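/- **Setting.** Let $V$ be a finite-dimensional real vector space, $I$ a finite set, $(\alpha_i)_{i\in I}$ a free family in $V^*$ and $(\alpha_i^\vee)_{i\in I}$ a family in $V$ with $\alpha_i(\alpha_i^\vee)=2$; put $r_i(v)=v-\alpha_i(v)\alpha_i^\vee$, $W^v=\langle r_i\mid i\in I\rangle$, $W^v(J)=\langle r_i\mid i\in J\rangle$ for $J\subset I$, $\Phi=\{w\alpha_i\}$ and $r_{w\alpha_i}=wr_iw^{-1}$. Assume that $(W^v,(r_i))$ is a Coxeter system with length $\ell$, that every root in $\Phi$ is a combination of the $\alpha_i$ with coefficients all $\ge 0$ (positive) or all $\le 0$, that $w\alpha_i$ is positive iff $\ell(wr_i)>\ell(w)$, and that $\Phi\cap\mathbb R_{>0}\alpha=\{\alpha\}$ for $\alpha\in\Phi$. Let $\Delta_{im}\subset V^*\setminus(\{0\}\cup\mathbb R\Phi)$ be stable under $\pm W^v$, consisting of combinations of the $\alpha_i$ with coefficients all $\ge0$ or all $\le0$, those of the first kind being stable under $W^v$; put $\Delta=\Phi\cup\Delta_{im}$. Let $\mathbb A$ be an affine space under $V$ (an origin is chosen, so $\mathbb A=V$)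 with a set $\mathcal M$ of hyperplanes (walls), each of the form $M(\alpha,k)=\{\alpha+k=0\}$ with $\alpha\in\Phi$, infinitely many for each $\alpha\in\Phi$, and stable under the group $W$ generated by the reflections $r_M$ in the walls $M=M(\alpha,k)$ with linear part $r_\alpha$. Put $\Gamma_\alpha=\{k\mid M(\alpha,k)\in\mathcal M\}$ for $\alpha\in\Phi$, $\Gamma_\alpha=\mathbb R$ for $\alpha\in\Delta_{im}$, $D(\alpha,k)=\{\alpha+k\ge0\}$, $D^\circ(\alpha,k)=\{\alpha+k>0\}$, $D(\alpha,\infty)=D^\circ(\alpha,\infty)=\mathbb A$. *Filters.* A set contains a filter if it is a member of it; a map fixes a filter if it fixes pointwise one of its members. The enclosure $cl(F)$ of a filter $F$ is the filter of sets containing a member of $F$ of the form $\bigcap_{\alpha\in\Delta}D(\alpha,k_\alpha)$, $k_\alpha\in\Gamma_\alpha\cup\{\infty\}$. The vectorial facets are the $\pm wF^v(J)$, $w\in W^v$, $J\subset I$, where $F^v(J)=\{v\mid\alpha_i(v)=0\ (i\in J),\ \alpha_i(v)>0\ (i\notin J)\}$; such a facet has type $J$, and it and $J$ are spherical if $W^v(J)$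 is finite. The facet $F(x,F^v)$ is the filter of sets containing an intersection of half-spaces $D(\alpha,k_\alpha)$ or $D^\circ(\alpha,k_\alpha)$ (one $k_\alpha\in\Gamma_\alpha\cup\{\infty\}$ for each $\alpha\in\Delta$) which contains the germ of $x+F^v$ at $x$. A chimney with base the facet $F$ and direction $F^v$ is $cl(F+F^v)$; its germ is the filter of sets containing $cl(F+\xi+F^v)$ for some $\xi\in\overline{F^v}$; it is splayed if $F^v$ is spherical, and solid if the direction of its support (the smallest affine subspace containing it) has finite fixator in $W^v$. The germ of the sector face $x+F^v$ is the filter of sets containing $x+\xi+F^v$ for some $\xi\in\overline{F^v}$. *Masures.* An affine masure of type $\mathbb A$ is a set $\mathcal I$ covered by a set $\mathcal A$ of subsets (apartments) such that: (MA1) each $A\in\mathcal A$ has a set $\mathrm{Isom}(\mathbb A,A)$ of bijections $\mathbb A\to A$ which is a single orbit $f\circ W$ (isomorphisms $A\to A'$ are the maps $f'\circ f^{-1}$; all notions of $\mathbb A$ are transported to $A$); (MA2) if $F$ is a point, the germ at $x$ of an interval $]x,y]$ with $y-x\ne0$ in a vectorial facet, a half-line with nonzero direction vector in a spherical vectorial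 facet, or a solid chimney of $A$, and $A'$ contains $F$, then $A\cap A'\supset cl_A(F)$ and some isomorphism $A\to A'$ fixes $cl_A(F)$; (MA3) a germ $\mathfrak R$ of a splayed chimney and $F$, a facet or a germ of a solid chimney, are contained in a common apartment; (MA4) if $A,A'$ both contain such $\mathfrak R$ and $F$, then $A\cap A'\supset cl_A(\mathfrak R\cup F)$ and some isomorphism $A\to A'$ fixes $cl_A(\mathfrak R\cup F)$. Two germs of spherical sector faces are parallel if, in some apartment containing both, they are germs of $x+F^v$ and $y+F^v$ with the same $F^v$. Let $\mathfrak F^\infty$ be the parallelism class (direction) of the germ of a sector face of spherical type $J$ and sign $\varepsilon=\pm$, and let $\mathcal I(\mathfrak F^\infty)$ be the set of sector-face germs in this class. For $A\in\mathcal A$ let $A(\mathfrak F^\infty)$ be the set of those contained in $A$. For a germ $\mathfrak R$ of a chimney with direction $\mathfrak F^\infty$, let $\mathfrak R_{\mathfrak F^\infty}$ be the filter of subsets of $\mathcal I(\mathfrak F^\infty)$ with base the sets $\{\mathfrak F\in\mathcal I(\mathfrak F^\infty)\mid S\text{ contains }\mathfrak F\}$, $S\in\mathfrak R$. Let $V_J=\bigcap_{i\in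 J}\ker\alpha_i$, let $\mathbb A_J=\mathbb A/V_J$ with walls $\mathcal M_J$ the images of the walls of direction $\ker\alpha$, $\alpha\in\Phi\cap\bigoplus_{i\in J}\mathbb R\alpha_i$, and let $W^J$ be the group of the elements of $W$ with linear part in $W^v(J)$. An $f\in\mathrm{Isom}(\mathbb A,A)$ which sends the direction $\varepsilon F^v(J)$ to $\mathfrak F^\infty$ induces $\bar f:\mathbb A_J\to A(\mathfrak F^\infty)$, $x+V_J\mapsto f(\text{germ of }x+\varepsilon F^v(J))$. **Proposition 4.3.** The set $\mathcal I(\mathfrak F^\infty)$, with facets the filters $\mathfrak R_{\mathfrak F^\infty}$ (for the germs $\mathfrak R$ of chimneys of direction $\mathfrak F^\infty$) and apartments the sets $A(\mathfrak F^\infty)$ (for the $A\in\mathcal A$ containing an element of $\mathcal I(\mathfrak F^\infty)$), is a Euclidean building of type $\mathbb A_J$, called the façade of $\mathcal I$ in the direction $\mathfrak F^\infty$. That is, there is a scalar product on $V/V_J$ such that: * $\mathbb A_J$ is a Euclidean apartment: $\mathcal M_J$ is stable under the orthogonal reflections in its members, and the group generated by the linear parts of these reflections is finite. The group $\overline{W^J}$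 induced by $W^J$ on $\mathbb A_J$ contains the group generated by these reflections and consists of isometries which stabilize $\mathcal M_J$ and have linear part in that finite group. * (I0) The apartments $A(\mathfrak F^\infty)$ cover $\mathcal I(\mathfrak F^\infty)$. For each of them the maps $\bar f$ as above exist, are bijections $\mathbb A_J\to A(\mathfrak F^\infty)$, and form a single orbit under $\overline{W^J}$; each identifies the closed facets of $\mathbb A_J$ (the enclosures, with respect to $\mathcal M_J$, of the germs at $x$ of $x+F'$, for $x\in\mathbb A_J$ and $F'$ a facet of the arrangement of the directions of the walls) with the facets $\mathfrak R_{\mathfrak F^\infty}$ contained in $A(\mathfrak F^\infty)$. * (I1) Any two facets are contained in a common apartment. * (I2) The intersection of two apartments is a union of facets, and for any two facets contained in it there is an isomorphism $\bar f'\circ\bar f^{-1}$ of the first apartment onto the second which fixes both facets. -/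

import Mathlib

open Filter Topology
open scoped Pointwise

/-! ## Euclidean apartments and Euclidean buildings -/

namespace EuclideanBuilding

variable {E : Type*} [AddCommGroup E] [Module ℝ E]

/-- The (affine) Weyl group of a set `walls` of affine hyperplanes of a space with scalar product
`B`: it is generated by the `B`-orthogonal reflections with respect to the walls. -/
def weylGroup (B : LinearMap.BilinForm ℝ E) (walls : Set (Set E)) : Subgroup (E ≃ᵃ[ℝ] E) :=
  Subgroup.closure {s | ∃ (n : E) (c : ℝ), n ≠ 0 ∧ {v | B n v = c} ∈ walls ∧
    ∀ v, s v = v - (2 * (B n v - c) / B n n) • n}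

/-- The vectorial Weyl group, generated by the linear parts of the reflections above. -/
def vectorialWeylGroup (B : LinearMap.BilinForm ℝ E) (walls : Set (Set E)) :
    Subgroup (E ≃ₗ[ℝ] E) :=
  Subgroup.closure {s | ∃ (n : E) (c : ℝ), n ≠ 0 ∧ {v | B n v = c} ∈ walls ∧
    ∀ v, s v = v - (2 * B n v / B n n) • n}

/-- `(E, B, walls)` is a Euclidean apartment: `B` is a scalar product, `walls` is a set of affine
hyperplanes stable under the reflections in its members, and the vectorial Weyl group is finite. -/
structure IsEuclideanApartment (B : LinearMap.BilinForm ℝ E) (walls : Set (Set E)) : Prop where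
  finiteDimensional : FiniteDimensional ℝ E
  symm : ∀ x y, B x y = B y x
  pos : ∀ x, x ≠ 0 → 0 < B x x
  hyperplane : ∀ M ∈ walls, ∃ (n : E) (c : ℝ), n ≠ 0 ∧ M = {v | B n v = c}
  stable : ∀ w ∈ weylGroup B walls, ∀ M ∈ walls, w '' M ∈ walls
  finite : (vectorialWeylGroup B walls : Set (E ≃ₗ[ℝ] E)).Finite

/-- The closed half-spaces bounded by a wall. -/
def halfSpaces (walls : Set (Set E)) : Set (Set E) :=
  {D | ∃ (φ : Module.Dual ℝ E) (k : ℝ), φ ≠ 0 ∧ {v | φ v + k = 0} ∈ walls ∧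
    D = {v | 0 ≤ φ v + k}}

/-- The enclosure of a filter `F`: the filter of sets containing a finite intersection of
half-spaces which are bounded by walls and contain `F`. (The walls of a Euclidean apartment have
finitely many directions, so one half-space for each direction and side amounts to this.) -/
def enclosure (walls : Set (Set E)) (F : Filter E) : Filter E :=
  Filter.generate {D | D ∈ halfSpaces walls ∧ D ∈ F}

/-- The vectorial facet of `u`: all the vectors having the same position as `u` with respect to
every vectorial wall, i.e. every direction of a wall. -/
def vectorialFacet (walls : Set (Set E)) (u : E) : Set E :=
  {u' | ∀ (φ : Module.Dual ℝ E) (k : ℝ), φ ≠ 0 → {v | φ v + k = 0} ∈ walls →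
    SignType.sign (φ u') = SignType.sign (φ u)}

/-- The closed facet attached to the point `x` and the vectorial facet of `u`: the enclosure of the
germ at `x` of `x + vectorialFacet u`. -/
def closedFacet [TopologicalSpace E] (walls : Set (Set E)) (x u : E) : Filter E :=
  enclosure walls (𝓝 x ⊓ 𝓟 ({x} + vectorialFacet walls u))

/-- `Y` with its set `facets` of (closed) facets, which are filters of subsets of `Y`, and its set
`apts` of apartments is a Euclidean building of type the Euclidean apartment `(E, B, walls)`.
For an apartment `A`, `isom A` is the set of isomorphisms of the type onto `A`: it is an orbit of a
group `G` of automorphisms of `(E, B, walls)` containing the Weyl group. An isomorphism `A → A'` is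
a map `f' ∘ f⁻¹` with `f ∈ isom A` and `f' ∈ isom A'`; it fixes a filter if it fixes pointwise
some member of the filter. A set contains a filter if it is a member of this filter. -/
structure IsEuclideanBuilding [TopologicalSpace E] (B : LinearMap.BilinForm ℝ E)
    (walls : Set (Set E)) (G : Subgroup (E ≃ᵃ[ℝ] E)) {Y : Type*} (apts : Set (Set Y))
    (isom : Set Y → Set (E → Y)) (facets : Set (Filter Y)) : Prop where
  apartment : IsEuclideanApartment B walls
  weyl_le : weylGroup B walls ≤ G
  linear_mem : ∀ g ∈ G, g.linear ∈ vectorialWeylGroup B walls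
  isometry : ∀ g ∈ G, ∀ x y, B (g x - g y) (g x - g y) = B (x - y) (x - y)
  walls_stable : ∀ g ∈ G, ∀ M ∈ walls, g '' M ∈ walls
  cover : ⋃₀ apts = Set.univ
  /-- every apartment is a Euclidean apartment isomorphic to the type ... -/
  I0 : ∀ A ∈ apts, (isom A).Nonempty ∧ ∀ f ∈ isom A, Function.Injective f ∧ Set.range f = A ∧
    ∀ g : E → Y, g ∈ isom A ↔ ∃ w ∈ G, g = f ∘ w
  /-- ... in which the facets of `Y` contained in it are the closed facets -/
  I0_facets : ∀ A ∈ apts, ∀ f ∈ isom A, ∀ F : Filter Y,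
    (F ∈ facets ∧ A ∈ F) ↔ ∃ x u : E, F = Filter.map f (closedFacet walls x u)
  /-- two facets are always contained in one apartment -/
  I1 : ∀ F ∈ facets, ∀ F' ∈ facets, ∃ A ∈ apts, A ∈ F ∧ A ∈ F'
  /-- the intersection of two apartments is a union of facets -/
  I2_union : ∀ A ∈ apts, ∀ A' ∈ apts, ∀ y ∈ A ∩ A', ∃ F ∈ facets, pure y ≤ F ∧ A ∩ A' ∈ F
  /-- two facets contained in `A ∩ A'` are fixed by an isomorphism of `A` onto `A'` -/
  I2_isom : ∀ A ∈ apts, ∀ A' ∈ apts, ∀ F ∈ facets, ∀ F' ∈ facets, A ∩ A' ∈ F → A ∩ A' ∈ F' →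
    ∃ f ∈ isom A, ∃ f' ∈ isom A',
      (∃ S ∈ F, ∀ p, f p ∈ S → f' p = f p) ∧ (∃ S ∈ F', ∀ p, f p ∈ S → f' p = f p)

end EuclideanBuilding

/-! ## The vectorial Weyl group and the roots -/

/-- A free family of simple roots `αᵢ` in the dual of `V` and a family of simple coroots in `V`. -/
structure RootBasis (V : Type*) [NormedAddCommGroup V] [NormedSpace ℝ V] (I : Type*) where
  root : I → Module.Dual ℝ V
  coroot : I → V
  root_coroot : ∀ i, root i (coroot i) = 2
  linearIndependent : LinearIndependent ℝ root

namespace RootBasis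

variable {V : Type*} [NormedAddCommGroup V] [NormedSpace ℝ V] {I : Type*} (R : RootBasis V I)

/-- The simple reflection `v ↦ v - αᵢ(v) αᵢ^∨`. -/
def refl (i : I) : V ≃ₗ[ℝ] V := Module.reflection (R.root_coroot i)

/-- The parabolic subgroup `W^v(J)`. -/
def parabolic (J : Set I) : Subgroup (V ≃ₗ[ℝ] V) := Subgroup.closure (R.refl '' J)

/-- The vectorial Weyl group `W^v`. -/
def weyl : Subgroup (V ≃ₗ[ℝ] V) := Subgroup.closure (Set.range R.refl)

/-- The simple reflection as an element of `W^v`. -/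
def reflW (i : I) : R.weyl := ⟨R.refl i, Subgroup.subset_closure ⟨i, rfl⟩⟩

/-- `J` is spherical if `W^v(J)` is finite. -/
def IsSpherical (J : Set I) : Prop := (R.parabolic J : Set (V ≃ₗ[ℝ] V)).Finite

/-- `α` is a real root with coroot `c`: `α = w αᵢ` and `c = w αᵢ^∨` for some `w ∈ W^v` and `i`. -/
def IsRootPair (α : Module.Dual ℝ V) (c : V) : Prop :=
  ∃ w ∈ R.weyl, ∃ i, α = R.root i ∘ₗ (w⁻¹ : V ≃ₗ[ℝ] V).toLinearMap ∧ c = w (R.coroot i)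

/-- The set `Φ` of real roots. -/
def realRoots : Set (Module.Dual ℝ V) := {α | ∃ c, R.IsRootPair α c}

/-- The linear forms which are combinations of simple roots with nonnegative coefficients. -/
def posCone [Fintype I] : Set (Module.Dual ℝ V) :=
  {α | ∃ c : I → ℝ, (∀ i, 0 ≤ c i) ∧ α = ∑ i, c i • R.root i}

/-- The facet `F^v(J)` of the closed fundamental chamber. -/
def fundFacet (J : Set I) : Set V :=
  {v | (∀ i ∈ J, R.root i v = 0) ∧ ∀ i, i ∉ J → 0 < R.root i v}

/-- The vectorial facet `ε w F^v(J)`, of sign `ε` and type `J`. -/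
def facetOf (ε : ℤˣ) (w : V ≃ₗ[ℝ] V) (J : Set I) : Set V :=
  (fun v => ε • w v) '' R.fundFacet J

/-- Vectorial facets, positive or negative. -/
def IsVectorialFacet (F : Set V) : Prop := ∃ ε, ∃ w ∈ R.weyl, ∃ J, F = R.facetOf ε w J

/-- Spherical vectorial facets, positive or negative. -/
def IsSphericalFacet (F : Set V) : Prop :=
  ∃ ε, ∃ w ∈ R.weyl, ∃ J, R.IsSpherical J ∧ F = R.facetOf ε w J

/-- The support `V_J` of `F^v(J)`. -/
def VJ (J : Set I) : Submodule ℝ V := ⨅ i ∈ J, LinearMap.ker (R.root i)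

end RootBasis

/-- The hyperplane `M(α, k)`. -/
def wallOf {V : Type*} [AddCommGroup V] [Module ℝ V] (α : Module.Dual ℝ V) (k : ℝ) : Set V :=
  {v | α v + k = 0}

/-- The closed half-space `D(α, k)`. -/
def halfOf {V : Type*} [AddCommGroup V] [Module ℝ V] (α : Module.Dual ℝ V) (k : ℝ) : Set V :=
  {v | 0 ≤ α v + k}

/-- The open half-space `D°(α, k)`. -/
def openHalfOf {V : Type*} [AddCommGroup V] [Module ℝ V] (α : Module.Dual ℝ V) (k : ℝ) : Set V :=
  {v | 0 < α v + k}

/-- The group generated by the reflections `v ↦ v - (α(v) + k) α^∨` in the hyperplanes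
`M(α, k)` of `walls`, `α` a real root. -/
def RootBasis.affineWeyl {V : Type*} [NormedAddCommGroup V] [NormedSpace ℝ V] {I : Type*}
    (R : RootBasis V I) (walls : Set (Set V)) : Subgroup (V ≃ᵃ[ℝ] V) :=
  Subgroup.closure {s | ∃ (α : Module.Dual ℝ V) (c : V) (k : ℝ), R.IsRootPair α c ∧
    wallOf α k ∈ walls ∧ ∀ v, s v = v - (α v + k) • c}

/-- The model affine apartment `𝔸` in the moderately imaginary case. An origin is chosen in the
affine space, which is thereby identified with its vector space `V`. -/
structure ModelApartment (V : Type*) [NormedAddCommGroup V] [NormedSpace ℝ V]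
    (I : Type*) [Fintype I] extends RootBasis V I where
  /-- `W^v` is a Coxeter group with generators the simple reflections, and the sign of `w αᵢ` is
  given by the length function -/
  coxeter : ∃ (M : CoxeterMatrix I) (cs : CoxeterSystem M toRootBasis.weyl),
    (∀ i, cs.simple i = toRootBasis.reflW i) ∧
    ∀ (w : toRootBasis.weyl) (i : I),
      root i ∘ₗ (w⁻¹ : V ≃ₗ[ℝ] V).toLinearMap ∈ toRootBasis.posCone ↔
        cs.length w < cs.length (w * toRootBasis.reflW i)
  /-- every real root is positive or negative -/
  pos_or_neg : ∀ α ∈ toRootBasis.realRoots, α ∈ toRootBasis.posCone ∨ -α ∈ toRootBasis.posCone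
  /-- the only positive multiple of a real root which is a real root is this root -/
  reduced : ∀ α ∈ toRootBasis.realRoots, ∀ c : ℝ, 0 < c → c • α ∈ toRootBasis.realRoots → c = 1
  /-- the set of imaginary roots -/
  imRoots : Set (Module.Dual ℝ V)
  im_ne_zero : (0 : Module.Dual ℝ V) ∉ imRoots
  im_disjoint : ∀ α ∈ toRootBasis.realRoots, ∀ c : ℝ, c • α ∉ imRoots
  im_neg : ∀ α ∈ imRoots, -α ∈ imRoots
  im_pos_or_neg : ∀ α ∈ imRoots, α ∈ toRootBasis.posCone ∨ -α ∈ toRootBasis.posCone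
  im_stable : ∀ α ∈ imRoots, ∀ w ∈ toRootBasis.weyl,
    α ∘ₗ (w⁻¹ : V ≃ₗ[ℝ] V).toLinearMap ∈ imRoots
  im_pos_stable : ∀ α ∈ imRoots, α ∈ toRootBasis.posCone → ∀ w ∈ toRootBasis.weyl,
    α ∘ₗ (w⁻¹ : V ≃ₗ[ℝ] V).toLinearMap ∈ toRootBasis.posCone
  /-- the set of (real) walls -/
  walls : Set (Set V)
  wall_eq : ∀ M ∈ walls, ∃ α ∈ toRootBasis.realRoots, ∃ k, M = wallOf α k
  infinite_walls : ∀ α ∈ toRootBasis.realRoots, {k | wallOf α k ∈ walls}.Infinite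
  walls_stable : ∀ w ∈ toRootBasis.affineWeyl walls, ∀ M ∈ walls, w '' M ∈ walls

namespace ModelApartment

variable {V : Type*} [NormedAddCommGroup V] [NormedSpace ℝ V] {I : Type*} [Fintype I]
  (𝔸 : ModelApartment V I)

/-- The affine Weyl group `W`. -/
def W : Subgroup (V ≃ᵃ[ℝ] V) := 𝔸.affineWeyl 𝔸.walls

/-- The set `Δ` of all roots. -/
def roots : Set (Module.Dual ℝ V) := 𝔸.realRoots ∪ 𝔸.imRoots

/-- The set `Γ_α`: the `k` such that `M(α, k)` is a wall, and all of `ℝ` for `α` imaginary. -/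
def Gam (α : Module.Dual ℝ V) : Set ℝ :=
  {k | (α ∈ 𝔸.realRoots ∧ wallOf α k ∈ 𝔸.walls) ∨ α ∈ 𝔸.imRoots}

/-- The enclosure `cl(F)`: the filter of sets containing a member of `F` of the form
`⋂_{α ∈ Δ} D(α, k_α)`, with one `k_α ∈ Γ_α ∪ {∞}` for each root `α`, where `D(α, ∞)` is the whole
space. (These intersections are stable under finite intersections.) -/
def cl (F : Filter V) : Filter V :=
  Filter.generate {S | S ∈ F ∧ ∃ D : Module.Dual ℝ V → Set V,
    (∀ α ∈ 𝔸.roots, D α = Set.univ ∨ ∃ k ∈ 𝔸.Gam α, D α = halfOf α k) ∧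
    S = ⋂ α ∈ 𝔸.roots, D α}

/-- The local facet `germ_x(x + F^v)`. -/
def localFacet (x : V) (Fv : Set V) : Filter V := 𝓝 x ⊓ 𝓟 ({x} + Fv)

/-- The facet `F(x, F^v)`: the filter of sets containing an intersection of half-spaces
`D(α, k_α)` or `D°(α, k_α)`, with one `k_α ∈ Γ_α ∪ {∞}` for each root `α`, this intersection
containing the local facet. -/
def facet (x : V) (Fv : Set V) : Filter V :=
  Filter.generate {S | S ∈ localFacet x Fv ∧ ∃ D : Module.Dual ℝ V → Set V,
    (∀ α ∈ 𝔸.roots, D α = Set.univ ∨ ∃ k ∈ 𝔸.Gam α, D α = halfOf α k ∨ D α = openHalfOf α k) ∧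
    S = ⋂ α ∈ 𝔸.roots, D α}

/-- The support of a filter: the smallest affine subspace containing it. -/
def support (F : Filter V) : AffineSubspace ℝ V :=
  sInf {E : AffineSubspace ℝ V | (E : Set V) ∈ F}

/-- The chimney with base `F(x, F₀^v)` and direction `F^v`, shortened by `ξ`
(`ξ = 0` is the chimney itself): `cl(F(x, F₀^v) + ξ + F^v)`. -/
def chimney (x : V) (F₀ Fv : Set V) (ξ : V) : Filter V :=
  𝔸.cl (𝔸.facet x F₀ + 𝓟 ({ξ} + Fv))

/-- The germ of the chimney: the filter of sets containing one of its shortenings. -/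
def chimneyGerm (x : V) (F₀ Fv : Set V) : Filter V :=
  ⨅ ξ ∈ closure Fv, 𝔸.chimney x F₀ Fv ξ

/-- The chimney is solid: the direction of its support has a finite fixator in `W^v`. -/
def IsSolid (x : V) (F₀ Fv : Set V) : Prop :=
  {w | w ∈ 𝔸.weyl ∧ ∀ v ∈ (support (𝔸.chimney x F₀ Fv 0)).direction, w v = v}.Finite

/-- The germ of the sector face `x + F^v`: the filter of sets containing one of its shortenings
`x + ξ + F^v`. -/
def sectorFaceGerm (x : V) (Fv : Set V) : Filter V :=
  ⨅ ξ ∈ closure Fv, 𝓟 ({x + ξ} + Fv)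

/-- Germs of splayed chimneys: those whose direction is spherical. -/
def IsSplayedChimneyGerm (F : Filter V) : Prop :=
  ∃ x F₀ Fv, 𝔸.IsVectorialFacet F₀ ∧ 𝔸.IsSphericalFacet Fv ∧ F = 𝔸.chimneyGerm x F₀ Fv

/-- Facets and germs of solid chimneys. -/
def IsFacetOrSolidChimneyGerm (F : Filter V) : Prop :=
  (∃ x Fv, 𝔸.IsVectorialFacet Fv ∧ F = 𝔸.facet x Fv) ∨
  ∃ x F₀ Fv, 𝔸.IsVectorialFacet F₀ ∧ 𝔸.IsVectorialFacet Fv ∧ 𝔸.IsSolid x F₀ Fv ∧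
    F = 𝔸.chimneyGerm x F₀ Fv

/-- Points, germs of preordered intervals `]x, x + u)`, generic half-lines and solid chimneys. -/
def IsMA2Filter (F : Filter V) : Prop :=
  (∃ x, F = pure x) ∨
  (∃ x u, u ≠ 0 ∧ (∃ Fv, 𝔸.IsVectorialFacet Fv ∧ u ∈ Fv) ∧
    F = 𝓝 x ⊓ 𝓟 ((fun t : ℝ => x + t • u) '' Set.Ioc 0 1)) ∨
  (∃ x u, u ≠ 0 ∧ (∃ Fv, 𝔸.IsSphericalFacet Fv ∧ u ∈ Fv) ∧
    F = 𝓟 ((fun t : ℝ => x + t • u) '' Set.Ici 0)) ∨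
  ∃ x F₀ Fv, 𝔸.IsVectorialFacet F₀ ∧ 𝔸.IsVectorialFacet Fv ∧ 𝔸.IsSolid x F₀ Fv ∧
    F = 𝔸.chimney x F₀ Fv 0

/-- The walls of `𝔸_J = 𝔸 / V_J`: the images of the walls of `𝔸` whose direction is the kernel
of a root `α ∈ Φ_J`, i.e. a real root in the span of the `αᵢ`, `i ∈ J`. -/
def wallsJ (J : Set I) : Set (Set (V ⧸ 𝔸.VJ J)) :=
  {N | ∃ α ∈ 𝔸.realRoots, α ∈ Submodule.span ℝ (𝔸.root '' J) ∧
    ∃ k, wallOf α k ∈ 𝔸.walls ∧ N = (𝔸.VJ J).mkQ '' wallOf α k}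

/-- The group of affine transformations of `𝔸_J` induced by `W^J`, the subgroup of the elements of
`W` with linear part in `W^v(J)`. -/
def WJ (J : Set I) : Subgroup ((V ⧸ 𝔸.VJ J) ≃ᵃ[ℝ] (V ⧸ 𝔸.VJ J)) where
  carrier := {g | ∃ w ∈ 𝔸.W, w.linear ∈ 𝔸.parabolic J ∧
    ∀ x, g ((𝔸.VJ J).mkQ x) = (𝔸.VJ J).mkQ (w x)}
  one_mem' := ⟨1, one_mem _, one_mem (𝔸.parabolic J), fun _ => rfl⟩
  mul_mem' := by
    rintro g h ⟨w, hw, hwl, hg⟩ ⟨w', hw', hwl', hh⟩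
    refine ⟨w * w', mul_mem hw hw', mul_mem (S := Subgroup (V ≃ₗ[ℝ] V)) hwl hwl', fun x => ?_⟩
    simp only [AffineEquiv.coe_mul, Function.comp_apply, hh, hg]
  inv_mem' := by
    rintro g ⟨w, hw, hwl, hg⟩
    refine ⟨w⁻¹, inv_mem hw, inv_mem (S := Subgroup (V ≃ₗ[ℝ] V)) hwl, fun x => ?_⟩
    rw [AffineEquiv.inv_def, AffineEquiv.symm_apply_eq, hg, AffineEquiv.inv_def,
      AffineEquiv.apply_symm_apply]

end ModelApartment

/-! ## Affine masures -/

/-- An affine masure of type `𝔸` with set of points `X`. For an apartment `A`, `isom A` is the set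
`Isom(𝔸, A)`; the objects of `A` (facets, chimneys, ...) are the images of those of `𝔸` under an
element of `isom A`. An isomorphism of `A` onto `A'` is a map `f' ∘ f⁻¹` with `f ∈ isom A` and
`f' ∈ isom A'`; that it fixes the image under `f` of a filter `F` of `𝔸`, i.e. fixes pointwise
a member of it, means `f =ᶠ[F] f'`, and then `A ∩ A'` contains this image. -/
structure Masure {V : Type*} [NormedAddCommGroup V] [NormedSpace ℝ V] {I : Type*} [Fintype I]
    (𝔸 : ModelApartment V I) (X : Type*) where
  apts : Set (Set X)
  cover : ⋃₀ apts = Set.univ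
  isom : Set X → Set (V → X)
  MA1 : ∀ A ∈ apts, (isom A).Nonempty ∧ ∀ f ∈ isom A, Function.Injective f ∧ Set.range f = A ∧
    ∀ g : V → X, g ∈ isom A ↔ ∃ w ∈ 𝔸.W, g = f ∘ w
  MA2 : ∀ A ∈ apts, ∀ A' ∈ apts, ∀ f ∈ isom A, ∀ F, 𝔸.IsMA2Filter F →
    A' ∈ Filter.map f F → ∃ f' ∈ isom A', f =ᶠ[𝔸.cl F] f'
  MA3 : ∀ A₁ ∈ apts, ∀ A₂ ∈ apts, ∀ f₁ ∈ isom A₁, ∀ f₂ ∈ isom A₂, ∀ R F,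
    𝔸.IsSplayedChimneyGerm R → 𝔸.IsFacetOrSolidChimneyGerm F →
    ∃ A ∈ apts, A ∈ Filter.map f₁ R ∧ A ∈ Filter.map f₂ F
  MA4 : ∀ A ∈ apts, ∀ A' ∈ apts, ∀ f ∈ isom A, ∀ R F,
    𝔸.IsSplayedChimneyGerm R → 𝔸.IsFacetOrSolidChimneyGerm F →
    A' ∈ Filter.map f R → A' ∈ Filter.map f F → ∃ f' ∈ isom A', f =ᶠ[𝔸.cl (R ⊔ F)] f'

namespace Masure

variable {V : Type*} [NormedAddCommGroup V] [NormedSpace ℝ V] {I : Type*} [Fintype I]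
  {𝔸 : ModelApartment V I} {X : Type*} (ℐ : Masure 𝔸 X)

/-- `F` is the germ of a sector face of sign `ε` and type `J`. -/
def IsSectorFaceGerm (ε : ℤˣ) (J : Set I) (F : Filter X) : Prop :=
  ∃ A ∈ ℐ.apts, ∃ f ∈ ℐ.isom A, ∃ x, ∃ w ∈ 𝔸.weyl,
    F = Filter.map f (ModelApartment.sectorFaceGerm x (𝔸.facetOf ε w J))

/-- Two germs of spherical sector faces are parallel if they have the same direction in some
apartment containing both. -/
def Parallel (F F' : Filter X) : Prop :=
  ∃ A ∈ ℐ.apts, ∃ f ∈ ℐ.isom A, ∃ (x y : V) (Fv : Set V), 𝔸.IsSphericalFacet Fv ∧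
    F = Filter.map f (ModelApartment.sectorFaceGerm x Fv) ∧
    F' = Filter.map f (ModelApartment.sectorFaceGerm y Fv)

/-- The façade `ℐ(𝔉^∞)` in the direction `𝔉^∞` of the germ `F₀`, i.e. its class for the
parallelism: the set of germs of sector faces parallel to `F₀`. -/
def Facade (F₀ : Filter X) : Type _ := {F : Filter X // ℐ.Parallel F₀ F}

/-- The set `A(𝔉^∞)` of the elements of the façade which are contained in `A`. -/
def facadeApt (F₀ : Filter X) (A : Set X) : Set (ℐ.Facade F₀) := {F | A ∈ F.1}

/-- The apartments of the façade: the `A(𝔉^∞)` for the apartments `A` containing an element of the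
façade. -/
def facadeApts (F₀ : Filter X) : Set (Set (ℐ.Facade F₀)) :=
  {B | ∃ A ∈ ℐ.apts, (ℐ.facadeApt F₀ A).Nonempty ∧ B = ℐ.facadeApt F₀ A}

/-- The identifications of `𝔸_J` with the apartment `B` of the façade: the maps induced by
those isomorphisms `f` of `𝔸` onto an apartment `A` with `B = A(𝔉^∞)` which send the direction
`ε F^v(J)` to `𝔉^∞`; the class of `x` is sent to the image under `f` of the germ of
`x + ε F^v(J)`. -/
def facadeIsom (ε : ℤˣ) (J : Set I) (F₀ : Filter X) (B : Set (ℐ.Facade F₀)) :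
    Set ((V ⧸ 𝔸.VJ J) → ℐ.Facade F₀) :=
  {g | ∃ A ∈ ℐ.apts, B = ℐ.facadeApt F₀ A ∧ ∃ f ∈ ℐ.isom A, ∀ x : V,
    (g ((𝔸.VJ J).mkQ x)).1 =
      Filter.map f (ModelApartment.sectorFaceGerm x (𝔸.facetOf ε 1 J))}

/-- `R` is the germ of a (splayed) chimney with direction the direction of `F₀`. -/
def IsChimneyGermOfDirection (F₀ R : Filter X) : Prop :=
  ∃ A ∈ ℐ.apts, ∃ f ∈ ℐ.isom A, ∃ x F₁ Fv, 𝔸.IsVectorialFacet F₁ ∧ 𝔸.IsSphericalFacet Fv ∧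
    R = Filter.map f (𝔸.chimneyGerm x F₁ Fv) ∧
    ℐ.Parallel F₀ (Filter.map f (ModelApartment.sectorFaceGerm x Fv))

/-- The filter of subsets of the façade attached to a filter `R` on `X`: a base is formed by the
sets of all elements of the façade contained in `S`, for `S ∈ R`. -/
def facadeFilter (F₀ R : Filter X) : Filter (ℐ.Facade F₀) :=
  R.lift' fun S => {F | S ∈ F.1}

/-- The facets of the façade. -/
def facadeFacets (F₀ : Filter X) : Set (Filter (ℐ.Facade F₀)) :=
  {𝓕 | ∃ R, ℐ.IsChimneyGermOfDirection F₀ R ∧ 𝓕 = ℐ.facadeFilter F₀ R}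

end Masure

/-!
Inside one apartment, the germs of the sector faces `x + ε F^v(J)` and `y + ε F^v(J)` coincide
exactly when `y - x ∈ V_J`, so an apartment of the façade is a copy of `𝔸_J = 𝔸 / V_J`. The scalar
product on `V / V_J` is an average over the finite group `W^v(J)`.

Far away in the direction `ε F^v(J)`, only the roots vanishing on this facet restrict a germ of
chimney. They are the roots of `Φ_J`, finite in number, and none of them is imaginary; so the filter
on the façade which comes from such a germ is the enclosure of a local facet of `𝔸_J`.

As `J` is spherical, these germs of chimneys are splayed and solid: (MA3) puts two of them into one
apartment, which gives (I1), and (MA4) provides an isomorphism between two apartments which is the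
identity on their enclosure, which gives (I2). The transitivity of parallelism holds because
parallelism with a fixed germ is locally constant along the segments of an apartment.
-/

/-! ## Reflections and roots -/

section LinearForms

variable {K E : Type*} [Field K] [AddCommGroup E] [Module K E]

lemma eq_smul_of_reflection_eq [NeZero (2 : K)] {f g : Module.Dual K E} {x y : E} (hx : f x = 2)
    (hy : g y = 2) (h : Module.reflection hx = Module.reflection hy) : f = (f y / 2) • g := by
  have two_ne : (2 : K) ≠ 0 := NeZero.ne 2
  ext v
  have hv : f v • x = g v • y := by
    have := LinearEquiv.congr_fun h v
    rwa [Module.reflection_apply, Module.reflection_apply, sub_right_inj] at this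
  have : f v * 2 = g v * f y := by simpa [hx] using congrArg f hv
  rw [LinearMap.smul_apply, smul_eq_mul]
  field_simp
  rw [this, mul_comm]

lemma exists_forall_apply_eq_of_linearIndependent [FiniteDimensional K E] {ι : Type*}
    {a : ι → Module.Dual K E} (ha : LinearIndependent K a) (c : ι → K) : ∃ v, ∀ i, a i v = c i := by
  obtain ⟨φ, hφ⟩ := LinearMap.dualMap_surjective_of_injective ha (Finsupp.linearCombination K c)
  obtain ⟨v, rfl⟩ := (Module.evalEquiv K E).surjective φ
  refine ⟨v, fun i => ?_⟩
  simpa using LinearMap.congr_fun hφ (Finsupp.single i 1)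

end LinearForms

namespace RootBasis

variable {V : Type*} [NormedAddCommGroup V] [NormedSpace ℝ V] {I : Type*} {R : RootBasis V I}

lemma refl_apply (i : I) (v : V) : R.refl i v = v - R.root i v • R.coroot i :=
  Module.reflection_apply _ _

lemma refl_mem_weyl (i : I) : R.refl i ∈ R.weyl := Subgroup.subset_closure ⟨i, rfl⟩

lemma parabolic_le_weyl (J : Set I) : R.parabolic J ≤ R.weyl :=
  Subgroup.closure_mono (Set.image_subset_range _ _)

lemma mem_VJ {J : Set I} {v : V} : v ∈ R.VJ J ↔ ∀ j ∈ J, R.root j v = 0 := by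
  simp [VJ]

lemma apply_eq_self_of_mem_parabolic {J : Set I} {w : V ≃ₗ[ℝ] V} (hw : w ∈ R.parabolic J) {v : V}
    (hv : v ∈ R.VJ J) : w v = v := by
  suffices R.parabolic J ≤ MulAction.stabilizer (V ≃ₗ[ℝ] V) v from this hw
  refine (Subgroup.closure_le _).2 ?_
  rintro _ ⟨j, hj, rfl⟩
  rw [SetLike.mem_coe, MulAction.mem_stabilizer_iff, LinearEquiv.smul_def, refl_apply,
    mem_VJ.1 hv j hj, zero_smul, sub_zero]

lemma mem_span_root_iff [Finite I] {J : Set I} {α : Module.Dual ℝ V} :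
    α ∈ Submodule.span ℝ (R.root '' J) ↔ ∀ v ∈ R.VJ J, α v = 0 := by
  refine ⟨fun h v hv => ?_, fun h => ?_⟩
  · have hle : Submodule.span ℝ (R.root '' J) ≤ LinearMap.ker (Module.Dual.eval ℝ V v) := by
      rw [Submodule.span_le]
      rintro _ ⟨j, hj, rfl⟩
      exact mem_VJ.1 hv j hj
    exact hle h
  · rw [Set.image_eq_range]
    refine mem_span_of_iInf_ker_le_ker fun v hv => h v (mem_VJ.2 fun j hj => ?_)
    exact (Submodule.mem_iInf _).1 hv ⟨j, hj⟩

lemma fundFacet_nonempty [FiniteDimensional ℝ V] (J : Set I) : (R.fundFacet J).Nonempty := by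
  classical
  obtain ⟨v, hv⟩ := exists_forall_apply_eq_of_linearIndependent R.linearIndependent
    (fun i => if i ∈ J then 0 else 1)
  exact ⟨v, fun i hi => by rw [hv, if_pos hi], fun i hi => by rw [hv, if_neg hi]; exact one_pos⟩

lemma fundFacet_subset_VJ (J : Set I) : R.fundFacet J ⊆ R.VJ J := fun _ hv => mem_VJ.2 hv.1

namespace IsRootPair

variable {α : Module.Dual ℝ V} {c : V}

lemma apply_eq_two (h : R.IsRootPair α c) : α c = 2 := by
  obtain ⟨u, -, i, rfl, rfl⟩ := h
  simp [R.root_coroot]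

lemma comp (h : R.IsRootPair α c) {w : V ≃ₗ[ℝ] V} (hw : w ∈ R.weyl) :
    R.IsRootPair (α ∘ₗ w.toLinearMap) (w⁻¹ c) := by
  obtain ⟨u, hu, i, rfl, rfl⟩ := h
  refine ⟨w⁻¹ * u, mul_mem (inv_mem hw) hu, i, ?_, rfl⟩
  rw [mul_inv_rev, inv_inv]
  rfl

lemma reflection_mem_weyl (h : R.IsRootPair α c) :
    Module.reflection h.apply_eq_two ∈ R.weyl := by
  obtain ⟨u, hu, i, rfl, rfl⟩ := id h
  have hconj : Module.reflection h.apply_eq_two = u * R.refl i * u⁻¹ := by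
    ext v
    simp [Module.reflection_apply, refl_apply]
  exact hconj ▸ mul_mem (mul_mem hu (refl_mem_weyl i)) (inv_mem hu)

lemma neg (h : R.IsRootPair α c) : R.IsRootPair (-α) (-c) := by
  have hα : α ∘ₗ (Module.reflection h.apply_eq_two).toLinearMap = -α := by
    ext v
    simp only [LinearMap.comp_apply, LinearEquiv.coe_coe, Module.reflection_apply, map_sub,
      map_smul, h.apply_eq_two, LinearMap.neg_apply, smul_eq_mul]
    ring
  have hc : (Module.reflection h.apply_eq_two)⁻¹ c = -c := by
    rw [Module.reflection_inv, Module.reflection_apply_self]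
  simpa only [hα, hc] using h.comp h.reflection_mem_weyl

end IsRootPair

lemma root_mem_realRoots (i : I) : R.root i ∈ R.realRoots := ⟨_, 1, one_mem _, i, rfl, rfl⟩

lemma ne_zero_of_mem_realRoots {α : Module.Dual ℝ V} (h : α ∈ R.realRoots) : α ≠ 0 := by
  obtain ⟨c, hc⟩ := h
  rintro rfl
  simpa using hc.apply_eq_two

lemma comp_mem_realRoots {α : Module.Dual ℝ V} (h : α ∈ R.realRoots) {w : V ≃ₗ[ℝ] V}
    (hw : w ∈ R.weyl) : α ∘ₗ w.toLinearMap ∈ R.realRoots :=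
  let ⟨_, hc⟩ := h; ⟨_, hc.comp hw⟩

lemma neg_mem_realRoots {α : Module.Dual ℝ V} (h : α ∈ R.realRoots) : -α ∈ R.realRoots :=
  let ⟨_, hc⟩ := h; ⟨_, hc.neg⟩

variable (R) in
/-- The closed fundamental chamber. -/
def closedChamber : Set V := {v | ∀ i, 0 ≤ R.root i v}

lemma fundFacet_subset_closedChamber (J : Set I) : R.fundFacet J ⊆ R.closedChamber := fun _ hv i =>
  (em (i ∈ J)).elim (fun h => (hv.1 i h).ge) fun h => (hv.2 i h).le

lemma nonneg_of_mem_posCone [Fintype I] {α : Module.Dual ℝ V} (h : α ∈ R.posCone) {v : V}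
    (hv : v ∈ R.closedChamber) : 0 ≤ α v := by
  obtain ⟨c, hc, rfl⟩ := h
  simp only [LinearMap.sum_apply, LinearMap.smul_apply, smul_eq_mul]
  exact Finset.sum_nonneg fun i _ => mul_nonneg (hc i) (hv i)

variable (R) in
/-- The set `Φ_J` of real roots which are combinations of the simple roots `αⱼ`, `j ∈ J`. -/
def rootsJ (J : Set I) : Set (Module.Dual ℝ V) :=
  {α | α ∈ R.realRoots ∧ α ∈ Submodule.span ℝ (R.root '' J)}

section RootsJ

variable {J : Set I} {α : Module.Dual ℝ V}

lemma root_mem_rootsJ {j : I} (hj : j ∈ J) : R.root j ∈ R.rootsJ J :=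
  ⟨root_mem_realRoots j, Submodule.subset_span ⟨j, hj, rfl⟩⟩

lemma neg_mem_rootsJ (h : α ∈ R.rootsJ J) : -α ∈ R.rootsJ J :=
  ⟨neg_mem_realRoots h.1, neg_mem h.2⟩

variable [Finite I]

lemma apply_eq_zero_of_mem_rootsJ (h : α ∈ R.rootsJ J) {v : V} (hv : v ∈ R.VJ J) : α v = 0 :=
  mem_span_root_iff.1 h.2 v hv

lemma comp_mem_rootsJ (h : α ∈ R.rootsJ J) {w : V ≃ₗ[ℝ] V} (hw : w ∈ R.parabolic J) :
    α ∘ₗ w.toLinearMap ∈ R.rootsJ J := by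
  refine ⟨comp_mem_realRoots h.1 (parabolic_le_weyl J hw), mem_span_root_iff.2 fun v hv => ?_⟩
  rw [LinearMap.comp_apply, LinearEquiv.coe_coe, apply_eq_self_of_mem_parabolic hw hv,
    apply_eq_zero_of_mem_rootsJ h hv]

end RootsJ

end RootBasis

namespace ModelApartment

variable {V : Type*} [NormedAddCommGroup V] [NormedSpace ℝ V] {I : Type*} [Fintype I]
  {𝔸 : ModelApartment V I}

variable (𝔸) in
lemma exists_length_descent : ∃ ℓ : 𝔸.weyl → ℕ, ∀ w, w ≠ 1 → ∃ i, ℓ (w * 𝔸.reflW i) < ℓ w ∧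
    -(𝔸.root i ∘ₗ (w⁻¹ : V ≃ₗ[ℝ] V).toLinearMap) ∈ 𝔸.posCone := by
  obtain ⟨M, cs, hs, hpos⟩ := 𝔸.coxeter
  refine ⟨cs.length, fun w hw => ?_⟩
  obtain ⟨i, hi⟩ := cs.exists_rightDescent_of_ne_one hw
  rw [CoxeterSystem.IsRightDescent, hs] at hi
  have hroot := 𝔸.pos_or_neg _ (RootBasis.comp_mem_realRoots (RootBasis.root_mem_realRoots i)
    (inv_mem w.2))
  exact ⟨i, hi, hroot.resolve_left fun h => ((hpos w i).1 h).asymm hi⟩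

lemma apply_eq_self_and_mem_parabolic_of_mem_closedChamber {w : V ≃ₗ[ℝ] V} (hw : w ∈ 𝔸.weyl) {v : V}
    (hv : v ∈ 𝔸.closedChamber) (hwv : w v ∈ 𝔸.closedChamber) :
    w v = v ∧ w ∈ 𝔸.parabolic {i | 𝔸.root i v = 0} := by
  obtain ⟨ℓ, hℓ⟩ := 𝔸.exists_length_descent
  induction h : ℓ ⟨w, hw⟩ using Nat.strong_induction_on generalizing w with
  | _ n ih =>
    by_cases hw1 : w = 1
    · subst hw1
      exact ⟨rfl, one_mem _⟩
    obtain ⟨i, hi, hneg⟩ := hℓ ⟨w, hw⟩ fun h => hw1 (congrArg Subtype.val h)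
    have hle : 𝔸.root i v ≤ 0 := by simpa using RootBasis.nonneg_of_mem_posCone hneg hwv
    have h0 : 𝔸.root i v = 0 := le_antisymm hle (hv i)
    have hfix : (w * 𝔸.refl i) v = w v := by simp [RootBasis.refl_apply, h0]
    obtain ⟨heq, hmem⟩ := ih _ (h ▸ hi) (mul_mem hw (RootBasis.refl_mem_weyl i))
      (by rwa [hfix]) rfl
    refine ⟨hfix ▸ heq, ?_⟩
    rw [← mul_inv_cancel_right w (𝔸.refl i)]
    exact mul_mem hmem (inv_mem (Subgroup.subset_closure ⟨i, h0, rfl⟩))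

lemma mem_parabolic_of_apply_mem_fundFacet {J : Set I} {w : V ≃ₗ[ℝ] V} (hw : w ∈ 𝔸.weyl) {v : V}
    (hv : v ∈ 𝔸.fundFacet J) (hwv : w v ∈ 𝔸.fundFacet J) : w ∈ 𝔸.parabolic J := by
  have hJ : {i | 𝔸.root i v = 0} = J :=
    Set.Subset.antisymm (fun i hi => by_contra fun hn => (hv.2 i hn).ne' hi) hv.1
  exact hJ ▸ (apply_eq_self_and_mem_parabolic_of_mem_closedChamber hw
    (RootBasis.fundFacet_subset_closedChamber J hv)
    (RootBasis.fundFacet_subset_closedChamber J hwv)).2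

lemma reflection_mem_parabolic [FiniteDimensional ℝ V] {J : Set I} {α : Module.Dual ℝ V} {c : V}
    (h : 𝔸.IsRootPair α c) (hα : α ∈ Submodule.span ℝ (𝔸.root '' J)) :
    Module.reflection h.apply_eq_two ∈ 𝔸.parabolic J := by
  obtain ⟨v, hv⟩ := RootBasis.fundFacet_nonempty (R := 𝔸.toRootBasis) J
  have hfix : Module.reflection h.apply_eq_two v = v := by
    rw [Module.reflection_apply, RootBasis.mem_span_root_iff.1 hα v
      (RootBasis.fundFacet_subset_VJ J hv), zero_smul, sub_zero]
  exact mem_parabolic_of_apply_mem_fundFacet h.reflection_mem_weyl hv (by rwa [hfix])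

lemma eq_or_eq_neg_of_reflection_eq {α β : Module.Dual ℝ V} {c d : V} (hα : 𝔸.IsRootPair α c)
    (hβ : 𝔸.IsRootPair β d)
    (h : Module.reflection hα.apply_eq_two = Module.reflection hβ.apply_eq_two) :
    α = β ∨ α = -β := by
  have heq := eq_smul_of_reflection_eq hα.apply_eq_two hβ.apply_eq_two h
  have hα' : α ∈ 𝔸.realRoots := ⟨c, hα⟩
  rcases lt_trichotomy (α d / 2) 0 with hneg | h0 | hpos
  · have hmul : (-(α d / 2)) • β = -α :=
      (neg_smul _ _).trans (congrArg Neg.neg heq.symm)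
    have h1 := 𝔸.reduced β ⟨d, hβ⟩ _ (neg_pos.2 hneg) (hmul ▸ RootBasis.neg_mem_realRoots hα')
    rw [h1, one_smul] at hmul
    exact Or.inr (by rw [hmul, neg_neg])
  · exact absurd (by rw [heq, h0, zero_smul]) (RootBasis.ne_zero_of_mem_realRoots hα')
  · rw [𝔸.reduced β ⟨d, hβ⟩ _ hpos (heq ▸ hα'), one_smul] at heq
    exact Or.inl heq

lemma finite_rootsJ [FiniteDimensional ℝ V] {J : Set I} (hJ : 𝔸.IsSpherical J) :
    (𝔸.rootsJ J).Finite := by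
  let fiber (s : V ≃ₗ[ℝ] V) : Set (Module.Dual ℝ V) :=
    {α | ∃ c, ∃ h : 𝔸.IsRootPair α c, Module.reflection h.apply_eq_two = s}
  have hfiber : ∀ s, (fiber s).Finite := fun s => by
    rcases (fiber s).eq_empty_or_nonempty with h | ⟨β, d, hβ, rfl⟩
    · exact h ▸ Set.finite_empty
    · refine (Set.toFinite {β, -β}).subset ?_
      rintro α ⟨c, hα, h⟩
      exact eq_or_eq_neg_of_reflection_eq hα hβ h
  refine (Set.Finite.biUnion hJ fun s _ => hfiber s).subset ?_
  rintro α ⟨⟨c, hα⟩, hspan⟩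
  exact Set.mem_biUnion (reflection_mem_parabolic hα hspan) ⟨c, hα, rfl⟩

end ModelApartment

/-! ## Vectorial facets -/

section FacetCone

variable {V : Type*} [NormedAddCommGroup V] [NormedSpace ℝ V] {I : Type*}

/-- The cone on which the forms `a i` vanish for `i ∈ J` and are positive for `i ∉ J`. Up to sign,
all vectorial facets have this form, for a family `a` of roots. -/
def facetCone (a : I → Module.Dual ℝ V) (J : Set I) : Set V :=
  {v | (∀ i ∈ J, a i v = 0) ∧ ∀ i, i ∉ J → 0 < a i v}

variable {a : I → Module.Dual ℝ V} {J : Set I}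

lemma smul_mem_facetCone {v : V} (hv : v ∈ facetCone a J) {t : ℝ} (ht : 0 < t) :
    t • v ∈ facetCone a J :=
  ⟨fun i hi => by rw [map_smul, hv.1 i hi, smul_zero],
    fun i hi => by rw [map_smul]; exact mul_pos ht (hv.2 i hi)⟩

lemma add_mem_facetCone {u v : V} (hu : u ∈ facetCone a J) (hv : v ∈ facetCone a J) :
    u + v ∈ facetCone a J :=
  ⟨fun i hi => by rw [map_add, hu.1 i hi, hv.1 i hi, add_zero],
    fun i hi => by rw [map_add]; exact add_pos (hu.2 i hi) (hv.2 i hi)⟩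

lemma zero_mem_closure_facetCone (hne : (facetCone a J).Nonempty) :
    (0 : V) ∈ closure (facetCone a J) := by
  obtain ⟨v, hv⟩ := hne
  have hlim : Tendsto (fun t : ℝ => t • v) (𝓝[>] 0) (𝓝 0) := by
    simpa using ((by fun_prop : Continuous fun t : ℝ => t • v).tendsto 0).mono_left
      nhdsWithin_le_nhds
  exact mem_closure_of_tendsto hlim
    (eventually_mem_nhdsWithin.mono fun t ht => smul_mem_facetCone hv ht)

lemma add_mem_closure_facetCone {u v : V} (hu : u ∈ closure (facetCone a J))
    (hv : v ∈ closure (facetCone a J)) : u + v ∈ closure (facetCone a J) :=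
  map_mem_closure₂ continuous_add hu hv fun _ hu _ hv => add_mem_facetCone hu hv

lemma mem_closure_facetCone_of_forall_add_smul_mem {u v : V}
    (h : ∀ t : ℝ, 0 < t → u + t • v ∈ facetCone a J) : v ∈ closure (facetCone a J) := by
  have hlim : Tendsto (fun t : ℝ => t⁻¹ • u + v) atTop (𝓝 v) := by
    simpa using ((tendsto_inv_atTop_zero (𝕜 := ℝ)).smul_const u).add_const v
  refine mem_closure_of_tendsto hlim ((eventually_gt_atTop 0).mono fun t ht => ?_)
  simpa [smul_smul, ht.ne'] using smul_mem_facetCone (h t ht) (inv_pos.2 ht)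

variable [FiniteDimensional ℝ V]

lemma eq_zero_and_nonneg_of_mem_closure_facetCone {v : V} (hv : v ∈ closure (facetCone a J)) :
    (∀ i ∈ J, a i v = 0) ∧ ∀ i, i ∉ J → 0 ≤ a i v := by
  have hcont i : Continuous (a i) := (a i).continuous_of_finiteDimensional
  exact ⟨fun i hi => closure_minimal (fun u hu => hu.1 i hi)
      (isClosed_eq (hcont i) continuous_const) hv,
    fun i hi => closure_minimal (fun u hu => (hu.2 i hi).le)
      (isClosed_le continuous_const (hcont i)) hv⟩

lemma add_mem_facetCone_of_mem_closure {u v : V} (hu : u ∈ closure (facetCone a J))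
    (hv : v ∈ facetCone a J) : u + v ∈ facetCone a J := by
  obtain ⟨hu₀, hu₁⟩ := eq_zero_and_nonneg_of_mem_closure_facetCone hu
  exact ⟨fun i hi => by rw [map_add, hu₀ i hi, hv.1 i hi, add_zero],
    fun i hi => by rw [map_add]; exact add_pos_of_nonneg_of_pos (hu₁ i hi) (hv.2 i hi)⟩

lemma exists_sub_smul_mem_facetCone [Finite I] {u v : V} (hv : v ∈ facetCone a J)
    (hu : ∀ i ∈ J, a i u = 0) : ∃ t : ℝ, 0 < t ∧ v - t • u ∈ facetCone a J := by
  have hpos : ∀ᶠ t in 𝓝[>] (0 : ℝ), ∀ i, i ∉ J → 0 < a i (v - t • u) := by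
    refine eventually_all.2 fun i => ?_
    rcases em (i ∈ J) with hi | hi
    · exact Eventually.of_forall fun t hn => absurd hi hn
    have hcont : Continuous fun t : ℝ => a i (v - t • u) :=
      (a i).continuous_of_finiteDimensional.comp (by fun_prop)
    have h0 : 0 < a i (v - (0 : ℝ) • u) := by simpa using hv.2 i hi
    filter_upwards [nhdsWithin_le_nhds (hcont.continuousAt.eventually (lt_mem_nhds h0))]
      with t ht _ using ht
  obtain ⟨t, hmem, ht⟩ := (hpos.and self_mem_nhdsWithin).exists
  refine ⟨t, ht, fun i hi => ?_, hmem⟩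
  rw [map_sub, map_smul, hu i hi, hv.1 i hi, smul_zero, sub_zero]

lemma facetCone_subset_of_closure_eq [Finite I] {b : I → Module.Dual ℝ V} {K : Set I}
    (hne : (facetCone a J).Nonempty) (h : closure (facetCone a J) = closure (facetCone b K)) :
    facetCone b K ⊆ facetCone a J := by
  intro v hv
  obtain ⟨u, hu⟩ := hne
  obtain ⟨t, ht, hmem⟩ := exists_sub_smul_mem_facetCone hv
    (eq_zero_and_nonneg_of_mem_closure_facetCone (h ▸ subset_closure hu)).1
  rw [← sub_add_cancel v (t • u)]
  exact add_mem_facetCone_of_mem_closure (h ▸ subset_closure hmem) (smul_mem_facetCone hu ht)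

open ModelApartment

lemma mem_sectorFaceGerm_facetCone (hne : (facetCone a J).Nonempty) {x : V} {S : Set V} :
    S ∈ sectorFaceGerm x (facetCone a J) ↔
      ∃ ξ ∈ closure (facetCone a J), ∀ v ∈ facetCone a J, x + ξ + v ∈ S := by
  have hle {ξ η : V} (hη : η ∈ closure (facetCone a J)) :
      𝓟 ({x + (ξ + η)} + facetCone a J) ≤ 𝓟 ({x + ξ} + facetCone a J) := by
    simp only [Set.singleton_add, principal_mono, Set.image_subset_iff]
    exact fun v hv => ⟨η + v, add_mem_facetCone_of_mem_closure hη hv, by simp only; abel⟩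
  rw [sectorFaceGerm, mem_biInf_of_directed]
  · simp only [mem_principal, Set.singleton_add, Set.image_subset_iff]
    rfl
  · intro ξ hξ η hη
    exact ⟨ξ + η, add_mem_closure_facetCone hξ hη, hle hη, add_comm ξ η ▸ hle hξ⟩
  · exact ⟨0, zero_mem_closure_facetCone hne⟩

lemma add_facetCone_mem_sectorFaceGerm (hne : (facetCone a J).Nonempty) (x : V) :
    {x} + facetCone a J ∈ sectorFaceGerm x (facetCone a J) :=
  (mem_sectorFaceGerm_facetCone hne).2 ⟨0, zero_mem_closure_facetCone hne,
    fun v hv => by rw [add_zero]; exact Set.add_mem_add rfl hv⟩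

lemma closure_facetCone_subset_of_sectorFaceGerm_eq {b : I → Module.Dual ℝ V} {K : Set I}
    (hne : (facetCone a J).Nonempty) (hne' : (facetCone b K).Nonempty) {x y : V}
    (h : sectorFaceGerm x (facetCone a J) = sectorFaceGerm y (facetCone b K)) :
    closure (facetCone b K) ⊆ closure (facetCone a J) := by
  have hmem := add_facetCone_mem_sectorFaceGerm hne x
  rw [h, mem_sectorFaceGerm_facetCone hne'] at hmem
  obtain ⟨η, -, hη⟩ := hmem
  refine closure_minimal (fun v hv => ?_) isClosed_closure
  refine mem_closure_facetCone_of_forall_add_smul_mem (u := y + η - x) fun t ht => ?_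
  have hshift := hη _ (smul_mem_facetCone hv ht)
  rw [Set.singleton_add, Set.mem_image] at hshift
  obtain ⟨u, hu, heq⟩ := hshift
  rwa [sub_add_eq_add_sub, ← heq, add_sub_cancel_left]

lemma facetCone_eq_of_sectorFaceGerm_eq [Finite I] {b : I → Module.Dual ℝ V} {K : Set I}
    (hne : (facetCone a J).Nonempty) (hne' : (facetCone b K).Nonempty) {x y : V}
    (h : sectorFaceGerm x (facetCone a J) = sectorFaceGerm y (facetCone b K)) :
    facetCone a J = facetCone b K := by
  have hcl : closure (facetCone a J) = closure (facetCone b K) :=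
    (closure_facetCone_subset_of_sectorFaceGerm_eq hne' hne h.symm).antisymm
      (closure_facetCone_subset_of_sectorFaceGerm_eq hne hne' h)
  exact (facetCone_subset_of_closure_eq hne' hcl.symm).antisymm
    (facetCone_subset_of_closure_eq hne hcl)

end FacetCone

section UnitsSMul

variable {M N F : Type*} [AddCommGroup M] [AddCommGroup N]

lemma units_smul_smul_self (ε : ℤˣ) (v : M) : ε • ε • v = v := by
  rw [smul_smul, Int.units_mul_self, one_smul]

lemma map_units_smul [FunLike F M N] [AddMonoidHomClass F M N] (φ : F) (ε : ℤˣ) (v : M) :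
    φ (ε • v) = ε • φ v :=
  map_zsmul φ (ε : ℤ) v

end UnitsSMul

namespace RootBasis

variable {V : Type*} [NormedAddCommGroup V] [NormedSpace ℝ V] {I : Type*} {R : RootBasis V I}
  {ε : ℤˣ} {w : V ≃ₗ[ℝ] V} {J : Set I} {v : V}

lemma mem_facetOf : v ∈ R.facetOf ε w J ↔ ε • w⁻¹ v ∈ R.fundFacet J := by
  refine ⟨?_, fun h => ⟨_, h, ?_⟩⟩
  · rintro ⟨u, hu, rfl⟩
    rwa [map_units_smul, units_smul_smul_self, ← LinearEquiv.mul_apply, inv_mul_cancel]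
  · simp only [map_units_smul, units_smul_smul_self]
    rw [← LinearEquiv.mul_apply, mul_inv_cancel, LinearEquiv.coe_one, id]

lemma mem_facetOf_one : v ∈ R.facetOf ε 1 J ↔ ε • v ∈ R.fundFacet J := by
  simp [mem_facetOf]

lemma facetOf_eq_facetCone (ε : ℤˣ) (w : V ≃ₗ[ℝ] V) (J : Set I) : R.facetOf ε w J =
    facetCone (fun i => (ε : ℤ) • (R.root i ∘ₗ (w⁻¹ : V ≃ₗ[ℝ] V).toLinearMap)) J := by
  ext v
  simp only [mem_facetOf, fundFacet, Set.mem_ofPred_eq, map_units_smul]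
  rfl

lemma facetOf_nonempty [FiniteDimensional ℝ V] (ε : ℤˣ) (w : V ≃ₗ[ℝ] V) (J : Set I) :
    (R.facetOf ε w J).Nonempty :=
  (fundFacet_nonempty J).image _

lemma image_facetOf (ε : ℤˣ) (w u : V ≃ₗ[ℝ] V) (J : Set I) :
    u '' R.facetOf ε w J = R.facetOf ε (u * w) J := by
  simp only [facetOf, Set.image_image, map_units_smul, LinearEquiv.mul_apply]

lemma smul_mem_facetOf (hv : v ∈ R.facetOf ε w J) {t : ℝ} (ht : 0 < t) :
    t • v ∈ R.facetOf ε w J := by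
  rw [facetOf_eq_facetCone] at *
  exact smul_mem_facetCone hv ht

lemma add_mem_facetOf {u : V} (hu : u ∈ R.facetOf ε w J) (hv : v ∈ R.facetOf ε w J) :
    u + v ∈ R.facetOf ε w J := by
  rw [facetOf_eq_facetCone] at *
  exact add_mem_facetCone hu hv

lemma add_mem_closure_facetOf {u : V} (hu : u ∈ closure (R.facetOf ε w J))
    (hv : v ∈ closure (R.facetOf ε w J)) : u + v ∈ closure (R.facetOf ε w J) := by
  rw [facetOf_eq_facetCone] at *
  exact add_mem_closure_facetCone hu hv

variable [FiniteDimensional ℝ V]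

lemma zero_mem_closure_facetOf : (0 : V) ∈ closure (R.facetOf ε w J) := by
  have hne := R.facetOf_nonempty ε w J
  rw [facetOf_eq_facetCone] at *
  exact zero_mem_closure_facetCone hne

lemma add_mem_facetOf_of_mem_closure {u : V} (hu : u ∈ closure (R.facetOf ε w J))
    (hv : v ∈ R.facetOf ε w J) : u + v ∈ R.facetOf ε w J := by
  rw [facetOf_eq_facetCone] at *
  exact add_mem_facetCone_of_mem_closure hu hv

lemma exists_add_smul_mem_facetOf_one [Finite I] {n : V} (hn : n ∈ R.VJ J)
    (hv : v ∈ R.facetOf ε 1 J) : ∃ t : ℝ, 0 < t ∧ n + t • v ∈ R.facetOf ε 1 J := by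
  rw [facetOf_eq_facetCone] at *
  obtain ⟨t, ht, hmem⟩ := exists_sub_smul_mem_facetCone hv (u := -n) fun i hi => by
    simp [mem_VJ.1 hn i hi]
  refine ⟨t⁻¹, inv_pos.2 ht, ?_⟩
  simpa [smul_smul, ht.ne', add_comm] using smul_mem_facetCone hmem (inv_pos.2 ht)

lemma mem_sectorFaceGerm {x : V} {S : Set V} :
    S ∈ ModelApartment.sectorFaceGerm x (R.facetOf ε w J) ↔
      ∃ ξ ∈ closure (R.facetOf ε w J), ∀ v ∈ R.facetOf ε w J, x + ξ + v ∈ S := by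
  have hne := R.facetOf_nonempty ε w J
  rw [facetOf_eq_facetCone] at *
  exact mem_sectorFaceGerm_facetCone hne

lemma add_facetOf_mem_sectorFaceGerm (x : V) :
    {x} + R.facetOf ε w J ∈ ModelApartment.sectorFaceGerm x (R.facetOf ε w J) := by
  have hne := R.facetOf_nonempty ε w J
  rw [facetOf_eq_facetCone] at *
  exact add_facetCone_mem_sectorFaceGerm hne x

lemma facetOf_eq_of_sectorFaceGerm_eq [Finite I] {ε' : ℤˣ} {w' : V ≃ₗ[ℝ] V} {J' : Set I} {x y : V}
    (h : ModelApartment.sectorFaceGerm x (R.facetOf ε w J) =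
      ModelApartment.sectorFaceGerm y (R.facetOf ε' w' J')) :
    R.facetOf ε w J = R.facetOf ε' w' J' := by
  have hne := R.facetOf_nonempty ε w J
  have hne' := R.facetOf_nonempty ε' w' J'
  simp only [facetOf_eq_facetCone] at *
  exact facetCone_eq_of_sectorFaceGerm_eq hne hne' h

end RootBasis

/-! ## Finite parabolic subgroups -/

namespace RootBasis

variable {V : Type*} [NormedAddCommGroup V] [NormedSpace ℝ V] {I : Type*} {R : RootBasis V I}
  {J : Set I}

lemma refl_mem_parabolic {j : I} (hj : j ∈ J) : R.refl j ∈ R.parabolic J :=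
  Subgroup.subset_closure ⟨j, hj, rfl⟩

lemma refl_apply_eq_self_iff {i : I} {v : V} : R.refl i v = v ↔ R.root i v = 0 := by
  have hne : R.coroot i ≠ 0 := fun h => by simpa [h] using R.root_coroot i
  rw [refl_apply, sub_eq_self, smul_eq_zero, or_iff_left hne]

lemma mem_span_root_of_mem_posCone_of_apply_eq_zero [Fintype I] {α : Module.Dual ℝ V}
    (hα : α ∈ R.posCone) {v : V} (hv : v ∈ R.fundFacet J) (h0 : α v = 0) :
    α ∈ Submodule.span ℝ (R.root '' J) := by
  obtain ⟨c, hc, rfl⟩ := hα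
  simp only [LinearMap.sum_apply, LinearMap.smul_apply, smul_eq_mul] at h0
  rw [Finset.sum_eq_zero_iff_of_nonneg fun i _ =>
    mul_nonneg (hc i) (fundFacet_subset_closedChamber J hv i)] at h0
  refine Submodule.sum_mem _ fun i _ => ?_
  rcases em (i ∈ J) with hi | hi
  · exact Submodule.smul_mem _ _ (Submodule.subset_span ⟨i, hi, rfl⟩)
  · rw [(mul_eq_zero.1 (h0 i (Finset.mem_univ i))).resolve_right (hv.2 i hi).ne', zero_smul]
    exact zero_mem _

lemma sum_parabolic_mul_right {M : Type*} [AddCommMonoid M] (hJ : R.IsSpherical J) {u : V ≃ₗ[ℝ] V}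
    (hu : u ∈ R.parabolic J) (φ : (V ≃ₗ[ℝ] V) → M) :
    ∑ w ∈ hJ.toFinset, φ (w * u) = ∑ w ∈ hJ.toFinset, φ w := by
  refine Finset.sum_equiv (Equiv.mulRight u) (fun w => ?_) fun _ _ => rfl
  exact hJ.mem_toFinset.trans
    (((R.parabolic J).mul_mem_cancel_right hu).symm.trans hJ.mem_toFinset.symm)

lemma sum_parabolic_mul_left {M : Type*} [AddCommMonoid M] (hJ : R.IsSpherical J) {u : V ≃ₗ[ℝ] V}
    (hu : u ∈ R.parabolic J) (φ : (V ≃ₗ[ℝ] V) → M) :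
    ∑ w ∈ hJ.toFinset, φ (u * w) = ∑ w ∈ hJ.toFinset, φ w := by
  refine Finset.sum_equiv (Equiv.mulLeft u) (fun w => ?_) fun _ _ => rfl
  exact hJ.mem_toFinset.trans
    (((R.parabolic J).mul_mem_cancel_left hu).symm.trans hJ.mem_toFinset.symm)

lemma sum_parabolic_apply_mem_VJ (hJ : R.IsSpherical J) (v : V) :
    ∑ w ∈ hJ.toFinset, w v ∈ R.VJ J := by
  refine mem_VJ.2 fun j hj => refl_apply_eq_self_iff.1 ?_
  rw [map_sum]
  exact sum_parabolic_mul_left hJ (refl_mem_parabolic hj) fun w => w v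

variable [Finite I]

/-- A positive semidefinite symmetric bilinear form on `V`, invariant under the finite group
`W^v(J)`, with kernel `V_J`: it induces the scalar product of `𝔸_J = V / V_J`. -/
noncomputable def formJ (hJ : R.IsSpherical J) : LinearMap.BilinForm ℝ V :=
  ∑ w ∈ hJ.toFinset, ∑ j ∈ (Set.toFinite J).toFinset,
    LinearMap.BilinForm.linMulLin (R.root j ∘ₗ w.toLinearMap) (R.root j ∘ₗ w.toLinearMap)

variable (hJ : R.IsSpherical J)

lemma formJ_apply (x y : V) : formJ hJ x y =
    ∑ w ∈ hJ.toFinset, ∑ j ∈ (Set.toFinite J).toFinset, R.root j (w x) * R.root j (w y) := by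
  simp [formJ, LinearMap.sum_apply]

lemma formJ_comm (x y : V) : formJ hJ x y = formJ hJ y x := by
  simp only [formJ_apply, mul_comm]

lemma formJ_apply_apply_of_mem_parabolic {u : V ≃ₗ[ℝ] V} (hu : u ∈ R.parabolic J) (x y : V) :
    formJ hJ (u x) (u y) = formJ hJ x y := by
  simpa only [formJ_apply, LinearEquiv.mul_apply] using sum_parabolic_mul_right hJ hu fun w =>
    ∑ j ∈ (Set.toFinite J).toFinset, R.root j (w x) * R.root j (w y)

lemma formJ_pos {x : V} (hx : x ∉ R.VJ J) : 0 < formJ hJ x x := by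
  obtain ⟨j, hj, hne⟩ : ∃ j ∈ J, R.root j x ≠ 0 := by simpa [mem_VJ] using hx
  rw [formJ_apply]
  exact Finset.sum_pos' (fun w _ => Finset.sum_nonneg fun j _ => mul_self_nonneg _)
    ⟨1, hJ.mem_toFinset.2 (one_mem (R.parabolic J)),
      Finset.sum_pos' (fun j _ => mul_self_nonneg _)
        ⟨j, (Set.toFinite J).mem_toFinset.2 hj, mul_self_pos.2 hne⟩⟩

lemma formJ_eq_zero_of_mem_VJ {x : V} (hx : x ∈ R.VJ J) (y : V) : formJ hJ x y = 0 := by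
  rw [formJ_apply]
  refine Finset.sum_eq_zero fun w hw => Finset.sum_eq_zero fun j hj => ?_
  rw [apply_eq_self_of_mem_parabolic (hJ.mem_toFinset.1 hw) hx,
    mem_VJ.1 hx j ((Set.toFinite J).mem_toFinset.1 hj), zero_mul]

lemma IsRootPair.coroot_notMem_VJ {α : Module.Dual ℝ V} {c : V} (h : R.IsRootPair α c)
    (hα : α ∈ Submodule.span ℝ (R.root '' J)) : c ∉ R.VJ J := fun hc => by
  simpa [h.apply_eq_two] using mem_span_root_iff.1 hα c hc

end RootBasis

namespace ModelApartment

variable {V : Type*} [NormedAddCommGroup V] [NormedSpace ℝ V] {I : Type*} [Fintype I]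
  {𝔸 : ModelApartment V I}

open RootBasis

section Roots

variable {α : Module.Dual ℝ V}

lemma neg_mem_roots (h : α ∈ 𝔸.roots) : -α ∈ 𝔸.roots := h.imp neg_mem_realRoots (𝔸.im_neg α)

lemma comp_mem_roots (h : α ∈ 𝔸.roots) {w : V ≃ₗ[ℝ] V} (hw : w ∈ 𝔸.weyl) :
    α ∘ₗ w.toLinearMap ∈ 𝔸.roots :=
  h.imp (fun h => comp_mem_realRoots h hw) fun h => by
    simpa only [inv_inv] using 𝔸.im_stable α h _ (inv_mem hw)

lemma units_smul_mem_roots (h : α ∈ 𝔸.roots) (ε : ℤˣ) : (ε : ℤ) • α ∈ 𝔸.roots := by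
  rcases Int.units_eq_one_or ε with rfl | rfl
  · simpa using h
  · simpa using neg_mem_roots h

lemma rootsJ_subset_roots (J : Set I) : 𝔸.rootsJ J ⊆ 𝔸.roots := fun _ h => Or.inl h.1

lemma mem_posCone_or_neg_mem_posCone (h : α ∈ 𝔸.roots) : α ∈ 𝔸.posCone ∨ -α ∈ 𝔸.posCone :=
  h.elim (𝔸.pos_or_neg α) (𝔸.im_pos_or_neg α)

lemma mem_posCone_of_apply_pos (h : α ∈ 𝔸.roots) {v : V} (hv : v ∈ 𝔸.closedChamber)
    (hα : 0 < α v) : α ∈ 𝔸.posCone := by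
  refine (mem_posCone_or_neg_mem_posCone h).resolve_right fun hn => hα.not_ge ?_
  simpa using nonneg_of_mem_posCone hn hv

lemma mem_span_root_of_apply_eq_zero (h : α ∈ 𝔸.roots) {J : Set I} {v : V}
    (hv : v ∈ 𝔸.fundFacet J) (h0 : α v = 0) : α ∈ Submodule.span ℝ (𝔸.root '' J) := by
  rcases mem_posCone_or_neg_mem_posCone h with hp | hp
  · exact mem_span_root_of_mem_posCone_of_apply_eq_zero hp hv h0
  · rw [← neg_mem_iff]
    exact mem_span_root_of_mem_posCone_of_apply_eq_zero hp hv (by simpa using h0)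

lemma apply_pos_of_mem_fundFacet (h : α ∈ 𝔸.roots) {J : Set I} {v v' : V}
    (hv : v ∈ 𝔸.fundFacet J) (hv' : v' ∈ 𝔸.fundFacet J) (hα : 0 < α v) : 0 < α v' := by
  have hpos := mem_posCone_of_apply_pos h (fundFacet_subset_closedChamber J hv) hα
  refine (nonneg_of_mem_posCone hpos (fundFacet_subset_closedChamber J hv')).lt_of_ne' fun h0 => ?_
  exact hα.ne' (mem_span_root_iff.1 (mem_span_root_of_apply_eq_zero h hv' h0) v
    (fundFacet_subset_VJ J hv))

lemma apply_pos_of_mem_facetOf (h : α ∈ 𝔸.roots) {ε : ℤˣ} {w : V ≃ₗ[ℝ] V} (hw : w ∈ 𝔸.weyl)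
    {J : Set I} {v v' : V} (hv : v ∈ 𝔸.facetOf ε w J) (hv' : v' ∈ 𝔸.facetOf ε w J)
    (hα : 0 < α v) : 0 < α v' := by
  obtain ⟨u, hu, rfl⟩ := hv
  obtain ⟨u', hu', rfl⟩ := hv'
  simp only [map_units_smul] at hα ⊢
  exact apply_pos_of_mem_fundFacet (units_smul_mem_roots (comp_mem_roots h hw) ε) hu hu' hα

lemma apply_nonneg_of_mem_facetOf (h : α ∈ 𝔸.roots) {ε : ℤˣ} {w : V ≃ₗ[ℝ] V} (hw : w ∈ 𝔸.weyl)
    {J : Set I} {v v' : V} (hv : v ∈ 𝔸.facetOf ε w J) (hv' : v' ∈ 𝔸.facetOf ε w J)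
    (hα : 0 ≤ α v) : 0 ≤ α v' := by
  by_contra! hn
  have hneg := apply_pos_of_mem_facetOf (neg_mem_roots h) hw hv' hv (by simpa using hn)
  exact hα.not_gt (by simpa using hneg)

end Roots

section Spherical

variable [FiniteDimensional ℝ V] {J : Set I}

lemma formJ_coroot (hJ : 𝔸.IsSpherical J) {α : Module.Dual ℝ V} {c : V} (h : 𝔸.IsRootPair α c)
    (hα : α ∈ Submodule.span ℝ (𝔸.root '' J)) (x : V) :
    formJ hJ c x = formJ hJ c c / 2 * α x := by
  have hinv := formJ_apply_apply_of_mem_parabolic hJ (reflection_mem_parabolic h hα) c x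
  simp only [Module.reflection_apply_self, Module.reflection_apply, map_neg, map_sub, map_smul,
    LinearMap.neg_apply, smul_eq_mul] at hinv
  linarith

lemma exists_mem_parabolic_forall_root_nonneg (hJ : 𝔸.IsSpherical J) (v : V) :
    ∃ w ∈ 𝔸.parabolic J, ∀ j ∈ J, 0 ≤ 𝔸.root j (w v) := by
  -- the point of the orbit of `v` closest to a point of the open chamber is in the chamber of `J`
  obtain ⟨c, hc⟩ := exists_forall_apply_eq_of_linearIndependent 𝔸.linearIndependent fun _ => 1
  obtain ⟨w, hw, hmax⟩ := Finset.exists_max_image hJ.toFinset (fun w => formJ hJ (w v) c)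
    ⟨1, hJ.mem_toFinset.2 (one_mem (𝔸.parabolic J))⟩
  rw [hJ.mem_toFinset] at hw
  refine ⟨w, hw, fun j hj => ?_⟩
  by_contra! hneg
  have hpair : 𝔸.IsRootPair (𝔸.root j) (𝔸.coroot j) := ⟨1, one_mem _, j, rfl, rfl⟩
  have hspan : 𝔸.root j ∈ Submodule.span ℝ (𝔸.root '' J) := (root_mem_rootsJ hj).2
  have hle := hmax (𝔸.refl j * w) (hJ.mem_toFinset.2 (mul_mem (refl_mem_parabolic hj) hw))
  rw [LinearEquiv.mul_apply, refl_apply, map_sub, map_smul, LinearMap.sub_apply,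
    LinearMap.smul_apply, smul_eq_mul, formJ_coroot hJ hpair hspan, hc] at hle
  linarith [mul_pos (neg_pos.2 hneg) (formJ_pos hJ (hpair.coroot_notMem_VJ hspan))]

lemma eventually_exists_apply_mem_closedChamber (hJ : 𝔸.IsSpherical J) {η : V}
    (hη : η ∈ 𝔸.fundFacet J) : ∀ᶠ v in 𝓝 η, ∃ w ∈ 𝔸.parabolic J, w v ∈ 𝔸.closedChamber := by
  have hpos : ∀ᶠ v in 𝓝 η, ∀ w ∈ (𝔸.parabolic J : Set (V ≃ₗ[ℝ] V)), ∀ i, i ∉ J →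
      0 < 𝔸.root i (w v) := by
    refine (eventually_all_finite hJ).2 fun w hw => eventually_all.2 fun i => ?_
    rcases em (i ∈ J) with hi | hi
    · exact Eventually.of_forall fun v hn => absurd hi hn
    have hcont : Continuous fun v => 𝔸.root i (w v) :=
      (𝔸.root i ∘ₗ w.toLinearMap).continuous_of_finiteDimensional
    have h0 : 0 < 𝔸.root i (w η) := by
      rw [apply_eq_self_of_mem_parabolic hw (fundFacet_subset_VJ J hη)]
      exact hη.2 i hi
    filter_upwards [hcont.continuousAt.eventually (lt_mem_nhds h0)] with v hv _ using hv
  filter_upwards [hpos] with v hv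
  obtain ⟨w, hw, hw'⟩ := exists_mem_parabolic_forall_root_nonneg hJ v
  exact ⟨w, hw, fun i => (em (i ∈ J)).elim (hw' i) fun hi => (hv w hw i hi).le⟩

lemma eventually_forall_roots_nonneg_of_mem_fundFacet (hJ : 𝔸.IsSpherical J) {η : V}
    (hη : η ∈ 𝔸.fundFacet J) : ∀ᶠ v in 𝓝 η, ∀ α ∈ 𝔸.roots, 0 < α η → 0 ≤ α v := by
  filter_upwards [eventually_exists_apply_mem_closedChamber hJ hη] with v hv α hα hpos
  obtain ⟨w, hw, hwv⟩ := hv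
  have hfix : w⁻¹ η = η := apply_eq_self_of_mem_parabolic (inv_mem hw) (fundFacet_subset_VJ J hη)
  have hmem := mem_posCone_of_apply_pos
    (comp_mem_roots hα (inv_mem (parabolic_le_weyl J hw))) (fundFacet_subset_closedChamber J hη)
    (by rwa [LinearMap.comp_apply, LinearEquiv.coe_coe, hfix])
  simpa using nonneg_of_mem_posCone hmem hwv

/-- Although `Δ` may be infinite, the neighbourhood does not depend on the root `α`: a point of a
spherical facet is in the interior of the Tits cone (up to sign). -/
lemma eventually_forall_roots_nonneg (hJ : 𝔸.IsSpherical J) {ε : ℤˣ} {η : V}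
    (hη : η ∈ 𝔸.facetOf ε 1 J) : ∀ᶠ v in 𝓝 η, ∀ α ∈ 𝔸.roots, 0 < α η → 0 ≤ α v := by
  have hsmul (α : Module.Dual ℝ V) (u : V) : ((ε : ℤ) • α) (ε • u) = α u := by
    rw [map_units_smul]
    exact units_smul_smul_self ε (α u)
  have hlim : Tendsto (fun v : V => ε • v) (𝓝 η) (𝓝 (ε • η)) :=
    (continuous_const_smul (ε : ℤ)).tendsto η
  filter_upwards [hlim.eventually
    (eventually_forall_roots_nonneg_of_mem_fundFacet hJ (mem_facetOf_one.1 hη))] with v hv α hα hpos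
  simpa only [hsmul, hpos, true_imp_iff] using hv _ (units_smul_mem_roots hα ε)

lemma exists_add_mem_vectorialFacet (hJ : 𝔸.IsSpherical J) (u : V) :
    ∃ n ∈ 𝔸.VJ J, ∃ F, 𝔸.IsVectorialFacet F ∧ u + n ∈ F := by
  obtain ⟨η, hη⟩ := fundFacet_nonempty (R := 𝔸.toRootBasis) J
  have hlim : Tendsto (fun t : ℝ => η + t • u) (𝓝[>] 0) (𝓝 η) := by
    simpa using ((by fun_prop : Continuous fun t : ℝ => η + t • u).tendsto 0).mono_left
      nhdsWithin_le_nhds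
  obtain ⟨t, ⟨w, hw, hwt⟩, ht⟩ :=
    ((hlim.eventually (eventually_exists_apply_mem_closedChamber hJ hη)).and
      self_mem_nhdsWithin).exists
  refine ⟨t⁻¹ • η, Submodule.smul_mem _ _ (fundFacet_subset_VJ J hη),
    𝔸.facetOf 1 w⁻¹ {i | 𝔸.root i (w (η + t • u)) = 0},
    ⟨1, w⁻¹, inv_mem (parabolic_le_weyl J hw), _, rfl⟩, ?_⟩
  have hmem : η + t • u ∈ 𝔸.facetOf 1 w⁻¹ {i | 𝔸.root i (w (η + t • u)) = 0} := by
    rw [mem_facetOf, inv_inv, one_smul]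
    exact ⟨fun i hi => hi, fun i hi => (hwt i).lt_of_ne' hi⟩
  simpa [smul_smul, ne_of_gt ht, add_comm] using smul_mem_facetOf hmem (inv_pos.2 ht)

lemma apply_pos_of_mem_imRoots (hJ : 𝔸.IsSpherical J) {α : Module.Dual ℝ V} (h : α ∈ 𝔸.imRoots)
    (hα : α ∈ 𝔸.posCone) {η : V} (hη : η ∈ 𝔸.fundFacet J) : 0 < α η := by
  refine (nonneg_of_mem_posCone hα (fundFacet_subset_closedChamber J hη)).lt_of_ne' fun h0 => ?_
  obtain ⟨v, hv⟩ := fundFacet_nonempty (R := 𝔸.toRootBasis) ∅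
  have hnonneg : ∀ w ∈ hJ.toFinset, 0 ≤ α (w v) := fun w hw => by
    have hw' := parabolic_le_weyl J (hJ.mem_toFinset.1 hw)
    have hpos : α ∘ₗ w.toLinearMap ∈ 𝔸.posCone := by
      simpa only [inv_inv] using 𝔸.im_pos_stable α h hα _ (inv_mem hw')
    exact nonneg_of_mem_posCone hpos (fundFacet_subset_closedChamber ∅ hv)
  -- `α` vanishes on `V_J`, hence at the sum of the orbit of `v` under `W^v(J)`
  have hsum : ∑ w ∈ hJ.toFinset, α (w v) = 0 := by
    rw [← map_sum]
    exact mem_span_root_iff.1 (mem_span_root_of_mem_posCone_of_apply_eq_zero hα hη h0) _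
      (sum_parabolic_apply_mem_VJ hJ v)
  have hαv : α v = 0 := (Finset.sum_eq_zero_iff_of_nonneg hnonneg).1 hsum 1
    (hJ.mem_toFinset.2 (one_mem (𝔸.parabolic J)))
  have hzero : α = 0 := by simpa using mem_span_root_of_mem_posCone_of_apply_eq_zero hα hv hαv
  exact 𝔸.im_ne_zero (hzero ▸ h)

lemma mem_rootsJ_of_apply_eq_zero (hJ : 𝔸.IsSpherical J) {ε : ℤˣ} {η : V}
    (hη : η ∈ 𝔸.facetOf ε 1 J) {α : Module.Dual ℝ V} (h : α ∈ 𝔸.roots) (h0 : α η = 0) :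
    α ∈ 𝔸.rootsJ J := by
  rw [mem_facetOf_one] at hη
  have h0' : α (ε • η) = 0 := by rw [map_units_smul, h0, smul_zero]
  refine ⟨h.resolve_right fun him => ?_, mem_span_root_of_apply_eq_zero h hη h0'⟩
  rcases 𝔸.im_pos_or_neg α him with hp | hp
  · exact (apply_pos_of_mem_imRoots hJ him hp hη).ne' h0'
  · exact (apply_pos_of_mem_imRoots hJ (𝔸.im_neg α him) hp hη).ne' (by simpa using h0')

end Spherical

end ModelApartment

/-! ## Enclosures and affine reflections -/

namespace ModelApartment

variable {V : Type*} [NormedAddCommGroup V] [NormedSpace ℝ V] {I : Type*} [Fintype I]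
  {𝔸 : ModelApartment V I}

variable (𝔸) in
/-- A choice, for each root `α`, of a half-space `D(α, k)` with `k ∈ Γ_α ∪ {∞}`. -/
def IsHalfFamily (D : Module.Dual ℝ V → Set V) : Prop :=
  ∀ α ∈ 𝔸.roots, D α = Set.univ ∨ ∃ k ∈ 𝔸.Gam α, D α = halfOf α k

variable (𝔸) in
/-- The enclosed sets: the intersections `⋂_{α ∈ Δ} D(α, k_α)`. -/
def IsEnclosed (S : Set V) : Prop :=
  ∃ D : Module.Dual ℝ V → Set V, 𝔸.IsHalfFamily D ∧ S = ⋂ α ∈ 𝔸.roots, D α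

lemma halfOf_inter_halfOf (α : Module.Dual ℝ V) (k k' : ℝ) :
    halfOf α k ∩ halfOf α k' = halfOf α (min k k') := by
  ext v
  simp only [halfOf, Set.mem_inter_iff, Set.mem_ofPred_eq, ← min_add_add_left, le_min_iff]

lemma isClosed_halfOf [FiniteDimensional ℝ V] (α : Module.Dual ℝ V) (k : ℝ) :
    IsClosed (halfOf α k) :=
  isClosed_le continuous_const (α.continuous_of_finiteDimensional.add continuous_const)

lemma IsHalfFamily.inter {D D' : Module.Dual ℝ V → Set V} (h : 𝔸.IsHalfFamily D)
    (h' : 𝔸.IsHalfFamily D') : 𝔸.IsHalfFamily fun α => D α ∩ D' α := by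
  intro α hα
  rcases h α hα with hD | ⟨k, hk, hD⟩
  · simpa only [hD, Set.univ_inter] using h' α hα
  rcases h' α hα with hD' | ⟨k', hk', hD'⟩
  · exact Or.inr ⟨k, hk, by simp only [hD, hD', Set.inter_univ]⟩
  · refine Or.inr ⟨min k k', ?_, by simp only [hD, hD', halfOf_inter_halfOf]⟩
    rcases min_choice k k' with h | h <;> rwa [h]

lemma isEnclosed_univ : 𝔸.IsEnclosed Set.univ :=
  ⟨fun _ => Set.univ, fun _ _ => Or.inl rfl, by simp⟩

lemma isEnclosed_halfOf {α : Module.Dual ℝ V} (hα : α ∈ 𝔸.roots) {k : ℝ} (hk : k ∈ 𝔸.Gam α) :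
    𝔸.IsEnclosed (halfOf α k) := by
  refine ⟨fun β => {v | β = α → v ∈ halfOf α k}, fun β _ => ?_, ?_⟩
  · rcases eq_or_ne β α with rfl | h
    · exact Or.inr ⟨k, hk, by simp⟩
    · exact Or.inl (by simp [h])
  · ext v
    simp only [Set.mem_iInter, Set.mem_ofPred_eq]
    exact ⟨fun hv _ _ _ => hv, fun hv => hv α hα rfl⟩

namespace IsEnclosed

variable {S T : Set V}

lemma inter (hS : 𝔸.IsEnclosed S) (hT : 𝔸.IsEnclosed T) : 𝔸.IsEnclosed (S ∩ T) := by
  obtain ⟨D, hD, rfl⟩ := hS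
  obtain ⟨D', hD', rfl⟩ := hT
  exact ⟨_, hD.inter hD', by simp only [Set.iInter_inter_distrib]⟩

lemma sInter {𝒮 : Set (Set V)} (hfin : 𝒮.Finite) (h : ∀ S ∈ 𝒮, 𝔸.IsEnclosed S) :
    𝔸.IsEnclosed (⋂₀ 𝒮) := by
  induction 𝒮, hfin using Set.Finite.induction_on with
  | empty => simpa only [Set.sInter_empty] using isEnclosed_univ
  | insert _ _ ih =>
    rw [Set.sInter_insert]
    exact (h _ (Set.mem_insert _ _)).inter (ih fun S hS => h S (Set.mem_insert_of_mem _ hS))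

lemma isClosed [FiniteDimensional ℝ V] (hS : 𝔸.IsEnclosed S) : IsClosed S := by
  obtain ⟨D, hD, rfl⟩ := hS
  refine isClosed_biInter fun α hα => ?_
  rcases hD α hα with h | ⟨k, -, h⟩ <;> rw [h]
  exacts [isClosed_univ, isClosed_halfOf α k]

lemma mem_facet (hS : 𝔸.IsEnclosed S) {x : V} {F : Set V} (h : S ∈ localFacet x F) :
    S ∈ 𝔸.facet x F := by
  obtain ⟨D, hD, rfl⟩ := hS
  exact GenerateSets.basic ⟨h, D, fun α hα => (hD α hα).imp_right
    fun ⟨k, hk, hDk⟩ => ⟨k, hk, Or.inl hDk⟩, rfl⟩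

end IsEnclosed

lemma mem_cl {F : Filter V} {T : Set V} : T ∈ 𝔸.cl F ↔ ∃ S, 𝔸.IsEnclosed S ∧ S ∈ F ∧ S ⊆ T := by
  refine ⟨fun hT => ?_, fun ⟨S, hS, hSF, hST⟩ => mem_of_superset (GenerateSets.basic ⟨hSF, hS⟩) hST⟩
  obtain ⟨𝒮, h𝒮, hfin, hsub⟩ := mem_generate_iff.1 hT
  exact ⟨⋂₀ 𝒮, .sInter hfin fun S hS => (h𝒮 hS).2, (sInter_mem hfin).2 fun S hS => (h𝒮 hS).1, hsub⟩

lemma cl_mono {F G : Filter V} (h : F ≤ G) : 𝔸.cl F ≤ 𝔸.cl G := fun T hT => by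
  obtain ⟨S, hS, hSG, hST⟩ := mem_cl.1 hT
  exact mem_cl.2 ⟨S, hS, h hSG, hST⟩

lemma localFacet_le_facet (x : V) (F : Set V) : localFacet x F ≤ 𝔸.facet x F :=
  le_generate_iff.2 fun _ hS => hS.1

end ModelApartment

section AffineEquiv

variable {V : Type*} [AddCommGroup V] [Module ℝ V]

lemma affineEquiv_apply_add (w : V ≃ᵃ[ℝ] V) (x v : V) : w (x + v) = w x + w.linear v := by
  rw [add_comm x, add_comm (w x)]
  exact w.map_vadd x v

lemma affineEquiv_apply_eq (w : V ≃ᵃ[ℝ] V) (v : V) : w v = w 0 + w.linear v := by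
  rw [← affineEquiv_apply_add, zero_add]

lemma linear_image_singleton_add (w : V ≃ᵃ[ℝ] V) (x : V) (F : Set V) :
    w '' ({x} + F) = {w x} + w.linear '' F := by
  simp only [Set.singleton_add, Set.image_image, affineEquiv_apply_add]

lemma inv_linear_image_linear_image (w : V ≃ᵃ[ℝ] V) (F : Set V) :
    (w⁻¹ : V ≃ᵃ[ℝ] V).linear '' (w.linear '' F) = F :=
  w.linear.toEquiv.symm_image_image F

lemma comp_linear_apply_add (w : V ≃ᵃ[ℝ] V) (α : Module.Dual ℝ V) (k : ℝ) (v : V) :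
    (α ∘ₗ w.linear.toLinearMap) v + (α (w 0) + k) = α (w v) + k := by
  rw [affineEquiv_apply_eq w v, map_add, LinearMap.comp_apply, LinearEquiv.coe_coe]
  ring

lemma preimage_wallOf (w : V ≃ᵃ[ℝ] V) (α : Module.Dual ℝ V) (k : ℝ) :
    w ⁻¹' wallOf α k = wallOf (α ∘ₗ w.linear.toLinearMap) (α (w 0) + k) := by
  simp only [wallOf, comp_linear_apply_add, Set.preimage_ofPred_eq]

lemma preimage_halfOf (w : V ≃ᵃ[ℝ] V) (α : Module.Dual ℝ V) (k : ℝ) :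
    w ⁻¹' halfOf α k = halfOf (α ∘ₗ w.linear.toLinearMap) (α (w 0) + k) := by
  simp only [halfOf, comp_linear_apply_add, Set.preimage_ofPred_eq]

lemma preimage_openHalfOf (w : V ≃ᵃ[ℝ] V) (α : Module.Dual ℝ V) (k : ℝ) :
    w ⁻¹' openHalfOf α k = openHalfOf (α ∘ₗ w.linear.toLinearMap) (α (w 0) + k) := by
  simp only [openHalfOf, comp_linear_apply_add, Set.preimage_ofPred_eq]

lemma comp_inv_comp (α : Module.Dual ℝ V) (u : V ≃ₗ[ℝ] V) :
    (α ∘ₗ (u⁻¹ : V ≃ₗ[ℝ] V).toLinearMap) ∘ₗ u.toLinearMap = α := by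
  ext v
  exact congrArg α (u.symm_apply_apply v)

lemma comp_comp_inv (α : Module.Dual ℝ V) (u : V ≃ₗ[ℝ] V) :
    (α ∘ₗ u.toLinearMap) ∘ₗ (u⁻¹ : V ≃ₗ[ℝ] V).toLinearMap = α := by
  ext v
  exact congrArg α (u.apply_symm_apply v)

lemma map_map_inv (w : V ≃ᵃ[ℝ] V) (F : Filter V) : map w (map (w⁻¹ : V ≃ᵃ[ℝ] V) F) = F := by
  rw [map_map]
  exact (congrArg (map · F) (funext w.apply_symm_apply)).trans map_id

/-- The reflection `v ↦ v - (α(v) + k) c` in the hyperplane `M(α, k)`, where `α(c) = 2`. -/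
noncomputable def affineReflection {α : Module.Dual ℝ V} {c : V} (h : α c = 2) (k : ℝ) :
    V ≃ᵃ[ℝ] V :=
  (Module.reflection h).toAffineEquiv.trans (AffineEquiv.constVAdd ℝ V (-(k • c)))

lemma affineReflection_apply {α : Module.Dual ℝ V} {c : V} (h : α c = 2) (k : ℝ) (v : V) :
    affineReflection h k v = v - (α v + k) • c := by
  simp only [affineReflection, AffineEquiv.trans_apply, LinearEquiv.coe_toAffineEquiv,
    AffineEquiv.constVAdd_apply, vadd_eq_add, Module.reflection_apply, add_smul]
  abel

end AffineEquiv

namespace ModelApartment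

variable {V : Type*} [NormedAddCommGroup V] [NormedSpace ℝ V] {I : Type*} [Fintype I]
  {𝔸 : ModelApartment V I} {w : V ≃ᵃ[ℝ] V}

open RootBasis

lemma affineReflection_mem_W {α : Module.Dual ℝ V} {c : V} (h : 𝔸.IsRootPair α c) {k : ℝ}
    (hk : wallOf α k ∈ 𝔸.walls) : affineReflection h.apply_eq_two k ∈ 𝔸.W :=
  Subgroup.subset_closure ⟨α, c, k, h, hk, affineReflection_apply _ _⟩

lemma linear_mem_weyl (hw : w ∈ 𝔸.W) : w.linear ∈ 𝔸.weyl := by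
  suffices 𝔸.W ≤ 𝔸.weyl.comap AffineEquiv.linearHom from this hw
  refine (Subgroup.closure_le _).2 ?_
  rintro s ⟨α, c, k, h, -, hs⟩
  obtain rfl : s = affineReflection h.apply_eq_two k :=
    AffineEquiv.ext fun v => by rw [hs, affineReflection_apply]
  exact h.reflection_mem_weyl

lemma exists_mem_W_linear_eq {u : V ≃ₗ[ℝ] V} (hu : u ∈ 𝔸.weyl) : ∃ w ∈ 𝔸.W, w.linear = u := by
  suffices 𝔸.weyl ≤ 𝔸.W.map AffineEquiv.linearHom from this hu
  refine (Subgroup.closure_le _).2 ?_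
  rintro _ ⟨i, rfl⟩
  obtain ⟨k, hk⟩ := (𝔸.infinite_walls _ (root_mem_realRoots i)).nonempty
  exact ⟨_, affineReflection_mem_W ⟨1, one_mem _, i, rfl, rfl⟩ hk, rfl⟩

lemma add_mem_Gam (hw : w ∈ 𝔸.W) {α : Module.Dual ℝ V} {k : ℝ} (hk : k ∈ 𝔸.Gam α) :
    α (w 0) + k ∈ 𝔸.Gam (α ∘ₗ w.linear.toLinearMap) := by
  rcases hk with ⟨hα, hwall⟩ | hα
  · refine Or.inl ⟨comp_mem_realRoots hα (linear_mem_weyl hw), ?_⟩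
    rw [← preimage_wallOf, ← w.image_symm]
    exact 𝔸.walls_stable _ (inv_mem hw) _ hwall
  · refine Or.inr ?_
    simpa only [inv_inv] using 𝔸.im_stable α hα _ (inv_mem (linear_mem_weyl hw))

lemma preimage_iInter_roots (hw : w ∈ 𝔸.W) (D : Module.Dual ℝ V → Set V) :
    w ⁻¹' (⋂ α ∈ 𝔸.roots, D α) =
      ⋂ α ∈ 𝔸.roots, w ⁻¹' D (α ∘ₗ (w.linear⁻¹ : V ≃ₗ[ℝ] V).toLinearMap) := by
  ext v
  simp only [Set.mem_preimage, Set.mem_iInter]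
  refine ⟨fun h α hα => h _ (comp_mem_roots hα (inv_mem (linear_mem_weyl hw))), fun h α hα => ?_⟩
  simpa only [comp_comp_inv] using h _ (comp_mem_roots hα (linear_mem_weyl hw))

lemma IsEnclosed.preimage {S : Set V} (hS : 𝔸.IsEnclosed S) (hw : w ∈ 𝔸.W) :
    𝔸.IsEnclosed (w ⁻¹' S) := by
  obtain ⟨D, hD, rfl⟩ := hS
  refine ⟨_, fun α hα => ?_, preimage_iInter_roots hw D⟩
  refine (hD _ (comp_mem_roots hα (inv_mem (linear_mem_weyl hw)))).imp
    (fun h => by rw [h, Set.preimage_univ]) fun ⟨k, hk, h⟩ => ⟨_, ?_, by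
      rw [h, preimage_halfOf, comp_inv_comp]⟩
  simpa only [comp_inv_comp] using add_mem_Gam hw hk

lemma map_cl_le (hw : w ∈ 𝔸.W) (F : Filter V) : map w (𝔸.cl F) ≤ 𝔸.cl (map w F) := fun T hT => by
  obtain ⟨S, hS, hSF, hST⟩ := mem_cl.1 hT
  exact mem_cl.2 ⟨_, hS.preimage hw, hSF, Set.preimage_mono hST⟩

section Continuity

variable [FiniteDimensional ℝ V]

lemma map_localFacet_le (w : V ≃ᵃ[ℝ] V) (x : V) (F : Set V) :
    map w (localFacet x F) ≤ localFacet (w x) (w.linear '' F) := by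
  refine map_inf_le.trans (inf_le_inf ?_ ?_)
  · exact (AffineMap.continuous_of_finiteDimensional w.toAffineMap).continuousAt
  · rw [map_principal, linear_image_singleton_add]

lemma map_facet_le (hw : w ∈ 𝔸.W) (x : V) (F : Set V) :
    map w (𝔸.facet x F) ≤ 𝔸.facet (w x) (w.linear '' F) := by
  refine le_generate_iff.2 ?_
  rintro S ⟨hS, D, hD, rfl⟩
  refine GenerateSets.basic ⟨map_localFacet_le w x F hS, _, fun α hα => ?_,
    preimage_iInter_roots hw D⟩
  refine (hD _ (comp_mem_roots hα (inv_mem (linear_mem_weyl hw)))).imp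
    (fun h => by rw [h, Set.preimage_univ]) fun ⟨k, hk, h⟩ => ⟨_, ?_, h.imp
      (fun h => by rw [h, preimage_halfOf, comp_inv_comp])
      fun h => by rw [h, preimage_openHalfOf, comp_inv_comp]⟩
  simpa only [comp_inv_comp] using add_mem_Gam hw hk

lemma map_chimney_le (hw : w ∈ 𝔸.W) (x : V) (F₀ Fv : Set V) (ξ : V) :
    map w (𝔸.chimney x F₀ Fv ξ) ≤
      𝔸.chimney (w x) (w.linear '' F₀) (w.linear '' Fv) (w.linear ξ) := by
  refine (map_cl_le hw _).trans (cl_mono ?_)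
  have hmap : map w (𝔸.facet x F₀ + 𝓟 ({ξ} + Fv)) =
      map w (𝔸.facet x F₀) + map w.linear (𝓟 ({ξ} + Fv)) :=
    map_map₂_distrib fun a b => affineEquiv_apply_add w a b
  rw [hmap, map_principal, Set.image_add, Set.image_singleton]
  exact add_le_add (map_facet_le hw x F₀) le_rfl

lemma linear_image_closure (w : V ≃ᵃ[ℝ] V) (F : Set V) :
    w.linear '' closure F = closure (w.linear '' F) :=
  w.linear.toContinuousLinearEquiv.toHomeomorph.image_closure F

lemma map_chimneyGerm_le (hw : w ∈ 𝔸.W) (x : V) (F₀ Fv : Set V) :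
    map w (𝔸.chimneyGerm x F₀ Fv) ≤ 𝔸.chimneyGerm (w x) (w.linear '' F₀) (w.linear '' Fv) := by
  refine le_iInf₂ fun ξ hξ => ?_
  rw [← linear_image_closure] at hξ
  obtain ⟨ξ, hξ, rfl⟩ := hξ
  exact (map_mono (iInf₂_le ξ hξ)).trans (map_chimney_le hw x F₀ Fv ξ)

lemma map_sectorFaceGerm_le (w : V ≃ᵃ[ℝ] V) (x : V) (Fv : Set V) :
    map w (sectorFaceGerm x Fv) ≤ sectorFaceGerm (w x) (w.linear '' Fv) := by
  refine le_iInf₂ fun ξ hξ => ?_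
  rw [← linear_image_closure] at hξ
  obtain ⟨ξ, hξ, rfl⟩ := hξ
  refine (map_mono (iInf₂_le ξ hξ)).trans ?_
  rw [map_principal, linear_image_singleton_add, affineEquiv_apply_add]

lemma map_chimneyGerm (hw : w ∈ 𝔸.W) (x : V) (F₀ Fv : Set V) :
    map w (𝔸.chimneyGerm x F₀ Fv) = 𝔸.chimneyGerm (w x) (w.linear '' F₀) (w.linear '' Fv) := by
  refine (map_chimneyGerm_le hw x F₀ Fv).antisymm ?_
  have hle := map_mono (m := w) (map_chimneyGerm_le (inv_mem hw) (w x) (w.linear '' F₀)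
    (w.linear '' Fv))
  rwa [map_map_inv, AffineEquiv.inv_def, AffineEquiv.symm_apply_apply, ← AffineEquiv.inv_def,
    inv_linear_image_linear_image, inv_linear_image_linear_image] at hle

lemma map_sectorFaceGerm (w : V ≃ᵃ[ℝ] V) (x : V) (Fv : Set V) :
    map w (sectorFaceGerm x Fv) = sectorFaceGerm (w x) (w.linear '' Fv) := by
  refine (map_sectorFaceGerm_le w x Fv).antisymm ?_
  have hle := map_mono (m := w) (map_sectorFaceGerm_le w⁻¹ (w x) (w.linear '' Fv))
  rwa [map_map_inv, AffineEquiv.inv_def, AffineEquiv.symm_apply_apply, ← AffineEquiv.inv_def,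
    inv_linear_image_linear_image] at hle

end Continuity

end ModelApartment

/-! ## Chimneys -/

lemma nonneg_of_forall_pos_add_mul_nonneg {a b : ℝ} (h : ∀ t : ℝ, 0 < t → 0 ≤ a + t * b) :
    0 ≤ a ∧ 0 ≤ b := by
  constructor
  · have hlim : Tendsto (fun t : ℝ => a + t * b) (𝓝[>] 0) (𝓝 a) := by
      simpa using ((by fun_prop : Continuous fun t : ℝ => a + t * b).tendsto 0).mono_left
        nhdsWithin_le_nhds
    exact ge_of_tendsto hlim (eventually_mem_nhdsWithin.mono h)
  · have hlim : Tendsto (fun t : ℝ => t⁻¹ * a + b) atTop (𝓝 b) := by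
      simpa using (tendsto_inv_atTop_zero.mul_const a).add_const b
    refine ge_of_tendsto hlim ((eventually_gt_atTop 0).mono fun t ht => ?_)
    have := mul_nonneg (inv_pos.2 ht).le (h t ht)
    rwa [mul_add, inv_mul_cancel_left₀ ht.ne'] at this

namespace RootBasis

open ModelApartment

variable {V : Type*} [NormedAddCommGroup V] [NormedSpace ℝ V] {I : Type*} {R : RootBasis V I}
  {ε : ℤˣ} {J : Set I}

lemma isVectorialFacet_facetOf_one (ε : ℤˣ) (J : Set I) :
    R.IsVectorialFacet (R.facetOf ε 1 J) :=
  ⟨ε, 1, one_mem _, J, rfl⟩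

lemma isSphericalFacet_facetOf_one (hJ : R.IsSpherical J) (ε : ℤˣ) :
    R.IsSphericalFacet (R.facetOf ε 1 J) :=
  ⟨ε, 1, one_mem _, J, hJ, rfl⟩

lemma IsSphericalFacet.isVectorialFacet {F : Set V} (h : R.IsSphericalFacet F) :
    R.IsVectorialFacet F := by
  obtain ⟨ε, w, hw, J, -, rfl⟩ := h
  exact ⟨ε, w, hw, J, rfl⟩

lemma IsVectorialFacet.image {w : V ≃ₗ[ℝ] V} (hw : w ∈ R.weyl) {F : Set V}
    (hF : R.IsVectorialFacet F) : R.IsVectorialFacet (w '' F) := by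
  obtain ⟨ε, v, hv, J, rfl⟩ := hF
  exact ⟨ε, w * v, mul_mem hw hv, J, image_facetOf ..⟩

lemma facetOf_one_subset_VJ : R.facetOf ε 1 J ⊆ R.VJ J := by
  rintro _ ⟨v, hv, rfl⟩
  exact zsmul_mem (fundFacet_subset_VJ J hv) ε

lemma image_facetOf_one_of_mem_parabolic {w : V ≃ₗ[ℝ] V} (hw : w ∈ R.parabolic J) :
    w '' R.facetOf ε 1 J = R.facetOf ε 1 J := by
  conv_rhs => rw [← Set.image_id (R.facetOf ε 1 J)]
  exact Set.image_congr fun v hv => apply_eq_self_of_mem_parabolic hw (facetOf_one_subset_VJ hv)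

lemma IsVectorialFacet.smul_mem {F : Set V} (hF : R.IsVectorialFacet F) {u : V} (hu : u ∈ F)
    {t : ℝ} (ht : 0 < t) : t • u ∈ F := by
  obtain ⟨ε, w, -, J, rfl⟩ := hF
  exact smul_mem_facetOf hu ht

lemma tendsto_localFacet {F : Set V} (hF : R.IsVectorialFacet F) (x : V) {u : V} (hu : u ∈ F) :
    Tendsto (fun t : ℝ => x + t • u) (𝓝[>] 0) (localFacet x F) := by
  refine tendsto_inf.2 ⟨?_, tendsto_principal.2 (eventually_mem_nhdsWithin.mono fun t ht =>
    Set.add_mem_add rfl (hF.smul_mem hu ht))⟩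
  simpa using ((by fun_prop : Continuous fun t : ℝ => x + t • u).tendsto 0).mono_left
    nhdsWithin_le_nhds

variable [FiniteDimensional ℝ V]

lemma closure_facetOf_one_subset_VJ : closure (R.facetOf ε 1 J) ⊆ R.VJ J :=
  closure_minimal facetOf_one_subset_VJ (Submodule.closed_of_finiteDimensional _)

lemma IsVectorialFacet.nonempty {F : Set V} (hF : R.IsVectorialFacet F) : F.Nonempty := by
  obtain ⟨ε, w, -, J, rfl⟩ := hF
  exact R.facetOf_nonempty ε w J

lemma sectorFaceGerm_add_le [Finite I] (x : V) {n : V} (hn : n ∈ R.VJ J) :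
    sectorFaceGerm (x + n) (R.facetOf ε 1 J) ≤ sectorFaceGerm x (R.facetOf ε 1 J) := by
  intro S hS
  rw [mem_sectorFaceGerm] at hS ⊢
  obtain ⟨ξ, hξ, hS⟩ := hS
  obtain ⟨η, hη⟩ := R.facetOf_nonempty ε 1 J
  obtain ⟨t, ht, hmem⟩ := exists_add_smul_mem_facetOf_one hn hη
  refine ⟨ξ + t • η, add_mem_closure_facetOf hξ (subset_closure (smul_mem_facetOf hη ht)),
    fun v hv => ?_⟩
  convert hS (n + t • η + v) (add_mem_facetOf hmem hv) using 1
  abel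

lemma sectorFaceGerm_add [Finite I] (x : V) {n : V} (hn : n ∈ R.VJ J) :
    sectorFaceGerm (x + n) (R.facetOf ε 1 J) = sectorFaceGerm x (R.facetOf ε 1 J) := by
  refine le_antisymm (sectorFaceGerm_add_le x hn) ?_
  simpa only [add_neg_cancel_right] using
    sectorFaceGerm_add_le (R := R) (ε := ε) (x + n) (neg_mem hn)

lemma nonneg_of_add_facetOf_subset_halfOf {w : V ≃ₗ[ℝ] V} {α : Module.Dual ℝ V}
    {x : V} {k : ℝ} (h : {x} + R.facetOf ε w J ⊆ halfOf α k) :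
    0 ≤ α x + k ∧ ∀ v ∈ R.facetOf ε w J, 0 ≤ α v := by
  have hray {v : V} (hv : v ∈ R.facetOf ε w J) : 0 ≤ α x + k ∧ 0 ≤ α v :=
    nonneg_of_forall_pos_add_mul_nonneg fun t ht => by
      have hmem : 0 ≤ α (x + t • v) + k := h (Set.add_mem_add rfl (smul_mem_facetOf hv ht))
      rwa [map_add, map_smul, smul_eq_mul, add_right_comm] at hmem
  obtain ⟨η, hη⟩ := R.facetOf_nonempty ε w J
  exact ⟨(hray hη).1, fun v hv => (hray hv).2⟩

lemma sub_mem_VJ_of_sectorFaceGerm_eq {x y : V}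
    (h : sectorFaceGerm x (R.facetOf ε 1 J) = sectorFaceGerm y (R.facetOf ε 1 J)) :
    y - x ∈ R.VJ J := by
  have hmem := R.add_facetOf_mem_sectorFaceGerm (ε := ε) (w := 1) (J := J) x
  rw [h, mem_sectorFaceGerm] at hmem
  obtain ⟨ξ, hξ, hsub⟩ := hmem
  obtain ⟨η, hη⟩ := R.facetOf_nonempty ε 1 J
  rw [Set.singleton_add] at hsub
  obtain ⟨u, hu, huη : x + u = y + ξ + η⟩ := hsub η hη
  have hyx : y - x = u - ξ - η := by
    rw [sub_sub, eq_sub_iff_add_eq, sub_add_eq_add_sub, sub_eq_iff_eq_add', huη, add_assoc]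
  rw [hyx]
  exact sub_mem (sub_mem (facetOf_one_subset_VJ hu) (closure_facetOf_one_subset_VJ hξ))
    (facetOf_one_subset_VJ hη)

end RootBasis

namespace ModelApartment

open RootBasis

variable {V : Type*} [NormedAddCommGroup V] [NormedSpace ℝ V] {I : Type*} [Fintype I]
  {𝔸 : ModelApartment V I}

section LocalFacet

variable {F : Set V} {x u : V}

variable [FiniteDimensional ℝ V]

lemma mem_closure_of_mem_localFacet (hF : 𝔸.IsVectorialFacet F) {T : Set V}
    (hT : T ∈ localFacet x F) : x ∈ closure T := by
  obtain ⟨u, hu⟩ := hF.nonempty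
  have hlim := tendsto_localFacet hF x hu
  exact mem_closure_of_tendsto (hlim.mono_right inf_le_left) (hlim.eventually hT)

lemma halfOf_mem_localFacet_iff (hF : 𝔸.IsVectorialFacet F) (hu : u ∈ F) {α : Module.Dual ℝ V}
    (hα : α ∈ 𝔸.roots) {k : ℝ} :
    halfOf α k ∈ localFacet x F ↔ 0 < α x + k ∨ α x + k = 0 ∧ 0 ≤ α u := by
  constructor
  · intro h
    have hx : 0 ≤ α x + k :=
      (isClosed_halfOf α k).closure_subset (mem_closure_of_mem_localFacet hF h)
    refine hx.lt_or_eq.imp_right fun hx₀ => ⟨hx₀.symm, ?_⟩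
    obtain ⟨t, hmem, ht⟩ := (((tendsto_localFacet hF x hu).eventually h).and
      eventually_mem_nhdsWithin).exists
    have hsum : α (x + t • u) + k = t * α u := by
      rw [map_add, map_smul, smul_eq_mul, add_right_comm, ← hx₀, zero_add]
    exact nonneg_of_mul_nonneg_right (hsum ▸ hmem) ht
  · rintro (h | ⟨hx, hu₀⟩)
    · have hcont : Continuous fun v => α v + k :=
        α.continuous_of_finiteDimensional.add continuous_const
      exact mem_inf_of_left ((hcont.continuousAt.eventually (lt_mem_nhds h)).mono fun v hv => hv.le)
    · obtain ⟨ε, w, hw, J, rfl⟩ := hF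
      refine mem_inf_of_right (mem_principal.2 ?_)
      rw [Set.singleton_add, Set.image_subset_iff]
      intro v hv
      change 0 ≤ α (x + v) + k
      rw [map_add, add_right_comm, hx, zero_add]
      exact apply_nonneg_of_mem_facetOf hα hw hu hv hu₀

end LocalFacet

section Direction

variable {ε : ℤˣ} {J : Set I}

lemma mem_parabolic_of_apply_mem_facetOf_one {w : V ≃ₗ[ℝ] V} (hw : w ∈ 𝔸.weyl) {v : V}
    (hv : v ∈ 𝔸.facetOf ε 1 J) (hwv : w v ∈ 𝔸.facetOf ε 1 J) : w ∈ 𝔸.parabolic J := by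
  rw [mem_facetOf_one] at hv hwv
  exact mem_parabolic_of_apply_mem_fundFacet hw hv (by rwa [map_units_smul])

lemma mem_parabolic_of_image_facetOf_one [FiniteDimensional ℝ V] {w : V ≃ₗ[ℝ] V} (hw : w ∈ 𝔸.weyl)
    (h : w '' 𝔸.facetOf ε 1 J = 𝔸.facetOf ε 1 J) : w ∈ 𝔸.parabolic J := by
  obtain ⟨v, hv⟩ := 𝔸.facetOf_nonempty ε 1 J
  exact mem_parabolic_of_apply_mem_facetOf_one hw hv (h ▸ Set.mem_image_of_mem w hv)

lemma IsHalfFamily.isClosed [FiniteDimensional ℝ V] {D : Module.Dual ℝ V → Set V}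
    (hD : 𝔸.IsHalfFamily D) {α : Module.Dual ℝ V} (hα : α ∈ 𝔸.roots) : IsClosed (D α) := by
  rcases hD α hα with h | ⟨k, -, h⟩ <;> rw [h]
  exacts [isClosed_univ, isClosed_halfOf α k]

lemma IsHalfFamily.add_mem_iff {D : Module.Dual ℝ V → Set V} (hD : 𝔸.IsHalfFamily D)
    {α : Module.Dual ℝ V} (hα : α ∈ 𝔸.rootsJ J) {y n : V} (hn : n ∈ 𝔸.VJ J) :
    y + n ∈ D α ↔ y ∈ D α := by
  rcases hD α (rootsJ_subset_roots J hα) with h | ⟨k, -, h⟩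
  · simp only [h, Set.mem_univ]
  · simp only [h, halfOf, Set.mem_ofPred_eq, map_add, apply_eq_zero_of_mem_rootsJ hα hn, add_zero]

variable [FiniteDimensional ℝ V]

lemma IsEnclosed.add_mem {S : Set V} (hS : 𝔸.IsEnclosed S) {x y v : V} {w : V ≃ₗ[ℝ] V}
    (h : {x} + 𝔸.facetOf ε w J ⊆ S) (hy : y ∈ S) (hv : v ∈ 𝔸.facetOf ε w J) : y + v ∈ S := by
  obtain ⟨D, hD, rfl⟩ := hS
  simp only [Set.mem_iInter, Set.subset_iInter_iff] at *
  intro α hα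
  replace h := h α hα
  replace hy := hy α hα
  rcases hD α hα with hDα | ⟨k, -, hDα⟩
  · exact hDα ▸ Set.mem_univ _
  rw [hDα] at h hy ⊢
  have hαv := (nonneg_of_add_facetOf_subset_halfOf h).2 v hv
  change 0 ≤ α (y + v) + k
  rw [map_add, add_right_comm]
  exact add_nonneg hy hαv

lemma IsEnclosed.mem_chimneyGerm {S : Set V} (hS : 𝔸.IsEnclosed S) {x : V} {F : Set V}
    (hF : S ∈ localFacet x F) {w : V ≃ₗ[ℝ] V} (h : {x} + 𝔸.facetOf ε w J ⊆ S) :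
    S ∈ 𝔸.chimneyGerm x F (𝔸.facetOf ε w J) := by
  refine mem_iInf_of_mem 0 (mem_iInf_of_mem zero_mem_closure_facetOf
    (mem_cl.2 ⟨S, hS, mem_add.2 ⟨S, hS.mem_facet hF, _, mem_principal_self _, ?_⟩, subset_rfl⟩))
  rw [Set.singleton_add]
  rintro _ ⟨y, hy, _, ⟨v, hv, rfl⟩, rfl⟩
  simpa only [zero_add] using hS.add_mem h hy hv

lemma mem_chimneyGerm {x : V} {w : V ≃ₗ[ℝ] V} {F T : Set V} :
    T ∈ 𝔸.chimneyGerm x F (𝔸.facetOf ε w J) ↔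
      ∃ ξ ∈ closure (𝔸.facetOf ε w J), T ∈ 𝔸.chimney x F (𝔸.facetOf ε w J) ξ := by
  have hle {ξ η : V} (hη : η ∈ closure (𝔸.facetOf ε w J)) :
      𝔸.chimney x F (𝔸.facetOf ε w J) (ξ + η) ≤ 𝔸.chimney x F (𝔸.facetOf ε w J) ξ := by
    refine cl_mono (add_le_add le_rfl (principal_mono.2 ?_))
    simp only [Set.singleton_add]
    rintro _ ⟨v, hv, rfl⟩
    exact ⟨η + v, add_mem_facetOf_of_mem_closure hη hv, (add_assoc ξ η v).symm⟩
  exact mem_biInf_of_directed (fun ξ hξ η hη => ⟨ξ + η, add_mem_closure_facetOf hξ hη, hle hη,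
    add_comm η ξ ▸ hle hξ⟩) ⟨0, zero_mem_closure_facetOf⟩

lemma add_subset_of_mem_facet_add {x ξ : V} {F G S : Set V} (hF : 𝔸.IsVectorialFacet F)
    (h : S ∈ 𝔸.facet x F + 𝓟 ({ξ} + G)) (hS : IsClosed S) : {x + ξ} + G ⊆ S := by
  obtain ⟨T, hT, P, hP, hTP⟩ := mem_add.1 h
  rw [Set.singleton_add]
  rintro _ ⟨v, hv, rfl⟩
  have hsub : T ⊆ (· + (ξ + v)) ⁻¹' S := fun y hy =>
    hTP (Set.add_mem_add hy (hP (Set.add_mem_add rfl hv)))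
  have hx := closure_minimal hsub (hS.preimage (by fun_prop))
    (mem_closure_of_mem_localFacet hF (localFacet_le_facet x F hT))
  rwa [Set.mem_preimage, ← add_assoc] at hx

lemma exists_isHalfFamily_of_mem_chimneyGerm {x : V} {F T : Set V} (hF : 𝔸.IsVectorialFacet F)
    (hT : T ∈ 𝔸.chimneyGerm x F (𝔸.facetOf ε 1 J)) :
    ∃ D, 𝔸.IsHalfFamily D ∧ (⋂ α ∈ 𝔸.roots, D α) ⊆ T ∧
      (∃ y, {y} + 𝔸.facetOf ε 1 J ⊆ ⋂ α ∈ 𝔸.roots, D α) ∧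
      ∀ α ∈ 𝔸.rootsJ J, D α ∈ localFacet x F := by
  obtain ⟨ξ, hξ, hT⟩ := mem_chimneyGerm.1 hT
  obtain ⟨S, hS, hmem, hST⟩ := mem_cl.1 hT
  have hsub := add_subset_of_mem_facet_add hF hmem hS.isClosed
  obtain ⟨D, hD, rfl⟩ := hS
  refine ⟨D, hD, hST, ⟨x + ξ, hsub⟩, fun α hα => ?_⟩
  obtain ⟨U, hU, P, hP, hUP⟩ := mem_add.1 hmem
  refine mem_of_superset (localFacet_le_facet x F hU) fun y hy => ?_
  obtain ⟨η, hη⟩ := 𝔸.facetOf_nonempty ε 1 J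
  have hyα := Set.mem_iInter₂.1 (hUP (Set.add_mem_add hy (hP (Set.add_mem_add rfl hη)))) α
    (rootsJ_subset_roots J hα)
  exact (hD.add_mem_iff hα (add_mem (closure_facetOf_one_subset_VJ hξ)
    (facetOf_one_subset_VJ hη))).1 hyα

lemma exists_smul_add_nonneg (hJ : 𝔸.IsSpherical J) {η : V} (hη : η ∈ 𝔸.facetOf ε 1 J) (v : V) :
    ∃ t : ℝ, 0 < t ∧ ∀ α ∈ 𝔸.roots, 0 < α η → 0 ≤ α (t • η + v) := by
  have hlim : Tendsto (fun t : ℝ => η + t⁻¹ • v) atTop (𝓝 η) := by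
    simpa using ((tendsto_inv_atTop_zero (𝕜 := ℝ)).smul_const v).const_add η
  obtain ⟨t, hnonneg, ht⟩ := ((hlim.eventually (eventually_forall_roots_nonneg hJ hη)).and
    (eventually_gt_atTop 0)).exists
  refine ⟨t, ht, fun α hα hpos => ?_⟩
  have hscale : t • η + v = t • (η + t⁻¹ • v) := by rw [smul_add, smul_inv_smul₀ ht.ne']
  rw [hscale, map_smul]
  exact mul_nonneg ht.le (hnonneg α hα hpos)

/-- Far enough in the direction `F^v`, the half-spaces of the roots not vanishing on `F^v` impose no
condition. -/
lemma IsHalfFamily.mem_sectorFaceGerm_iff {D : Module.Dual ℝ V → Set V} (hD : 𝔸.IsHalfFamily D)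
    (hJ : 𝔸.IsSpherical J) {x z : V} (h : {x} + 𝔸.facetOf ε 1 J ⊆ ⋂ α ∈ 𝔸.roots, D α) :
    (⋂ α ∈ 𝔸.roots, D α) ∈ sectorFaceGerm z (𝔸.facetOf ε 1 J) ↔ ∀ α ∈ 𝔸.rootsJ J, z ∈ D α := by
  obtain ⟨η, hη⟩ := 𝔸.facetOf_nonempty ε 1 J
  rw [mem_sectorFaceGerm]
  simp only [Set.mem_iInter, Set.subset_iInter_iff] at h ⊢
  constructor
  · rintro ⟨ξ, hξ, hmem⟩ α hα
    have hzη := hmem η hη α (rootsJ_subset_roots J hα)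
    rwa [hD.add_mem_iff hα (facetOf_one_subset_VJ hη),
      hD.add_mem_iff hα (closure_facetOf_one_subset_VJ hξ)] at hzη
  · intro hz
    obtain ⟨t, ht, hnonneg⟩ := exists_smul_add_nonneg hJ hη (z - x)
    have htη := smul_mem_facetOf hη ht
    refine ⟨t • η, subset_closure htη, fun v hv α hα => ?_⟩
    rcases hD α hα with hDα | ⟨k, -, hDα⟩
    · exact hDα ▸ Set.mem_univ _
    obtain ⟨hx, hdir⟩ := nonneg_of_add_facetOf_subset_halfOf (hDα ▸ h α hα)
    rcases (hdir η hη).lt_or_eq with hαη | hαη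
    · rw [hDα]
      have hfar := hnonneg α hα hαη
      have hαv := hdir v hv
      change 0 ≤ α (z + t • η + v) + k
      rw [map_add, map_sub] at hfar
      rw [map_add, map_add]
      linarith
    · have hαJ := mem_rootsJ_of_apply_eq_zero hJ hη hα hαη.symm
      rw [hD.add_mem_iff hαJ (facetOf_one_subset_VJ hv),
        hD.add_mem_iff hαJ (facetOf_one_subset_VJ htη)]
      exact hz α hαJ

lemma IsHalfFamily.mem_of_mem_localFacet {D : Module.Dual ℝ V → Set V} (hD : 𝔸.IsHalfFamily D)
    {x : V} {F : Set V} (hF : 𝔸.IsVectorialFacet F) {α : Module.Dual ℝ V} (hα : α ∈ 𝔸.roots)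
    (h : D α ∈ localFacet x F) : x ∈ D α :=
  (hD.isClosed hα).closure_subset (mem_closure_of_mem_localFacet hF h)

lemma sectorFaceGerm_le_chimneyGerm (hJ : 𝔸.IsSpherical J) (x : V) {F : Set V}
    (hF : 𝔸.IsVectorialFacet F) :
    sectorFaceGerm x (𝔸.facetOf ε 1 J) ≤ 𝔸.chimneyGerm x F (𝔸.facetOf ε 1 J) := by
  intro T hT
  obtain ⟨D, hD, hDT, ⟨y, hy⟩, hloc⟩ := exists_isHalfFamily_of_mem_chimneyGerm hF hT
  exact mem_of_superset ((hD.mem_sectorFaceGerm_iff hJ hy).2 fun α hα =>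
    hD.mem_of_mem_localFacet hF (rootsJ_subset_roots J hα) (hloc α hα)) hDT

lemma isSolid_of_isSpherical (hJ : 𝔸.IsSpherical J) (x : V) {F : Set V}
    (hF : 𝔸.IsVectorialFacet F) : 𝔸.IsSolid x F (𝔸.facetOf ε 1 J) := by
  refine Set.Finite.subset hJ ?_
  rintro w ⟨hw, hfix⟩
  obtain ⟨η, hη⟩ := 𝔸.facetOf_nonempty ε 1 J
  have hsub : {x} + 𝔸.facetOf ε 1 J ⊆ support (𝔸.chimney x F (𝔸.facetOf ε 1 J) 0) := by
    rw [support, AffineSubspace.coe_sInf]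
    refine Set.subset_iInter₂ fun E hE => ?_
    obtain ⟨S, hS, hmem, hSE⟩ := mem_cl.1 (show (E : Set V) ∈ 𝔸.cl _ from hE)
    simpa only [add_zero] using (add_subset_of_mem_facet_add hF hmem hS.isClosed).trans hSE
  have hdir : η ∈ (support (𝔸.chimney x F (𝔸.facetOf ε 1 J) 0)).direction := by
    simpa using AffineSubspace.vsub_mem_direction
      (hsub (Set.add_mem_add rfl (add_mem_facetOf hη hη))) (hsub (Set.add_mem_add rfl hη))
  exact mem_parabolic_of_apply_mem_facetOf_one hw hη ((hfix η hdir).symm ▸ hη)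

end Direction

end ModelApartment

/-! ## The quotient apartment `𝔸_J` -/

lemma exists_smul_eq_of_hyperplane_eq {K E : Type*} [Field K] [AddCommGroup E] [Module K E]
    {φ ψ : Module.Dual K E} {k l : K} (hφ : φ ≠ 0)
    (h : {v | φ v + k = 0} = {v | ψ v + l = 0}) : ∃ c : K, c ≠ 0 ∧ φ = c • ψ ∧ k = c * l := by
  have hiff (v : E) : φ v + k = 0 ↔ ψ v + l = 0 := Set.ext_iff.1 h v
  obtain ⟨x, hx⟩ := LinearMap.surjective hφ (-k)
  have hφx : φ x + k = 0 := by rw [hx, neg_add_cancel]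
  have hψx : ψ x + l = 0 := (hiff x).1 hφx
  have hker : LinearMap.ker ψ ≤ LinearMap.ker φ := fun v hv => by
    have hadd := (hiff (x + v)).2 (by rw [map_add, LinearMap.mem_ker.1 hv, add_zero, hψx])
    rwa [map_add, add_right_comm, hφx, zero_add] at hadd
  have hmem := mem_span_of_iInf_ker_le_ker (L := fun _ : Unit => ψ) (K := φ) (by simpa using hker)
  rw [Set.range_const, Submodule.mem_span_singleton] at hmem
  obtain ⟨c, rfl⟩ := hmem
  refine ⟨c, fun hc => hφ (by rw [hc, zero_smul]), rfl, ?_⟩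
  rw [LinearMap.smul_apply, smul_eq_mul] at hφx
  linear_combination hφx - c * hψx

namespace EuclideanBuilding

variable {E : Type*} [AddCommGroup E] [Module ℝ E] [TopologicalSpace E]

/-- The germ at `x` of `x + F`, where `F` is the vectorial facet of `u`. -/
def germ (walls : Set (Set E)) (x u : E) : Filter E :=
  𝓝 x ⊓ 𝓟 ({x} + vectorialFacet walls u)

variable {walls : Set (Set E)} {x u : E}

lemma tendsto_germ [ContinuousAdd E] [ContinuousSMul ℝ E] :
    Tendsto (fun t : ℝ => x + t • u) (𝓝[>] 0) (germ walls x u) := by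
  refine tendsto_inf.2 ⟨?_, tendsto_principal.2 (eventually_mem_nhdsWithin.mono fun t ht =>
    Set.add_mem_add rfl fun φ k _ _ => ?_)⟩
  · simpa using ((by fun_prop : Continuous fun t : ℝ => x + t • u).tendsto 0).mono_left
      nhdsWithin_le_nhds
  · rw [map_smul, smul_eq_mul, sign_mul, sign_pos ht, one_mul]

lemma halfSpace_mem_germ_iff [ContinuousAdd E] [ContinuousSMul ℝ E] {φ : Module.Dual ℝ E}
    (hφ : φ ≠ 0) (hcont : Continuous φ) (hwall : ∃ l : ℝ, {v | φ v + l = 0} ∈ walls) {k : ℝ} :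
    {v | 0 ≤ φ v + k} ∈ germ walls x u ↔ 0 < φ x + k ∨ φ x + k = 0 ∧ 0 ≤ φ u := by
  have hcont' : Continuous fun v => φ v + k := hcont.add continuous_const
  constructor
  · intro h
    have hray : ∀ᶠ t in 𝓝[>] (0 : ℝ), 0 ≤ φ (x + t • u) + k := tendsto_germ.eventually h
    have hlim : Tendsto (fun t : ℝ => x + t • u) (𝓝[>] 0) (𝓝 x) :=
      (tendsto_germ (walls := walls)).mono_right inf_le_left
    have hx : 0 ≤ φ x + k := ge_of_tendsto ((hcont'.tendsto x).comp hlim) hray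
    refine hx.lt_or_eq.imp_right fun hx₀ => ⟨hx₀.symm, ?_⟩
    obtain ⟨t, hmem, ht⟩ := (hray.and eventually_mem_nhdsWithin).exists
    rw [map_add, map_smul, smul_eq_mul, add_right_comm, ← hx₀, zero_add] at hmem
    exact nonneg_of_mul_nonneg_right hmem ht
  · rintro (h | ⟨hx, hu⟩)
    · exact mem_inf_of_left (((hcont'.tendsto x).eventually (lt_mem_nhds h)).mono fun v hv => hv.le)
    · refine mem_inf_of_right (mem_principal.2 ?_)
      rw [Set.singleton_add, Set.image_subset_iff]
      intro v hv
      obtain ⟨l, hl⟩ := hwall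
      change 0 ≤ φ (x + v) + k
      rwa [map_add, add_right_comm, hx, zero_add, ← sign_nonneg_iff, hv φ l hφ hl, sign_nonneg_iff]

end EuclideanBuilding

namespace ModelApartment

open RootBasis

variable {V : Type*} [NormedAddCommGroup V] [NormedSpace ℝ V] {I : Type*} [Fintype I]
  {𝔸 : ModelApartment V I} {J : Set I} {α : Module.Dual ℝ V}

section Quotient

lemma mkQ_add_of_mem_VJ (y : V) {n : V} (hn : n ∈ 𝔸.VJ J) :
    (𝔸.VJ J).mkQ (y + n) = (𝔸.VJ J).mkQ y := by
  rw [map_add, add_eq_left]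
  exact (Submodule.Quotient.mk_eq_zero _).2 hn

/-- The linear form on `V / V_J` induced by a root of `Φ_J`. -/
def rootBar (h : α ∈ 𝔸.rootsJ J) : Module.Dual ℝ (V ⧸ 𝔸.VJ J) :=
  (𝔸.VJ J).liftQ α fun _ hv => apply_eq_zero_of_mem_rootsJ h hv

lemma rootBar_mkQ (h : α ∈ 𝔸.rootsJ J) (x : V) : rootBar h ((𝔸.VJ J).mkQ x) = α x := rfl

lemma rootBar_ne_zero (h : α ∈ 𝔸.rootsJ J) : rootBar h ≠ 0 := fun h₀ =>
  ne_zero_of_mem_realRoots h.1 (LinearMap.ext fun x => by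
    rw [← rootBar_mkQ h, h₀, LinearMap.zero_apply, LinearMap.zero_apply])

lemma rootBar_neg (h : α ∈ 𝔸.rootsJ J) (v : V ⧸ 𝔸.VJ J) :
    rootBar (neg_mem_rootsJ h) v = -rootBar h v := by
  obtain ⟨x, rfl⟩ := (𝔸.VJ J).mkQ_surjective v
  rfl

lemma image_mkQ_preimage_rootBar (h : α ∈ 𝔸.rootsJ J) (s : Set ℝ) :
    (𝔸.VJ J).mkQ '' (α ⁻¹' s) = rootBar h ⁻¹' s :=
  Set.image_preimage_eq (rootBar h ⁻¹' s) (𝔸.VJ J).mkQ_surjective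

lemma image_mkQ_wallOf (h : α ∈ 𝔸.rootsJ J) (k : ℝ) :
    (𝔸.VJ J).mkQ '' wallOf α k = {v | rootBar h v + k = 0} :=
  image_mkQ_preimage_rootBar h {r | r + k = 0}

lemma image_mkQ_halfOf (h : α ∈ 𝔸.rootsJ J) (k : ℝ) :
    (𝔸.VJ J).mkQ '' halfOf α k = {v | 0 ≤ rootBar h v + k} :=
  image_mkQ_preimage_rootBar h {r | 0 ≤ r + k}

lemma mem_wallsJ (h : α ∈ 𝔸.rootsJ J) {k : ℝ} (hk : wallOf α k ∈ 𝔸.walls) :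
    {v | rootBar h v + k = 0} ∈ 𝔸.wallsJ J :=
  ⟨α, h.1, h.2, k, hk, (image_mkQ_wallOf h k).symm⟩

lemma exists_mem_wallsJ (h : α ∈ 𝔸.rootsJ J) : ∃ k : ℝ, {v | rootBar h v + k = 0} ∈ 𝔸.wallsJ J :=
  (𝔸.infinite_walls α h.1).nonempty.imp fun _ hk => mem_wallsJ h hk

lemma exists_eq_smul_rootBar {φ : Module.Dual ℝ (V ⧸ 𝔸.VJ J)} (hφ : φ ≠ 0) {k : ℝ}
    (h : {v | φ v + k = 0} ∈ 𝔸.wallsJ J) :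
    ∃ (α : Module.Dual ℝ V) (hα : α ∈ 𝔸.rootsJ J) (l : ℝ), wallOf α l ∈ 𝔸.walls ∧
      ∃ c : ℝ, c ≠ 0 ∧ φ = c • rootBar hα ∧ k = c * l := by
  obtain ⟨α, hreal, hspan, l, hl, heq⟩ := h
  have hα : α ∈ 𝔸.rootsJ J := ⟨hreal, hspan⟩
  rw [image_mkQ_wallOf hα] at heq
  exact ⟨α, hα, l, hl, exists_smul_eq_of_hyperplane_eq hφ heq⟩

end Quotient

section ClosedFacet

lemma wallOf_neg (α : Module.Dual ℝ V) (k : ℝ) : wallOf (-α) (-k) = wallOf α k := by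
  ext v
  simp only [wallOf, Set.mem_ofPred_eq, LinearMap.neg_apply, ← neg_add, neg_eq_zero]

lemma mem_halfSpaces_wallsJ_iff {H : Set (V ⧸ 𝔸.VJ J)} :
    H ∈ EuclideanBuilding.halfSpaces (𝔸.wallsJ J) ↔
      ∃ (α : Module.Dual ℝ V) (hα : α ∈ 𝔸.rootsJ J) (k : ℝ), wallOf α k ∈ 𝔸.walls ∧
        H = {v | 0 ≤ rootBar hα v + k} := by
  constructor
  · rintro ⟨φ, k, hφ, hwall, rfl⟩
    obtain ⟨α, hα, l, hl, c, hc, rfl, rfl⟩ := exists_eq_smul_rootBar hφ hwall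
    have hfactor (v : V ⧸ 𝔸.VJ J) : (c • rootBar hα) v + c * l = c * (rootBar hα v + l) := by
      rw [LinearMap.smul_apply, smul_eq_mul, mul_add]
    simp only [hfactor]
    rcases hc.lt_or_gt with hneg | hpos
    · refine ⟨-α, neg_mem_rootsJ hα, -l, by rwa [wallOf_neg], ?_⟩
      ext v
      rw [Set.mem_ofPred_eq, Set.mem_ofPred_eq, rootBar_neg hα, ← neg_add, neg_nonneg]
      exact ⟨fun h => nonpos_of_mul_nonneg_right h hneg, mul_nonneg_of_nonpos_of_nonpos hneg.le⟩
    · exact ⟨α, hα, l, hl, by simp only [mul_nonneg_iff_of_pos_left hpos]⟩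
  · rintro ⟨α, hα, k, hk, rfl⟩
    exact ⟨rootBar hα, k, rootBar_ne_zero hα, mem_wallsJ hα hk, rfl⟩

variable [FiniteDimensional ℝ V] {ε : ℤˣ} {x u : V} {F : Set V}

lemma halfSpace_mem_germ_wallsJ_iff (hα : α ∈ 𝔸.rootsJ J) {k : ℝ} (hF : 𝔸.IsVectorialFacet F)
    (hu : u ∈ F) :
    {v | 0 ≤ rootBar hα v + k} ∈
        EuclideanBuilding.germ (𝔸.wallsJ J) ((𝔸.VJ J).mkQ x) ((𝔸.VJ J).mkQ u) ↔
      halfOf α k ∈ localFacet x F := by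
  have hcont : Continuous (rootBar hα) :=
    (𝔸.VJ J).isOpenQuotientMap_mkQ.isQuotientMap.continuous_iff.2 α.continuous_of_finiteDimensional
  rw [EuclideanBuilding.halfSpace_mem_germ_iff (rootBar_ne_zero hα) hcont (exists_mem_wallsJ hα),
    halfOf_mem_localFacet_iff hF hu (rootsJ_subset_roots J hα), rootBar_mkQ, rootBar_mkQ]

lemma IsHalfFamily.image_mkQ_mem_closedFacet {D : Module.Dual ℝ V → Set V} (hD : 𝔸.IsHalfFamily D)
    (hF : 𝔸.IsVectorialFacet F) (hu : u ∈ F) (hα : α ∈ 𝔸.rootsJ J) (h : D α ∈ localFacet x F) :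
    (𝔸.VJ J).mkQ '' D α ∈
      EuclideanBuilding.closedFacet (𝔸.wallsJ J) ((𝔸.VJ J).mkQ x) ((𝔸.VJ J).mkQ u) := by
  rcases hD α (rootsJ_subset_roots J hα) with hDα | ⟨k, hk, hDα⟩
  · rw [hDα, Set.image_univ, Set.range_eq_univ.2 (𝔸.VJ J).mkQ_surjective]
    exact univ_mem
  · have hwall : wallOf α k ∈ 𝔸.walls :=
      hk.elim And.right fun him => absurd him (by simpa using 𝔸.im_disjoint α hα.1 1)
    rw [hDα] at h ⊢
    rw [image_mkQ_halfOf hα]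
    exact GenerateSets.basic ⟨mem_halfSpaces_wallsJ_iff.2 ⟨α, hα, k, hwall, rfl⟩,
      (halfSpace_mem_germ_wallsJ_iff hα hF hu).2 h⟩

lemma IsHalfFamily.mem_closedFacet {D : Module.Dual ℝ V → Set V} (hD : 𝔸.IsHalfFamily D)
    (hJ : 𝔸.IsSpherical J) (hF : 𝔸.IsVectorialFacet F) (hu : u ∈ F)
    (h : ∀ α ∈ 𝔸.rootsJ J, D α ∈ localFacet x F) {T : Set (V ⧸ 𝔸.VJ J)}
    (hT : ∀ z, (∀ α ∈ 𝔸.rootsJ J, z ∈ D α) → (𝔸.VJ J).mkQ z ∈ T) :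
    T ∈ EuclideanBuilding.closedFacet (𝔸.wallsJ J) ((𝔸.VJ J).mkQ x) ((𝔸.VJ J).mkQ u) := by
  refine mem_of_superset ((biInter_mem (finite_rootsJ hJ)).2 fun α hα =>
    hD.image_mkQ_mem_closedFacet hF hu hα (h α hα)) fun v hv => ?_
  obtain ⟨z, rfl⟩ := (𝔸.VJ J).mkQ_surjective v
  refine hT z fun α hα => ?_
  obtain ⟨y, hy, hyz⟩ := Set.mem_iInter₂.1 hv α hα
  have hsub : z - y ∈ 𝔸.VJ J := (Submodule.Quotient.eq _).1 hyz.symm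
  simpa only [add_sub_cancel] using (hD.add_mem_iff hα hsub (y := y)).2 hy

lemma exists_isEnclosed_preimage_of_mem_closedFacet (hF : 𝔸.IsVectorialFacet F) (hu : u ∈ F)
    {T : Set (V ⧸ 𝔸.VJ J)}
    (hT : T ∈ EuclideanBuilding.closedFacet (𝔸.wallsJ J) ((𝔸.VJ J).mkQ x) ((𝔸.VJ J).mkQ u)) :
    ∃ T' ⊆ T, 𝔸.IsEnclosed ((𝔸.VJ J).mkQ ⁻¹' T') ∧ (𝔸.VJ J).mkQ ⁻¹' T' ∈ localFacet x F := by
  obtain ⟨𝒯, h𝒯, hfin, hsub⟩ := mem_generate_iff.1 hT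
  refine ⟨⋂₀ 𝒯, hsub, ?_⟩
  rw [Set.preimage_sInter, ← Set.sInter_image, sInter_mem (hfin.image _)]
  have hhalf : ∀ H ∈ 𝒯, 𝔸.IsEnclosed ((𝔸.VJ J).mkQ ⁻¹' H) ∧
      (𝔸.VJ J).mkQ ⁻¹' H ∈ localFacet x F := fun H hH => by
    obtain ⟨hspace, hmem⟩ := h𝒯 hH
    obtain ⟨α, hα, k, hk, rfl⟩ := mem_halfSpaces_wallsJ_iff.1 hspace
    exact ⟨isEnclosed_halfOf (rootsJ_subset_roots J hα) (Or.inl ⟨hα.1, hk⟩),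
      (halfSpace_mem_germ_wallsJ_iff hα hF hu).1 hmem⟩
  exact ⟨IsEnclosed.sInter (hfin.image _) (Set.forall_mem_image.2 fun H hH => (hhalf H hH).1),
    Set.forall_mem_image.2 fun H hH => (hhalf H hH).2⟩

lemma preimage_mkQ_mem_chimneyGerm (ε : ℤˣ) (hF : 𝔸.IsVectorialFacet F) {T : Set (V ⧸ 𝔸.VJ J)}
    (hT : 𝔸.IsEnclosed ((𝔸.VJ J).mkQ ⁻¹' T)) (hloc : (𝔸.VJ J).mkQ ⁻¹' T ∈ localFacet x F) :
    (𝔸.VJ J).mkQ ⁻¹' T ∈ 𝔸.chimneyGerm x F (𝔸.facetOf ε 1 J) := by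
  have hx : x ∈ (𝔸.VJ J).mkQ ⁻¹' T :=
    hT.isClosed.closure_subset (mem_closure_of_mem_localFacet hF hloc)
  refine hT.mem_chimneyGerm hloc ?_
  rw [Set.singleton_add, Set.image_subset_iff]
  intro v hv
  rwa [Set.mem_preimage, Set.mem_preimage, mkQ_add_of_mem_VJ x (facetOf_one_subset_VJ hv)]

end ClosedFacet

section Form

variable (hJ : 𝔸.IsSpherical J)

/-- The scalar product on `V / V_J` induced by `formJ`. -/
noncomputable def formBar : LinearMap.BilinForm ℝ (V ⧸ 𝔸.VJ J) :=
  (𝔸.VJ J).liftQ ((𝔸.VJ J).liftQ (formJ hJ) fun _ hx =>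
    LinearMap.ext (formJ_eq_zero_of_mem_VJ hJ hx)).flip fun x hx => by
      ext y
      exact (formJ_comm hJ y x).trans (formJ_eq_zero_of_mem_VJ hJ hx y)

lemma formBar_mkQ (x y : V) : formBar hJ ((𝔸.VJ J).mkQ x) ((𝔸.VJ J).mkQ y) = formJ hJ x y :=
  formJ_comm hJ y x

lemma formBar_comm (x y : V ⧸ 𝔸.VJ J) : formBar hJ x y = formBar hJ y x := by
  obtain ⟨x, rfl⟩ := (𝔸.VJ J).mkQ_surjective x
  obtain ⟨y, rfl⟩ := (𝔸.VJ J).mkQ_surjective y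
  rw [formBar_mkQ, formBar_mkQ, formJ_comm]

lemma formBar_pos (x : V ⧸ 𝔸.VJ J) (hx : x ≠ 0) : 0 < formBar hJ x x := by
  obtain ⟨x, rfl⟩ := (𝔸.VJ J).mkQ_surjective x
  rw [formBar_mkQ]
  exact formJ_pos hJ fun h => hx ((Submodule.Quotient.mk_eq_zero _).2 h)

lemma eq_of_formBar_eq {x y : V ⧸ 𝔸.VJ J} (h : ∀ v, formBar hJ x v = formBar hJ y v) :
    x = y := by
  by_contra hne
  have hpos := formBar_pos hJ (x - y) (sub_ne_zero.2 hne)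
  rw [(formBar hJ).map_sub x y, LinearMap.sub_apply, h, sub_self] at hpos
  exact hpos.false

lemma mkQ_coroot_ne_zero {c : V} (hc : 𝔸.IsRootPair α c)
    (hα : α ∈ Submodule.span ℝ (𝔸.root '' J)) : (𝔸.VJ J).mkQ c ≠ 0 := fun h =>
  hc.coroot_notMem_VJ hα ((Submodule.Quotient.mk_eq_zero _).1 h)

end Form

section WJ

variable {g : (V ⧸ 𝔸.VJ J) ≃ᵃ[ℝ] (V ⧸ 𝔸.VJ J)}

lemma image_mem_wallsJ (hg : g ∈ 𝔸.WJ J) {M : Set (V ⧸ 𝔸.VJ J)} (hM : M ∈ 𝔸.wallsJ J) :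
    g '' M ∈ 𝔸.wallsJ J := by
  obtain ⟨w, hw, hlin, hgw⟩ := hg
  obtain ⟨α, hreal, hspan, k, hk, rfl⟩ := hM
  have himage : w '' wallOf α k =
      wallOf (α ∘ₗ (w.linear⁻¹ : V ≃ₗ[ℝ] V).toLinearMap) (α ((w⁻¹ : V ≃ᵃ[ℝ] V) 0) + k) := by
    exact (w.toEquiv.image_eq_preimage_symm _).trans (preimage_wallOf (w⁻¹ : V ≃ᵃ[ℝ] V) α k)
  have hα := comp_mem_rootsJ ⟨hreal, hspan⟩ (inv_mem hlin)
  refine ⟨_, hα.1, hα.2, _, himage ▸ 𝔸.walls_stable w hw _ hk, ?_⟩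
  rw [← himage, Set.image_image, Set.image_image]
  exact Set.image_congr fun x _ => hgw x

lemma linear_apply_mkQ {w : V ≃ᵃ[ℝ] V} (h : ∀ x, g ((𝔸.VJ J).mkQ x) = (𝔸.VJ J).mkQ (w x)) (x : V) :
    g.linear ((𝔸.VJ J).mkQ x) = (𝔸.VJ J).mkQ (w.linear x) := by
  have hg : g ((𝔸.VJ J).mkQ x) - g ((𝔸.VJ J).mkQ 0) = g.linear ((𝔸.VJ J).mkQ x - (𝔸.VJ J).mkQ 0) :=
    (g.toAffineMap.linearMap_vsub _ _).symm
  have hw : w x - w 0 = w.linear x := by rw [affineEquiv_apply_eq w x, add_sub_cancel_left]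
  rw [map_zero, sub_zero, ← map_zero (𝔸.VJ J).mkQ, h, h, ← map_sub, hw] at hg
  exact hg.symm

lemma formBar_sub_sub (hJ : 𝔸.IsSpherical J) (hg : g ∈ 𝔸.WJ J) (x y : V ⧸ 𝔸.VJ J) :
    formBar hJ (g x - g y) (g x - g y) = formBar hJ (x - y) (x - y) := by
  obtain ⟨w, -, hlin, hgw⟩ := hg
  obtain ⟨z, hz⟩ := (𝔸.VJ J).mkQ_surjective (x - y)
  have hsub : g x - g y = (𝔸.VJ J).mkQ (w.linear z) := by
    rw [← linear_apply_mkQ hgw, hz]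
    exact (g.toAffineMap.linearMap_vsub x y).symm
  rw [hsub, ← hz, formBar_mkQ, formBar_mkQ, formJ_apply_apply_of_mem_parabolic hJ hlin]

end WJ

section Reflections

variable [FiniteDimensional ℝ V] (hJ : 𝔸.IsSpherical J) {c : V}

lemma formBar_coroot (hc : 𝔸.IsRootPair α c) (hα : α ∈ 𝔸.rootsJ J) (v : V ⧸ 𝔸.VJ J) :
    formBar hJ ((𝔸.VJ J).mkQ c) v = formJ hJ c c / 2 * rootBar hα v := by
  obtain ⟨x, rfl⟩ := (𝔸.VJ J).mkQ_surjective v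
  rw [formBar_mkQ, rootBar_mkQ]
  exact formJ_coroot hJ hc hα.2 x

lemma setOf_formBar_coroot_eq (hc : 𝔸.IsRootPair α c) (hα : α ∈ 𝔸.rootsJ J) (k : ℝ) :
    {v | formBar hJ ((𝔸.VJ J).mkQ c) v = -(formJ hJ c c / 2 * k)} = {v | rootBar hα v + k = 0} := by
  have hpos := formJ_pos hJ (hc.coroot_notMem_VJ hα.2)
  ext v
  rw [Set.mem_ofPred_eq, Set.mem_ofPred_eq, formBar_coroot hJ hc hα, eq_neg_iff_add_eq_zero,
    ← mul_add, mul_eq_zero_iff_left (by positivity)]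

lemma orthogonalReflection_smul_coroot (hc : 𝔸.IsRootPair α c) (hα : α ∈ 𝔸.rootsJ J) {s : ℝ}
    (hs : s ≠ 0) (k : ℝ) (v : V ⧸ 𝔸.VJ J) :
    (2 * (formBar hJ (s • (𝔸.VJ J).mkQ c) v - -(s * (formJ hJ c c / 2 * k))) /
        formBar hJ (s • (𝔸.VJ J).mkQ c) (s • (𝔸.VJ J).mkQ c)) • s • (𝔸.VJ J).mkQ c =
      (rootBar hα v + k) • (𝔸.VJ J).mkQ c := by
  have hpos := formJ_pos hJ (hc.coroot_notMem_VJ hα.2)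
  simp only [map_smul, LinearMap.smul_apply, smul_eq_mul, formBar_mkQ, smul_smul]
  rw [formBar_coroot hJ hc hα]
  congr 1
  field

lemma exists_eq_smul_coroot {n : V ⧸ 𝔸.VJ J} {d : ℝ} (hn : n ≠ 0)
    (h : {v | formBar hJ n v = d} ∈ 𝔸.wallsJ J) :
    ∃ α ∈ 𝔸.rootsJ J, ∃ (c : V) (k s : ℝ), 𝔸.IsRootPair α c ∧ wallOf α k ∈ 𝔸.walls ∧ s ≠ 0 ∧
      n = s • (𝔸.VJ J).mkQ c ∧ d = -(s * (formJ hJ c c / 2 * k)) := by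
  have hform : formBar hJ n ≠ 0 := fun h₀ => hn <| eq_of_formBar_eq hJ fun v => by
    rw [h₀, map_zero]
  obtain ⟨α, hα, k, hk, t, ht, hnt, hdt⟩ := exists_eq_smul_rootBar hform (k := -d)
    (by simpa only [add_neg_eq_zero] using h)
  obtain ⟨c, hc⟩ := hα.1
  have hpos := formJ_pos hJ (hc.coroot_notMem_VJ hα.2)
  refine ⟨α, hα, c, k, 2 * t / formJ hJ c c, hc, hk, by positivity, ?_, ?_⟩
  · refine eq_of_formBar_eq hJ fun v => ?_
    rw [hnt, map_smul, LinearMap.smul_apply, LinearMap.smul_apply, formBar_coroot hJ hc hα,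
      smul_eq_mul, smul_eq_mul]
    field
  · rw [← neg_eq_iff_eq_neg, hdt]
    field

lemma weylGroup_le_WJ : EuclideanBuilding.weylGroup (formBar hJ) (𝔸.wallsJ J) ≤ 𝔸.WJ J := by
  refine (Subgroup.closure_le _).2 ?_
  rintro g ⟨n, d, hn, hwall, hg⟩
  obtain ⟨α, hα, c, k, s, hc, hk, hs, rfl, rfl⟩ := exists_eq_smul_coroot hJ hn hwall
  refine ⟨affineReflection hc.apply_eq_two k, affineReflection_mem_W hc hk,
    reflection_mem_parabolic hc hα.2, fun x => ?_⟩
  rw [hg, orthogonalReflection_smul_coroot hJ hc hα hs, affineReflection_apply, map_sub, map_smul,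
    rootBar_mkQ]

lemma exists_parabolic_semiconj {g : (V ⧸ 𝔸.VJ J) ≃ₗ[ℝ] (V ⧸ 𝔸.VJ J)}
    (hg : g ∈ EuclideanBuilding.vectorialWeylGroup (formBar hJ) (𝔸.wallsJ J)) :
    ∃ u ∈ 𝔸.parabolic J, Function.Semiconj (𝔸.VJ J).mkQ u g := by
  induction hg using Subgroup.closure_induction with
  | mem g hg =>
    obtain ⟨n, d, hn, hwall, hg⟩ := hg
    obtain ⟨α, hα, c, k, s, hc, -, hs, rfl, -⟩ := exists_eq_smul_coroot hJ hn hwall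
    refine ⟨_, reflection_mem_parabolic hc hα.2, fun x => ?_⟩
    have hrefl := orthogonalReflection_smul_coroot hJ hc hα hs 0 ((𝔸.VJ J).mkQ x)
    simp only [mul_zero, neg_zero, sub_zero, add_zero] at hrefl
    rw [hg, hrefl, Module.reflection_apply, map_sub, map_smul, rootBar_mkQ]
  | one => exact ⟨1, one_mem _, Function.Semiconj.id_right⟩
  | mul g g' _ _ h h' =>
    obtain ⟨u, hu, hug⟩ := h
    obtain ⟨u', hu', hug'⟩ := h'
    exact ⟨u * u', mul_mem hu hu', hug.comp_right hug'⟩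
  | inv g _ h =>
    obtain ⟨u, hu, hug⟩ := h
    exact ⟨u⁻¹, inv_mem hu, hug.inverses_right u.apply_symm_apply g.symm_apply_apply⟩

lemma exists_vectorialWeylGroup_semiconj {u : V ≃ₗ[ℝ] V} (hu : u ∈ 𝔸.parabolic J) :
    ∃ g ∈ EuclideanBuilding.vectorialWeylGroup (formBar hJ) (𝔸.wallsJ J),
      Function.Semiconj (𝔸.VJ J).mkQ u g := by
  induction hu using Subgroup.closure_induction with
  | mem u hu =>
    obtain ⟨j, hj, rfl⟩ := hu
    have hα := root_mem_rootsJ (R := 𝔸.toRootBasis) hj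
    have hc : 𝔸.IsRootPair (𝔸.root j) (𝔸.coroot j) := ⟨1, one_mem _, j, rfl, rfl⟩
    obtain ⟨k, hk⟩ := exists_mem_wallsJ hα
    have htwo : rootBar hα ((𝔸.VJ J).mkQ (𝔸.coroot j)) = 2 := 𝔸.root_coroot j
    refine ⟨Module.reflection htwo, Subgroup.subset_closure ⟨(𝔸.VJ J).mkQ (𝔸.coroot j), _,
      mkQ_coroot_ne_zero hc hα.2, (setOf_formBar_coroot_eq hJ hc hα k).symm ▸ hk, fun v => ?_⟩,
      fun x => ?_⟩
    · simpa [Module.reflection_apply] using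
        (orthogonalReflection_smul_coroot hJ hc hα one_ne_zero 0 v).symm
    · rw [Module.reflection_apply, rootBar_mkQ, refl_apply, map_sub, map_smul]
  | one => exact ⟨1, one_mem _, Function.Semiconj.id_right⟩
  | mul u u' _ _ h h' =>
    obtain ⟨g, hg, hug⟩ := h
    obtain ⟨g', hg', hug'⟩ := h'
    exact ⟨g * g', mul_mem hg hg', hug.comp_right hug'⟩
  | inv u _ h =>
    obtain ⟨g, hg, hug⟩ := h
    exact ⟨g⁻¹, inv_mem hg, hug.inverses_right u.apply_symm_apply g.symm_apply_apply⟩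

lemma linear_mem_vectorialWeylGroup {g : (V ⧸ 𝔸.VJ J) ≃ᵃ[ℝ] (V ⧸ 𝔸.VJ J)} (hg : g ∈ 𝔸.WJ J) :
    g.linear ∈ EuclideanBuilding.vectorialWeylGroup (formBar hJ) (𝔸.wallsJ J) := by
  obtain ⟨w, -, hlin, hgw⟩ := hg
  obtain ⟨L, hL, hwL⟩ := exists_vectorialWeylGroup_semiconj hJ hlin
  convert hL
  ext v
  obtain ⟨x, rfl⟩ := (𝔸.VJ J).mkQ_surjective v
  rw [linear_apply_mkQ hgw, hwL]

lemma finite_vectorialWeylGroup :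
    (EuclideanBuilding.vectorialWeylGroup (formBar hJ) (𝔸.wallsJ J) :
      Set ((V ⧸ 𝔸.VJ J) ≃ₗ[ℝ] (V ⧸ 𝔸.VJ J))).Finite := by
  choose! lift hlift hsemi using fun g => exists_parabolic_semiconj hJ (g := g)
  refine Set.Finite.of_finite_image (f := lift)
    (hJ.subset (Set.image_subset_iff.2 fun g hg => hlift g hg)) fun g hg g' hg' heq => ?_
  ext v
  obtain ⟨x, rfl⟩ := (𝔸.VJ J).mkQ_surjective v
  rw [← hsemi g hg, ← hsemi g' hg', heq]

lemma isEuclideanApartment :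
    EuclideanBuilding.IsEuclideanApartment (formBar hJ) (𝔸.wallsJ J) where
  finiteDimensional := inferInstance
  symm := formBar_comm hJ
  pos := formBar_pos hJ
  hyperplane := by
    rintro M ⟨α, ⟨c, hc⟩, hspan, k, -, rfl⟩
    have hα : α ∈ 𝔸.rootsJ J := ⟨⟨c, hc⟩, hspan⟩
    exact ⟨_, _, mkQ_coroot_ne_zero hc hspan,
      (image_mkQ_wallOf hα k).trans (setOf_formBar_coroot_eq hJ hc hα k).symm⟩
  stable := fun _ hw _ hM => image_mem_wallsJ (weylGroup_le_WJ hJ hw) hM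
  finite := finite_vectorialWeylGroup hJ

end Reflections

end ModelApartment

/-! ## Closed facets of `𝔸_J` and chimneys -/

lemma iff_of_forall_eventually_iff {E : Type*} [AddCommGroup E] [Module ℝ E] {P : E → Prop}
    (h : ∀ x u, ∀ᶠ t : ℝ in 𝓝[>] 0, P (x + t • u) ↔ P x) (x y : E) : P x ↔ P y := by
  have hloc : IsLocallyConstant fun t : ℝ => P (x + t • (y - x)) := by
    refine (IsLocallyConstant.iff_eventually_eq _).2 fun t₀ => ?_
    have hadd (s r : ℝ) : x + s • (y - x) + r • (y - x) = x + (s + r) • (y - x) := by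
      rw [add_assoc, ← add_smul]
    obtain ⟨δ, hδ, hIoo⟩ := mem_nhdsGT_iff_exists_Ioo_subset.1
      ((h (x + t₀ • (y - x)) (y - x)).and (h (x + t₀ • (y - x)) (-(y - x))))
    rw [Set.mem_Ioi] at hδ
    filter_upwards [Ioo_mem_nhds (sub_lt_self t₀ hδ) (lt_add_of_pos_right t₀ hδ)] with t ht
    rcases lt_trichotomy t t₀ with hlt | rfl | hlt
    · have := (hIoo ⟨sub_pos.2 hlt, by linarith [ht.1]⟩).2
      rw [smul_neg, ← neg_smul, hadd, neg_sub, add_sub_cancel] at this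
      exact propext this
    · rfl
    · have := (hIoo ⟨sub_pos.2 hlt, by linarith [ht.2]⟩).1
      rw [hadd, add_sub_cancel] at this
      exact propext this
  have heq := hloc.apply_eq_of_preconnectedSpace 0 1
  simpa only [zero_smul, add_zero, one_smul, add_sub_cancel] using iff_of_eq heq

namespace ModelApartment

open RootBasis

variable {V : Type*} [NormedAddCommGroup V] [NormedSpace ℝ V] {I : Type*} [Fintype I]
  {𝔸 : ModelApartment V I} {X : Type*} {ε : ℤˣ} {J : Set I} {S F : Set V} {x y u : V}

lemma eventuallyEq_cl_iff {f g : V → X} {G : Filter V} :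
    f =ᶠ[𝔸.cl G] g ↔ ∃ S, 𝔸.IsEnclosed S ∧ S ∈ G ∧ Set.EqOn f g S :=
  mem_cl

lemma IsEnclosed.add_facetOf_subset_of_ray {w : V ≃ₗ[ℝ] V} (hS : 𝔸.IsEnclosed S)
    (hw : w ∈ 𝔸.weyl) (hu : u ∈ 𝔸.facetOf ε w J) (h : ∀ t : ℝ, 0 ≤ t → x + t • u ∈ S) :
    {x} + 𝔸.facetOf ε w J ⊆ S := by
  obtain ⟨D, hD, rfl⟩ := hS
  simp only [Set.mem_iInter, Set.subset_iInter_iff, Set.singleton_add] at h ⊢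
  rintro α hα _ ⟨v, hv, rfl⟩
  rcases hD α hα with hDα | ⟨k, -, hDα⟩
  · exact hDα ▸ Set.mem_univ _
  have hray (t : ℝ) (ht : 0 < t) : 0 ≤ α x + k + t * α u := by
    have hmem : x + t • u ∈ halfOf α k := hDα ▸ h t ht.le α hα
    change 0 ≤ α (x + t • u) + k at hmem
    rwa [map_add, map_smul, smul_eq_mul, add_right_comm] at hmem
  obtain ⟨hx, hαu⟩ := nonneg_of_forall_pos_add_mul_nonneg hray
  have hαv := apply_nonneg_of_mem_facetOf hα hw hu hv hαu
  rw [hDα]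
  change 0 ≤ α (x + v) + k
  rw [map_add]
  linarith

variable [FiniteDimensional ℝ V]

lemma map_comp_sectorFaceGerm (f : V → X) (w : V ≃ᵃ[ℝ] V) (x : V) (Fv : Set V) :
    map (f ∘ w) (sectorFaceGerm x Fv) = map f (sectorFaceGerm (w x) (w.linear '' Fv)) := by
  rw [← map_map, map_sectorFaceGerm]

lemma IsHalfFamily.mem_localFacet {D : Module.Dual ℝ V → Set V} (hD : 𝔸.IsHalfFamily D)
    {α : Module.Dual ℝ V} (hα : α ∈ 𝔸.roots) (hF : 𝔸.IsVectorialFacet F) (hu : u ∈ F)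
    (hx : x ∈ D α) (hxu : x + u ∈ D α) : D α ∈ localFacet x F := by
  rcases hD α hα with hDα | ⟨k, -, hDα⟩ <;> rw [hDα] at hx hxu ⊢
  · exact univ_mem
  · have hx' : 0 ≤ α x + k := hx
    have hxu' : 0 ≤ α (x + u) + k := hxu
    rw [map_add] at hxu'
    rw [halfOf_mem_localFacet_iff hF hu hα]
    exact hx'.lt_or_eq.imp_right fun h => ⟨h.symm, by linarith⟩

lemma IsHalfFamily.eventually_forall_mem {D : Module.Dual ℝ V → Set V} (hD : 𝔸.IsHalfFamily D)
    (hJ : 𝔸.IsSpherical J) {η : V} (h : {y} + 𝔸.facetOf ε 1 J ⊆ ⋂ α ∈ 𝔸.roots, D α)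
    (hη : η ∈ 𝔸.facetOf ε 1 J) :
    ∀ᶠ z in 𝓝 (y + η), ∀ α ∈ 𝔸.roots, α ∉ 𝔸.rootsJ J → z ∈ D α := by
  have hlim : Tendsto (· - y) (𝓝 (y + η)) (𝓝 η) := by
    simpa using (continuous_sub_right y).tendsto (y + η)
  filter_upwards [hlim.eventually (eventually_forall_roots_nonneg hJ hη)] with z hz α hα hαJ
  rcases hD α hα with hDα | ⟨k, -, hDα⟩ <;> rw [hDα]
  · exact Set.mem_univ _
  obtain ⟨hy, hC⟩ :=
    nonneg_of_add_facetOf_subset_halfOf (hDα ▸ h.trans (Set.biInter_subset_of_mem hα))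
  have hpos := (hC η hη).lt_of_ne fun h0 => hαJ (mem_rootsJ_of_apply_eq_zero hJ hη hα h0.symm)
  have hzy := hz α hα hpos
  rw [map_sub] at hzy
  change 0 ≤ α z + k
  linarith

lemma IsEnclosed.exists_mem_chimneyGerm_of_segment (hS : 𝔸.IsEnclosed S) (hJ : 𝔸.IsSpherical J)
    (hF : 𝔸.IsVectorialFacet F) (hu : u ∈ F) (hx : S ∈ sectorFaceGerm x (𝔸.facetOf ε 1 J))
    (hxu : S ∈ sectorFaceGerm (x + u) (𝔸.facetOf ε 1 J)) :
    ∃ n ∈ 𝔸.VJ J, S ∈ 𝔸.chimneyGerm (x + n) F (𝔸.facetOf ε 1 J) := by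
  obtain ⟨ξ, hξ, hsub⟩ := mem_sectorFaceGerm.1 hx
  obtain ⟨η, hη⟩ := 𝔸.facetOf_nonempty ε 1 J
  have hn : ξ + η ∈ 𝔸.VJ J :=
    (𝔸.VJ J).add_mem (closure_facetOf_one_subset_VJ hξ) (facetOf_one_subset_VJ hη)
  refine ⟨ξ + η, hn, hS.mem_chimneyGerm ?_ ?_⟩
  · obtain ⟨D, hD, rfl⟩ := hS
    replace hsub : {x + ξ} + 𝔸.facetOf ε 1 J ⊆ ⋂ α ∈ 𝔸.roots, D α := by
      rw [Set.singleton_add]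
      exact Set.image_subset_iff.2 hsub
    have hmem : ∀ α ∈ 𝔸.rootsJ J, D α ∈ localFacet (x + (ξ + η)) F := fun α hα => by
      have hxD := (hD.mem_sectorFaceGerm_iff hJ hsub).1 hx α hα
      have hxuD := (hD.mem_sectorFaceGerm_iff hJ hsub).1 hxu α hα
      rw [← hD.add_mem_iff hα hn] at hxD hxuD
      exact hD.mem_localFacet (rootsJ_subset_roots J hα) hF hu hxD (add_right_comm x u _ ▸ hxuD)
    have hnear := hD.eventually_forall_mem hJ hsub hη
    rw [add_assoc] at hnear
    filter_upwards [(biInter_mem (finite_rootsJ hJ)).2 hmem, mem_inf_of_left hnear] with z hz hz'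
    exact Set.mem_iInter₂.2 fun α hα => by_cases (Set.mem_iInter₂.1 hz α) (hz' α hα)
  · rw [Set.singleton_add]
    rintro _ ⟨v, hv, rfl⟩
    simpa only [add_assoc] using hsub (η + v) (add_mem_facetOf hη hv)

lemma eventually_mem_sectorFaceGerm_of_mem_chimneyGerm (hJ : 𝔸.IsSpherical J) {n : V}
    (hF : 𝔸.IsVectorialFacet F) (hn : n ∈ 𝔸.VJ J) (hu : u + n ∈ F)
    (hS : S ∈ 𝔸.chimneyGerm x F (𝔸.facetOf ε 1 J)) :
    ∀ᶠ t : ℝ in 𝓝[>] 0, S ∈ sectorFaceGerm (x + t • u) (𝔸.facetOf ε 1 J) := by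
  obtain ⟨D, hD, hDS, ⟨y, hy⟩, hloc⟩ := exists_isHalfFamily_of_mem_chimneyGerm hF hS
  have hmem := (biInter_mem (finite_rootsJ hJ)).2 hloc
  filter_upwards [(tendsto_localFacet hF x hu).eventually hmem] with t ht
  refine mem_of_superset ((hD.mem_sectorFaceGerm_iff hJ hy).2 fun α hα => ?_) hDS
  have := Set.mem_iInter₂.1 ht α hα
  rwa [smul_add, ← add_assoc, hD.add_mem_iff hα (Submodule.smul_mem _ t hn)] at this

end ModelApartment

/-! ## Sector faces and chimneys in a masure -/

namespace Masure

open ModelApartment RootBasis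

variable {V : Type*} [NormedAddCommGroup V] [NormedSpace ℝ V] {I : Type*} [Fintype I]
  {𝔸 : ModelApartment V I} {X : Type*} {ℐ : Masure 𝔸 X} {A A' : Set X} {f f' : V → X}

lemma isom_injective (hA : A ∈ ℐ.apts) (hf : f ∈ ℐ.isom A) : Function.Injective f :=
  ((ℐ.MA1 A hA).2 f hf).1

lemma range_isom (hA : A ∈ ℐ.apts) (hf : f ∈ ℐ.isom A) : Set.range f = A :=
  ((ℐ.MA1 A hA).2 f hf).2.1

lemma comp_mem_isom (hA : A ∈ ℐ.apts) (hf : f ∈ ℐ.isom A) {w : V ≃ᵃ[ℝ] V} (hw : w ∈ 𝔸.W) :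
    f ∘ w ∈ ℐ.isom A :=
  (((ℐ.MA1 A hA).2 f hf).2.2 _).2 ⟨w, hw, rfl⟩

lemma exists_isom_eq_comp (hA : A ∈ ℐ.apts) (hf : f ∈ ℐ.isom A) (hf' : f' ∈ ℐ.isom A) :
    ∃ w ∈ 𝔸.W, f' = f ∘ w :=
  (((ℐ.MA1 A hA).2 f hf).2.2 _).1 hf'

lemma apt_mem_map (hA : A ∈ ℐ.apts) (hf : f ∈ ℐ.isom A) (F : Filter V) : A ∈ map f F := by
  rw [mem_map, ← range_isom hA hf, Set.preimage_range]
  exact univ_mem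

lemma apt_mem_map_of_eqOn (hA' : A' ∈ ℐ.apts) (hf' : f' ∈ ℐ.isom A') {S : Set V} {F : Filter V}
    (h : Set.EqOn f f' S) (hS : S ∈ F) : A' ∈ map f F := by
  rw [map_congr (mem_of_superset hS h)]
  exact apt_mem_map hA' hf' F

variable (ℐ) in
/-- Parallelism of germs of sector faces, tested on translates of the fixed vectorial facet
`ε F^v(J)` of the model: `F` and `G` are the images of two of them under one isomorphism. -/
def ParallelOfType (ε : ℤˣ) (J : Set I) (F G : Filter X) : Prop :=
  ∃ A ∈ ℐ.apts, ∃ f ∈ ℐ.isom A, ∃ x y, F = map f (sectorFaceGerm x (𝔸.facetOf ε 1 J)) ∧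
    G = map f (sectorFaceGerm y (𝔸.facetOf ε 1 J))

variable {ε : ℤˣ} {J : Set I} {x y z : V} {F F' : Set V}

lemma ParallelOfType.symm {F G : Filter X} (h : ℐ.ParallelOfType ε J F G) :
    ℐ.ParallelOfType ε J G F := by
  obtain ⟨A, hA, f, hf, x, y, hF, hG⟩ := h
  exact ⟨A, hA, f, hf, y, x, hG, hF⟩

lemma isSplayedChimneyGerm_chimneyGerm (hJ : 𝔸.IsSpherical J) (x : V)
    (hF : 𝔸.IsVectorialFacet F) :
    𝔸.IsSplayedChimneyGerm (𝔸.chimneyGerm x F (𝔸.facetOf ε 1 J)) :=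
  ⟨x, F, _, hF, isSphericalFacet_facetOf_one hJ ε, rfl⟩

lemma exists_isom_eqOn_ray (hJ : 𝔸.IsSpherical J) (hA : A ∈ ℐ.apts) (hA' : A' ∈ ℐ.apts)
    (hf : f ∈ ℐ.isom A) {u : V} (hu : u ∈ 𝔸.facetOf ε 1 J)
    (h : ∀ t : ℝ, 0 ≤ t → f (x + t • u) ∈ A') :
    ∃ f' ∈ ℐ.isom A', ∃ S, 𝔸.IsEnclosed S ∧ (∀ t : ℝ, 0 ≤ t → x + t • u ∈ S) ∧
      Set.EqOn f f' S := by
  rcases eq_or_ne u 0 with rfl | hu₀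
  · simp only [smul_zero, add_zero] at h ⊢
    obtain ⟨f', hf', heq⟩ := ℐ.MA2 A hA A' hA' f hf (pure x) (.inl ⟨x, rfl⟩) (h 0 le_rfl)
    obtain ⟨S, hS, hxS, hEq⟩ := eventuallyEq_cl_iff.1 heq
    exact ⟨f', hf', S, hS, fun _ _ => hxS, hEq⟩
  · obtain ⟨f', hf', heq⟩ := ℐ.MA2 A hA A' hA' f hf
      (𝓟 ((fun t : ℝ => x + t • u) '' Set.Ici 0))
      (.inr (.inr (.inl ⟨x, u, hu₀, ⟨_, isSphericalFacet_facetOf_one hJ ε, hu⟩, rfl⟩)))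
      (mem_map.2 (mem_principal.2 (Set.image_subset_iff.2 h)))
    obtain ⟨S, hS, hray, hEq⟩ := eventuallyEq_cl_iff.1 heq
    exact ⟨f', hf', S, hS, Set.image_subset_iff.1 (mem_principal.1 hray), hEq⟩

variable [FiniteDimensional ℝ V]

lemma isFacetOrSolidChimneyGerm_chimneyGerm (hJ : 𝔸.IsSpherical J) (x : V)
    (hF : 𝔸.IsVectorialFacet F) :
    𝔸.IsFacetOrSolidChimneyGerm (𝔸.chimneyGerm x F (𝔸.facetOf ε 1 J)) :=
  .inr ⟨x, F, _, hF, isVectorialFacet_facetOf_one ε J, isSolid_of_isSpherical hJ x hF, rfl⟩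

lemma exists_isom_eqOn_add_facetOf (hJ : 𝔸.IsSpherical J) (hA : A ∈ ℐ.apts) (hA' : A' ∈ ℐ.apts)
    (hf : f ∈ ℐ.isom A) (h : A' ∈ map f (sectorFaceGerm x (𝔸.facetOf ε 1 J))) :
    ∃ n ∈ 𝔸.VJ J, ∃ f' ∈ ℐ.isom A', ∃ S, 𝔸.IsEnclosed S ∧
      {x + n} + 𝔸.facetOf ε 1 J ⊆ S ∧ Set.EqOn f f' S := by
  obtain ⟨ξ, hξ, hsub⟩ := mem_sectorFaceGerm.1 (mem_map.1 h)
  obtain ⟨u, hu⟩ := 𝔸.facetOf_nonempty ε 1 J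
  have hray (t : ℝ) (ht : 0 ≤ t) : f (x + (ξ + u) + t • u) ∈ A' := by
    have := hsub _ (smul_mem_facetOf hu (by linarith : 0 < 1 + t))
    rwa [add_smul, one_smul, ← add_assoc, add_assoc x] at this
  obtain ⟨f', hf', S, hS, hrayS, hEq⟩ := exists_isom_eqOn_ray hJ hA hA' hf hu hray
  exact ⟨ξ + u,
    (𝔸.VJ J).add_mem (closure_facetOf_one_subset_VJ hξ) (facetOf_one_subset_VJ hu), f', hf', S,
    hS, hS.add_facetOf_subset_of_ray (one_mem _) hu hrayS, hEq⟩

lemma apt_mem_map_chimneyGerm (hJ : 𝔸.IsSpherical J) (hA : A ∈ ℐ.apts) (hA' : A' ∈ ℐ.apts)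
    (hf : f ∈ ℐ.isom A) (h : A' ∈ map f (sectorFaceGerm x (𝔸.facetOf ε 1 J))) :
    ∃ n ∈ 𝔸.VJ J,
      A' ∈ map f (𝔸.chimneyGerm (x + n) (𝔸.facetOf ε 1 J) (𝔸.facetOf ε 1 J)) := by
  obtain ⟨n, hn, f', hf', S, hS, hsub, hEq⟩ := exists_isom_eqOn_add_facetOf hJ hA hA' hf h
  exact ⟨n, hn, apt_mem_map_of_eqOn hA' hf' hEq
    (hS.mem_chimneyGerm (mem_inf_of_right (mem_principal.2 hsub)) hsub)⟩

lemma exists_isom_eqOn_of_mem_chimneyGerm (hJ : 𝔸.IsSpherical J) (hA : A ∈ ℐ.apts)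
    (hA' : A' ∈ ℐ.apts) (hf : f ∈ ℐ.isom A) (hF : 𝔸.IsVectorialFacet F)
    (hF' : 𝔸.IsVectorialFacet F') (h : A' ∈ map f (𝔸.chimneyGerm x F (𝔸.facetOf ε 1 J)))
    (h' : A' ∈ map f (𝔸.chimneyGerm y F' (𝔸.facetOf ε 1 J))) :
    ∃ f' ∈ ℐ.isom A', ∃ S, 𝔸.IsEnclosed S ∧ S ∈ 𝔸.chimneyGerm x F (𝔸.facetOf ε 1 J) ∧
      S ∈ 𝔸.chimneyGerm y F' (𝔸.facetOf ε 1 J) ∧ Set.EqOn f f' S := by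
  obtain ⟨f', hf', heq⟩ := ℐ.MA4 A hA A' hA' f hf _ _ (isSplayedChimneyGerm_chimneyGerm hJ x hF)
    (isFacetOrSolidChimneyGerm_chimneyGerm hJ y hF') h h'
  obtain ⟨S, hS, hmem, hEq⟩ := eventuallyEq_cl_iff.1 heq
  exact ⟨f', hf', S, hS, (mem_sup.1 hmem).1, (mem_sup.1 hmem).2, hEq⟩

lemma exists_isom_eqOn_of_mem_sectorFaceGerm (hJ : 𝔸.IsSpherical J) (hA : A ∈ ℐ.apts)
    (hA' : A' ∈ ℐ.apts) (hf : f ∈ ℐ.isom A)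
    (h : A' ∈ map f (sectorFaceGerm x (𝔸.facetOf ε 1 J)))
    (h' : A' ∈ map f (sectorFaceGerm y (𝔸.facetOf ε 1 J))) :
    ∃ f' ∈ ℐ.isom A', ∃ S, 𝔸.IsEnclosed S ∧ S ∈ sectorFaceGerm x (𝔸.facetOf ε 1 J) ∧
      S ∈ sectorFaceGerm y (𝔸.facetOf ε 1 J) ∧ Set.EqOn f f' S := by
  have hfacet := 𝔸.isVectorialFacet_facetOf_one ε J
  obtain ⟨m, hm, hx⟩ := apt_mem_map_chimneyGerm hJ hA hA' hf h
  obtain ⟨n, hn, hy⟩ := apt_mem_map_chimneyGerm hJ hA hA' hf h'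
  obtain ⟨f', hf', S, hS, hSx, hSy, hEq⟩ :=
    exists_isom_eqOn_of_mem_chimneyGerm hJ hA hA' hf hfacet hfacet hx hy
  exact ⟨f', hf', S, hS, sectorFaceGerm_add x hm ▸ sectorFaceGerm_le_chimneyGerm hJ _ hfacet hSx,
    sectorFaceGerm_add y hn ▸ sectorFaceGerm_le_chimneyGerm hJ _ hfacet hSy, hEq⟩

lemma apt_mem_map_chimneyGerm_of_segment (hJ : 𝔸.IsSpherical J) (hA : A ∈ ℐ.apts)
    (hA' : A' ∈ ℐ.apts) (hf : f ∈ ℐ.isom A) {u : V} (hF : 𝔸.IsVectorialFacet F) (hu : u ∈ F)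
    (h : A' ∈ map f (sectorFaceGerm x (𝔸.facetOf ε 1 J)))
    (h' : A' ∈ map f (sectorFaceGerm (x + u) (𝔸.facetOf ε 1 J))) :
    ∃ n ∈ 𝔸.VJ J, A' ∈ map f (𝔸.chimneyGerm (x + n) F (𝔸.facetOf ε 1 J)) := by
  obtain ⟨f', hf', S, hS, hSx, hSxu, hEq⟩ :=
    exists_isom_eqOn_of_mem_sectorFaceGerm hJ hA hA' hf h h'
  obtain ⟨n, hn, hmem⟩ := hS.exists_mem_chimneyGerm_of_segment hJ hF hu hSx hSxu
  exact ⟨n, hn, apt_mem_map_of_eqOn hA' hf' hEq hmem⟩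

lemma ParallelOfType.facetOf_eq {v : V ≃ₗ[ℝ] V} (hJ : 𝔸.IsSpherical J) (hA : A ∈ ℐ.apts)
    (hf : f ∈ ℐ.isom A)
    (h : ℐ.ParallelOfType ε J (map f (sectorFaceGerm x (𝔸.facetOf ε 1 J)))
      (map f (sectorFaceGerm y (𝔸.facetOf ε v J)))) :
    𝔸.facetOf ε v J = 𝔸.facetOf ε 1 J := by
  obtain ⟨B, hB, g, hg, a, b, hxa, hyb⟩ := h
  obtain ⟨f', hf', S, -, hSa, hSb, hEq⟩ := exists_isom_eqOn_of_mem_sectorFaceGerm hJ hB hA hg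
    (hxa ▸ apt_mem_map hA hf _) (hyb ▸ apt_mem_map hA hf _)
  obtain ⟨w, -, rfl⟩ := exists_isom_eq_comp hA hf hf'
  have hinj := map_injective (isom_injective hA hf)
  rw [map_congr (mem_of_superset hSa hEq), map_comp_sectorFaceGerm, image_facetOf] at hxa
  rw [map_congr (mem_of_superset hSb hEq), map_comp_sectorFaceGerm, image_facetOf] at hyb
  rw [facetOf_eq_of_sectorFaceGerm_eq (hinj hyb), facetOf_eq_of_sectorFaceGerm_eq (hinj hxa)]

section Transitivity

variable {A₁ A₂ : Set X} {f₁ f₂ : V → X}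

lemma eventually_parallelOfType_iff (hJ : 𝔸.IsSpherical J) (hA₁ : A₁ ∈ ℐ.apts)
    (hf₁ : f₁ ∈ ℐ.isom A₁) (hA₂ : A₂ ∈ ℐ.apts) (hf₂ : f₂ ∈ ℐ.isom A₂) (x u y : V) :
    ∀ᶠ t : ℝ in 𝓝[>] 0,
      (ℐ.ParallelOfType ε J (map f₁ (sectorFaceGerm (x + t • u) (𝔸.facetOf ε 1 J)))
          (map f₂ (sectorFaceGerm y (𝔸.facetOf ε 1 J))) ↔
        ℐ.ParallelOfType ε J (map f₁ (sectorFaceGerm x (𝔸.facetOf ε 1 J)))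
          (map f₂ (sectorFaceGerm y (𝔸.facetOf ε 1 J)))) := by
  have hfacet := 𝔸.isVectorialFacet_facetOf_one ε J
  obtain ⟨n, hn, F, hF, hu⟩ := exists_add_mem_vectorialFacet hJ u
  obtain ⟨A, hA, hmem₁, hmem₂⟩ := ℐ.MA3 A₁ hA₁ A₂ hA₂ f₁ hf₁ f₂ hf₂ _ _
    (isSplayedChimneyGerm_chimneyGerm hJ x hF)
    (isFacetOrSolidChimneyGerm_chimneyGerm (ε := ε) hJ y hfacet)
  obtain ⟨f, hf, S, -, hS, -, hEq⟩ :=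
    exists_isom_eqOn_of_mem_chimneyGerm hJ hA₁ hA hf₁ hF hF hmem₁ hmem₁
  obtain ⟨f', hf', S', -, hS', -, hEq'⟩ :=
    exists_isom_eqOn_of_mem_chimneyGerm hJ hA₂ hA hf₂ hfacet hfacet hmem₂ hmem₂
  obtain ⟨w, -, rfl⟩ := exists_isom_eq_comp hA hf hf'
  rw [map_congr (mem_of_superset (sectorFaceGerm_le_chimneyGerm hJ y hfacet hS') hEq'),
    map_comp_sectorFaceGerm, image_facetOf]
  have hiff (z : V) (hz : S ∈ sectorFaceGerm z (𝔸.facetOf ε 1 J)) :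
      ℐ.ParallelOfType ε J (map f₁ (sectorFaceGerm z (𝔸.facetOf ε 1 J)))
          (map f (sectorFaceGerm (w y) (𝔸.facetOf ε (w.linear * 1) J))) ↔
        𝔸.facetOf ε (w.linear * 1) J = 𝔸.facetOf ε 1 J := by
    rw [map_congr (mem_of_superset hz hEq)]
    exact ⟨fun h => h.facetOf_eq hJ hA hf, fun h => ⟨A, hA, f, hf, z, w y, rfl, by rw [h]⟩⟩
  filter_upwards [eventually_mem_sectorFaceGerm_of_mem_chimneyGerm hJ hF hn hu hS] with t ht
  rw [hiff _ ht, hiff x (sectorFaceGerm_le_chimneyGerm hJ x hF hS)]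

lemma ParallelOfType.trans (hJ : 𝔸.IsSpherical J) {F G H : Filter X}
    (h : ℐ.ParallelOfType ε J F G) (h' : ℐ.ParallelOfType ε J G H) :
    ℐ.ParallelOfType ε J F H := by
  obtain ⟨A₁, hA₁, f₁, hf₁, x, y, rfl, rfl⟩ := h
  obtain ⟨A₂, hA₂, f₂, hf₂, a, b, -, rfl⟩ := id h'
  exact (iff_of_forall_eventually_iff
    (P := fun z => ℐ.ParallelOfType ε J (map f₁ (sectorFaceGerm z (𝔸.facetOf ε 1 J)))
      (map f₂ (sectorFaceGerm b (𝔸.facetOf ε 1 J))))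
    (fun z u => eventually_parallelOfType_iff hJ hA₁ hf₁ hA₂ hf₂ z u b) x y).2 h'

end Transitivity

lemma exists_facet_eq_linear_image (hJ : 𝔸.IsSpherical J) (hA : A ∈ ℐ.apts) (hA' : A' ∈ ℐ.apts)
    (hf : f ∈ ℐ.isom A) (hf' : f' ∈ ℐ.isom A') (hF : 𝔸.IsVectorialFacet F)
    (h : map f (sectorFaceGerm x (𝔸.facetOf ε 1 J)) = map f' (sectorFaceGerm y F)) :
    ∃ w ∈ 𝔸.W, F = w.linear '' 𝔸.facetOf ε 1 J := by
  have hmem : A' ∈ map f (sectorFaceGerm x (𝔸.facetOf ε 1 J)) := h ▸ apt_mem_map hA' hf' _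
  obtain ⟨f'', hf'', S, -, hS, -, hEq⟩ :=
    exists_isom_eqOn_of_mem_sectorFaceGerm hJ hA hA' hf hmem hmem
  obtain ⟨w, hw, rfl⟩ := exists_isom_eq_comp hA' hf' hf''
  obtain ⟨ε', v, -, J', rfl⟩ := hF
  rw [map_congr (mem_of_superset hS hEq), map_comp_sectorFaceGerm, image_facetOf] at h
  refine ⟨w, hw, ?_⟩
  rw [image_facetOf, facetOf_eq_of_sectorFaceGerm_eq (map_injective (isom_injective hA' hf') h)]

lemma map_comp_sectorFaceGerm_inv (f : V → X) (w : V ≃ᵃ[ℝ] V) (y : V) (Fv : Set V) :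
    map (f ∘ w) (sectorFaceGerm (w⁻¹ y) Fv) = map f (sectorFaceGerm y (w.linear '' Fv)) := by
  rw [map_comp_sectorFaceGerm, AffineEquiv.inv_def, AffineEquiv.apply_symm_apply]

lemma IsSectorFaceGerm.exists_isom {F₀ : Filter X} (h : ℐ.IsSectorFaceGerm ε J F₀) :
    ∃ A ∈ ℐ.apts, ∃ f ∈ ℐ.isom A, ∃ x, F₀ = map f (sectorFaceGerm x (𝔸.facetOf ε 1 J)) := by
  obtain ⟨A, hA, f, hf, x, v, hv, rfl⟩ := h
  obtain ⟨w, hw, rfl⟩ := exists_mem_W_linear_eq hv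
  exact ⟨A, hA, f ∘ w, comp_mem_isom hA hf hw, w⁻¹ x, by
    rw [map_comp_sectorFaceGerm_inv, image_facetOf, mul_one]⟩

lemma parallel_iff_parallelOfType (hJ : 𝔸.IsSpherical J) {F₀ : Filter X}
    (h₀ : ℐ.IsSectorFaceGerm ε J F₀) (F : Filter X) :
    ℐ.Parallel F₀ F ↔ ℐ.ParallelOfType ε J F₀ F := by
  constructor
  · rintro ⟨B, hB, g, hg, x, y, Fv, hFv, hx, hy⟩
    obtain ⟨A, hA, f, hf, z, hz⟩ := h₀.exists_isom
    obtain ⟨w, hw, rfl⟩ := exists_facet_eq_linear_image hJ hA hB hf hg hFv.isVectorialFacet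
      (hz.symm.trans hx)
    exact ⟨B, hB, g ∘ w, comp_mem_isom hB hg hw, w⁻¹ x, w⁻¹ y,
      by rw [map_comp_sectorFaceGerm_inv, hx], by rw [map_comp_sectorFaceGerm_inv, hy]⟩
  · rintro ⟨A, hA, f, hf, x, y, hx, hy⟩
    exact ⟨A, hA, f, hf, x, y, _, isSphericalFacet_facetOf_one hJ ε, hx, hy⟩

end Masure

/-! ## Isomorphisms induced on the façade -/

namespace ModelApartment

open RootBasis

variable {V : Type*} [NormedAddCommGroup V] [NormedSpace ℝ V] {I : Type*} [Fintype I]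
  {𝔸 : ModelApartment V I} {J : Set I}

lemma mkQ_eq_mkQ_iff {x y : V} : (𝔸.VJ J).mkQ x = (𝔸.VJ J).mkQ y ↔ y - x ∈ 𝔸.VJ J := by
  rw [eq_comm]
  exact Submodule.Quotient.eq _

lemma map_VJ_of_mem_parabolic {u : V ≃ₗ[ℝ] V} (hu : u ∈ 𝔸.parabolic J) :
    (𝔸.VJ J).map (u : V →ₗ[ℝ] V) = 𝔸.VJ J := by
  refine SetLike.coe_injective ((Set.image_congr fun v hv => ?_).trans (Set.image_id _))
  exact apply_eq_self_of_mem_parabolic hu hv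

lemma exists_mem_WJ_apply_mkQ {w : V ≃ᵃ[ℝ] V} (hw : w ∈ 𝔸.W) (hl : w.linear ∈ 𝔸.parabolic J) :
    ∃ k ∈ 𝔸.WJ J, ∀ x, k ((𝔸.VJ J).mkQ x) = (𝔸.VJ J).mkQ (w x) := by
  let k : (V ⧸ 𝔸.VJ J) ≃ᵃ[ℝ] (V ⧸ 𝔸.VJ J) :=
    (Submodule.Quotient.equiv _ _ w.linear (map_VJ_of_mem_parabolic hl)).toAffineEquiv.trans
      (AffineEquiv.constVAdd ℝ _ ((𝔸.VJ J).mkQ (w 0)))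
  have hk (x : V) : k ((𝔸.VJ J).mkQ x) = (𝔸.VJ J).mkQ (w x) := by
    rw [affineEquiv_apply_eq w x, map_add]
    rfl
  exact ⟨k, ⟨w, hw, hl, hk⟩, hk⟩

/- Averaging over the finite group `W^v(J)` kills `w u - u` and fixes `V_J` pointwise, so `w u = u`;
the fixator of a point of the open chamber is trivial. -/
lemma eq_one_of_apply_sub_mem_VJ (hJ : 𝔸.IsSpherical J) {w : V ≃ₗ[ℝ] V} (hw : w ∈ 𝔸.parabolic J)
    {u : V} (hu : u ∈ 𝔸.fundFacet ∅) (h : w u - u ∈ 𝔸.VJ J) : w = 1 := by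
  have hzero : ∑ s ∈ hJ.toFinset, s (w u - u) = 0 := by
    simp only [map_sub, Finset.sum_sub_distrib, sub_eq_zero]
    exact sum_parabolic_mul_right hJ hw fun s => s u
  have hconst : ∑ s ∈ hJ.toFinset, s (w u - u) = hJ.toFinset.card • (w u - u) :=
    Finset.sum_eq_card_nsmul fun s hs => apply_eq_self_of_mem_parabolic (hJ.mem_toFinset.1 hs) h
  have hcard : hJ.toFinset.card ≠ 0 :=
    Finset.card_ne_zero_of_mem (hJ.mem_toFinset.2 (one_mem (𝔸.parabolic J)))
  rw [hconst, ← Nat.cast_smul_eq_nsmul ℝ, smul_eq_zero, Nat.cast_eq_zero, or_iff_right hcard,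
    sub_eq_zero] at hzero
  have hu' := fundFacet_subset_closedChamber ∅ hu
  have hmem := (apply_eq_self_and_mem_parabolic_of_mem_closedChamber
    (parabolic_le_weyl J hw) hu' (hzero.symm ▸ hu')).2
  have hempty : {i | 𝔸.root i u = 0} = ∅ :=
    Set.eq_empty_of_forall_notMem fun i => (hu.2 i (Set.notMem_empty i)).ne'
  rwa [hempty, RootBasis.parabolic, Set.image_empty, Subgroup.closure_empty,
    Subgroup.mem_bot] at hmem

lemma mkQ_apply_eq_of_fixes_two (hJ : 𝔸.IsSpherical J) {w : V ≃ᵃ[ℝ] V}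
    (hl : w.linear ∈ 𝔸.parabolic J) {n u : V} (hu : u ∈ 𝔸.fundFacet ∅)
    (hn : (𝔸.VJ J).mkQ (w n) = (𝔸.VJ J).mkQ n)
    (hnu : (𝔸.VJ J).mkQ (w (n + u)) = (𝔸.VJ J).mkQ (n + u)) (z : V) :
    (𝔸.VJ J).mkQ (w z) = (𝔸.VJ J).mkQ z := by
  have hlin : w.linear = 1 := by
    refine eq_one_of_apply_sub_mem_VJ hJ hl hu (mkQ_eq_mkQ_iff.1 ?_)
    rwa [affineEquiv_apply_add, map_add, map_add, hn, add_right_inj, eq_comm] at hnu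
  have hw (v : V) : w v = w 0 + v := by rw [affineEquiv_apply_eq, hlin, LinearEquiv.coe_one, id]
  rw [hw, map_add] at hn ⊢
  rwa [add_eq_right] at hn ⊢

lemma mkQ_mem_of_preimage_mem_sectorFaceGerm [FiniteDimensional ℝ V] {ε : ℤˣ} {z : V}
    {T : Set (V ⧸ 𝔸.VJ J)} (h : (𝔸.VJ J).mkQ ⁻¹' T ∈ sectorFaceGerm z (𝔸.facetOf ε 1 J)) :
    (𝔸.VJ J).mkQ z ∈ T := by
  obtain ⟨ξ, hξ, hsub⟩ := mem_sectorFaceGerm.1 h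
  obtain ⟨η, hη⟩ := 𝔸.facetOf_nonempty ε 1 J
  have hmem := hsub η hη
  rwa [Set.mem_preimage, mkQ_add_of_mem_VJ _ (facetOf_one_subset_VJ hη),
    mkQ_add_of_mem_VJ _ (closure_facetOf_one_subset_VJ hξ)] at hmem

end ModelApartment

namespace Masure

open ModelApartment RootBasis EuclideanBuilding

variable {V : Type*} [NormedAddCommGroup V] [NormedSpace ℝ V] {I : Type*} [Fintype I]
  {𝔸 : ModelApartment V I} {X : Type*} {ℐ : Masure 𝔸 X} {ε : ℤˣ} {J : Set I} {F₀ : Filter X}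
  {A A' : Set X} {f f' : V → X} {g g' : V ⧸ 𝔸.VJ J → ℐ.Facade F₀}

lemma mem_facadeFilter {R : Filter X} {T : Set (ℐ.Facade F₀)} :
    T ∈ ℐ.facadeFilter F₀ R ↔ ∃ S ∈ R, ∀ G : ℐ.Facade F₀, S ∈ G.1 → G ∈ T :=
  mem_lift'_sets (h := fun S => {G : ℐ.Facade F₀ | S ∈ G.1})
    fun _ _ hST _ hG => mem_of_superset hG hST

lemma facadeApt_mem_facadeFilter {R : Filter X} (h : A ∈ R) :
    ℐ.facadeApt F₀ A ∈ ℐ.facadeFilter F₀ R :=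
  mem_lift' h

lemma sUnion_facadeApts (F₀ : Filter X) : ⋃₀ ℐ.facadeApts F₀ = Set.univ := by
  refine Set.eq_univ_of_forall fun G => ?_
  obtain ⟨A, hA, f, hf, -, y, Fv, -, -, hG⟩ := G.2
  have hAG : A ∈ G.1 := hG ▸ apt_mem_map hA hf _
  exact ⟨_, ⟨A, hA, ⟨G, hAG⟩, rfl⟩, hAG⟩

variable (ℐ) in
/-- The map `f` is an isomorphism of `𝔸` onto the apartment `A` which sends the direction
`ε F^v(J)` to that of `F₀`, and `g` is the map that it induces on `𝔸_J`. -/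
structure Induces (ε : ℤˣ) (J : Set I) (F₀ : Filter X) (A : Set X) (f : V → X)
    (g : V ⧸ 𝔸.VJ J → ℐ.Facade F₀) : Prop where
  apt_mem : A ∈ ℐ.apts
  isom_mem : f ∈ ℐ.isom A
  val_apply_mkQ : ∀ x, (g ((𝔸.VJ J).mkQ x)).1 = map f (sectorFaceGerm x (𝔸.facetOf ε 1 J))

lemma mem_facadeIsom_iff {B : Set (ℐ.Facade F₀)} :
    g ∈ ℐ.facadeIsom ε J F₀ B ↔ ∃ A f, ℐ.Induces ε J F₀ A f g ∧ B = ℐ.facadeApt F₀ A := by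
  constructor
  · rintro ⟨A, hA, hB, f, hf, h⟩
    exact ⟨A, f, ⟨hA, hf, h⟩, hB⟩
  · rintro ⟨A, f, h, hB⟩
    exact ⟨A, h.apt_mem, hB, f, h.isom_mem, h.val_apply_mkQ⟩

namespace Induces

lemma mem_facadeIsom (h : ℐ.Induces ε J F₀ A f g) : g ∈ ℐ.facadeIsom ε J F₀ (ℐ.facadeApt F₀ A) :=
  mem_facadeIsom_iff.2 ⟨A, f, h, rfl⟩

lemma apt_mem_val (h : ℐ.Induces ε J F₀ A f g) (v : V ⧸ 𝔸.VJ J) : A ∈ (g v).1 := by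
  obtain ⟨x, rfl⟩ := (𝔸.VJ J).mkQ_surjective v
  rw [h.val_apply_mkQ]
  exact apt_mem_map h.apt_mem h.isom_mem _

lemma apply_mkQ_eq_of_eqOn (h : ℐ.Induces ε J F₀ A f g) (h' : ℐ.Induces ε J F₀ A' f' g')
    {S : Set V} (hEq : Set.EqOn f f' S) {x : V} (hS : S ∈ sectorFaceGerm x (𝔸.facetOf ε 1 J)) :
    g' ((𝔸.VJ J).mkQ x) = g ((𝔸.VJ J).mkQ x) :=
  Subtype.ext (by rw [h.val_apply_mkQ, h'.val_apply_mkQ, map_congr (mem_of_superset hS hEq)])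

lemma image_mem_val_iff (h : ℐ.Induces ε J F₀ A f g) {S : Set V} {x : V} :
    f '' S ∈ (g ((𝔸.VJ J).mkQ x)).1 ↔ S ∈ sectorFaceGerm x (𝔸.facetOf ε 1 J) := by
  rw [h.val_apply_mkQ, mem_map, Set.preimage_image_eq _ (isom_injective h.apt_mem h.isom_mem)]

end Induces

variable [FiniteDimensional ℝ V]

lemma Induces.injective (h : ℐ.Induces ε J F₀ A f g) : Function.Injective g := by
  intro v v' heq
  obtain ⟨x, rfl⟩ := (𝔸.VJ J).mkQ_surjective v
  obtain ⟨y, rfl⟩ := (𝔸.VJ J).mkQ_surjective v'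
  have heq := congrArg Subtype.val heq
  rw [h.val_apply_mkQ, h.val_apply_mkQ] at heq
  exact mkQ_eq_mkQ_iff.2
    (sub_mem_VJ_of_sectorFaceGerm_eq (map_injective (isom_injective h.apt_mem h.isom_mem) heq))

lemma exists_induces (hJ : 𝔸.IsSpherical J) (h₀ : ℐ.IsSectorFaceGerm ε J F₀) (hA : A ∈ ℐ.apts)
    (hf : f ∈ ℐ.isom A) {z : V}
    (hz : ℐ.ParallelOfType ε J F₀ (map f (sectorFaceGerm z (𝔸.facetOf ε 1 J)))) :
    ∃ g, ℐ.Induces ε J F₀ A f g := by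
  have hparallel (x : V) : ℐ.Parallel F₀ (map f (sectorFaceGerm x (𝔸.facetOf ε 1 J))) :=
    (parallel_iff_parallelOfType hJ h₀ _).2 (hz.trans hJ ⟨A, hA, f, hf, z, x, rfl, rfl⟩)
  let rep := Function.surjInv (𝔸.VJ J).mkQ_surjective
  have hrep (x : V) : x - rep ((𝔸.VJ J).mkQ x) ∈ 𝔸.VJ J :=
    mkQ_eq_mkQ_iff.1 (Function.surjInv_eq (𝔸.VJ J).mkQ_surjective _)
  refine ⟨fun v => ⟨_, hparallel (rep v)⟩, hA, hf, fun x => ?_⟩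
  change map f (sectorFaceGerm (rep _) _) = _
  rw [← sectorFaceGerm_add _ (hrep x), add_sub_cancel]

lemma exists_induces_apply_eq (hJ : 𝔸.IsSpherical J) (h₀ : ℐ.IsSectorFaceGerm ε J F₀)
    (hA : A ∈ ℐ.apts) {G : ℐ.Facade F₀} (hG : G ∈ ℐ.facadeApt F₀ A) :
    ∃ f g, ℐ.Induces ε J F₀ A f g ∧ ∃ v, g v = G := by
  have hpar := (parallel_iff_parallelOfType hJ h₀ _).1 G.2
  obtain ⟨B, hB, k, hk, -, y, -, hGk⟩ := id hpar
  have hAk : A ∈ map k (sectorFaceGerm y (𝔸.facetOf ε 1 J)) := hGk ▸ hG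
  obtain ⟨f, hf, S, -, hS, -, hEq⟩ := exists_isom_eqOn_of_mem_sectorFaceGerm hJ hB hA hk hAk hAk
  rw [map_congr (mem_of_superset hS hEq)] at hGk
  obtain ⟨g, hg⟩ := exists_induces hJ h₀ hA hf (hGk ▸ hpar)
  exact ⟨f, g, hg, (𝔸.VJ J).mkQ y, Subtype.ext (by rw [hg.val_apply_mkQ, hGk])⟩

lemma exists_induces_of_mem_facadeApts (hJ : 𝔸.IsSpherical J) (h₀ : ℐ.IsSectorFaceGerm ε J F₀)
    {B : Set (ℐ.Facade F₀)} (hB : B ∈ ℐ.facadeApts F₀) :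
    ∃ A f g, ℐ.Induces (g := g) ε J F₀ A f ∧ B = ℐ.facadeApt F₀ A := by
  obtain ⟨A, hA, ⟨G, hG⟩, rfl⟩ := hB
  obtain ⟨f, g, h, -⟩ := exists_induces_apply_eq hJ h₀ hA hG
  exact ⟨A, f, g, h, rfl⟩

namespace Induces

lemma apply_comp_mkQ (h : ℐ.Induces ε J F₀ A f g) {w : V ≃ᵃ[ℝ] V}
    (hl : w.linear ∈ 𝔸.parabolic J) (x : V) :
    (g ((𝔸.VJ J).mkQ (w x))).1 = map (f ∘ w) (sectorFaceGerm x (𝔸.facetOf ε 1 J)) := by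
  rw [h.val_apply_mkQ, map_comp_sectorFaceGerm, image_facetOf_one_of_mem_parabolic hl]

lemma exists_comp (h : ℐ.Induces ε J F₀ A f g) {k : (V ⧸ 𝔸.VJ J) ≃ᵃ[ℝ] (V ⧸ 𝔸.VJ J)}
    (hk : k ∈ 𝔸.WJ J) : ∃ f', ℐ.Induces ε J F₀ A f' (g ∘ k) := by
  obtain ⟨w, hw, hl, hkw⟩ := hk
  refine ⟨f ∘ w, h.apt_mem, comp_mem_isom h.apt_mem h.isom_mem hw, fun x => ?_⟩
  rw [Function.comp_apply, hkw, h.apply_comp_mkQ hl]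

lemma parallelOfType (hJ : 𝔸.IsSpherical J) (h₀ : ℐ.IsSectorFaceGerm ε J F₀)
    (h : ℐ.Induces ε J F₀ A f g) (x : V) :
    ℐ.ParallelOfType ε J F₀ (map f (sectorFaceGerm x (𝔸.facetOf ε 1 J))) := by
  rw [← h.val_apply_mkQ, ← parallel_iff_parallelOfType hJ h₀]
  exact (g _).2

lemma exists_of_eqOn (hJ : 𝔸.IsSpherical J) (h₀ : ℐ.IsSectorFaceGerm ε J F₀)
    (h : ℐ.Induces ε J F₀ A f g) (hA' : A' ∈ ℐ.apts) (hf' : f' ∈ ℐ.isom A') {S : Set V}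
    (hEq : Set.EqOn f f' S) {x : V} (hS : S ∈ sectorFaceGerm x (𝔸.facetOf ε 1 J)) :
    ∃ g', ℐ.Induces ε J F₀ A' f' g' := by
  have hpar := h.parallelOfType hJ h₀ x
  rw [map_congr (mem_of_superset hS hEq)] at hpar
  exact exists_induces hJ h₀ hA' hf' hpar

lemma exists_eq_comp (hJ : 𝔸.IsSpherical J) (h₀ : ℐ.IsSectorFaceGerm ε J F₀)
    (h : ℐ.Induces ε J F₀ A f g) (h' : ℐ.Induces ε J F₀ A f' g') :
    ∃ w ∈ 𝔸.W, w.linear ∈ 𝔸.parabolic J ∧ f' = f ∘ w ∧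
      ∀ x, g' ((𝔸.VJ J).mkQ x) = g ((𝔸.VJ J).mkQ (w x)) := by
  obtain ⟨w, hw, rfl⟩ := exists_isom_eq_comp h.apt_mem h.isom_mem h'.isom_mem
  have hpar := (h.parallelOfType hJ h₀ 0).symm.trans hJ (h'.parallelOfType hJ h₀ 0)
  rw [map_comp_sectorFaceGerm, image_facetOf] at hpar
  have himage := hpar.facetOf_eq hJ h.apt_mem h.isom_mem
  rw [← image_facetOf] at himage
  have hl := mem_parabolic_of_image_facetOf_one (linear_mem_weyl hw) himage
  exact ⟨w, hw, hl, rfl, fun x => Subtype.ext (by rw [h'.val_apply_mkQ, h.apply_comp_mkQ hl])⟩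

lemma range_eq (hJ : 𝔸.IsSpherical J) (h₀ : ℐ.IsSectorFaceGerm ε J F₀)
    (h : ℐ.Induces ε J F₀ A f g) : Set.range g = ℐ.facadeApt F₀ A := by
  refine (Set.range_subset_iff.2 h.apt_mem_val).antisymm fun G hG => ?_
  obtain ⟨f', g', h', v, rfl⟩ := exists_induces_apply_eq hJ h₀ h.apt_mem hG
  obtain ⟨x, rfl⟩ := (𝔸.VJ J).mkQ_surjective v
  obtain ⟨w, -, -, -, hw⟩ := h.exists_eq_comp hJ h₀ h'
  exact ⟨_, (hw x).symm⟩

lemma mem_image_of_image_preimage_mkQ_mem (hJ : 𝔸.IsSpherical J) (h₀ : ℐ.IsSectorFaceGerm ε J F₀)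
    (h : ℐ.Induces ε J F₀ A f g) {T : Set (V ⧸ 𝔸.VJ J)} {G : ℐ.Facade F₀}
    (hG : f '' ((𝔸.VJ J).mkQ ⁻¹' T) ∈ G.1) : G ∈ g '' T := by
  have hAG : G ∈ ℐ.facadeApt F₀ A :=
    mem_of_superset hG ((Set.image_subset_range _ _).trans (range_isom h.apt_mem h.isom_mem).le)
  rw [← h.range_eq hJ h₀] at hAG
  obtain ⟨v, rfl⟩ := hAG
  obtain ⟨z, rfl⟩ := (𝔸.VJ J).mkQ_surjective v
  exact ⟨_, mkQ_mem_of_preimage_mem_sectorFaceGerm (h.image_mem_val_iff.1 hG), rfl⟩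

lemma facadeFilter_map_chimneyGerm (hJ : 𝔸.IsSpherical J) (h₀ : ℐ.IsSectorFaceGerm ε J F₀)
    (h : ℐ.Induces ε J F₀ A f g) (x : V) {F : Set V} (hF : 𝔸.IsVectorialFacet F) {u : V}
    (hu : u ∈ F) :
    ℐ.facadeFilter F₀ (map f (𝔸.chimneyGerm x F (𝔸.facetOf ε 1 J))) =
      map g (closedFacet (𝔸.wallsJ J) ((𝔸.VJ J).mkQ x) ((𝔸.VJ J).mkQ u)) := by
  ext T
  rw [mem_facadeFilter, mem_map]
  constructor
  · rintro ⟨S, hS, hsub⟩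
    obtain ⟨D, hD, hDS, ⟨y, hy⟩, hloc⟩ := exists_isHalfFamily_of_mem_chimneyGerm hF hS
    refine hD.mem_closedFacet hJ hF hu hloc fun z hz => hsub _ ?_
    rw [h.val_apply_mkQ, mem_map]
    exact mem_of_superset ((hD.mem_sectorFaceGerm_iff hJ hy).2 hz) hDS
  · intro hT
    obtain ⟨T', hsub, hT', hloc⟩ := exists_isEnclosed_preimage_of_mem_closedFacet hF hu hT
    refine ⟨_, image_mem_map (preimage_mkQ_mem_chimneyGerm ε hF hT' hloc), fun G hG => ?_⟩
    obtain ⟨v, hv, rfl⟩ := h.mem_image_of_image_preimage_mkQ_mem hJ h₀ hG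
    exact hsub hv

lemma exists_mem_map_chimneyGerm (hJ : 𝔸.IsSpherical J) (h : ℐ.Induces ε J F₀ A f g)
    (hA' : A' ∈ ℐ.apts) {v v' : V ⧸ 𝔸.VJ J}
    (hm : ℐ.facadeApt F₀ A' ∈ map g (closedFacet (𝔸.wallsJ J) v v')) :
    ∃ x u F, (𝔸.VJ J).mkQ x = v ∧ (𝔸.VJ J).mkQ u = v' ∧ 𝔸.IsVectorialFacet F ∧ u ∈ F ∧
      A' ∈ map f (𝔸.chimneyGerm x F (𝔸.facetOf ε 1 J)) := by
  obtain ⟨x, rfl⟩ := (𝔸.VJ J).mkQ_surjective v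
  obtain ⟨u, rfl⟩ := (𝔸.VJ J).mkQ_surjective v'
  obtain ⟨n, hn, F, hF, hu⟩ := exists_add_mem_vectorialFacet hJ u
  rw [mem_map, ← mkQ_add_of_mem_VJ u hn] at hm
  obtain ⟨T, hsub, hT, hloc⟩ := exists_isEnclosed_preimage_of_mem_closedFacet hF hu hm
  have hgerm {z : V} (hz : (𝔸.VJ J).mkQ z ∈ T) :
      A' ∈ map f (sectorFaceGerm z (𝔸.facetOf ε 1 J)) := h.val_apply_mkQ z ▸ hsub hz
  have hx : (𝔸.VJ J).mkQ x ∈ T :=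
    hT.isClosed.closure_subset (mem_closure_of_mem_localFacet hF hloc)
  obtain ⟨t, ht, ht0⟩ := (((tendsto_localFacet hF x hu).eventually hloc).and
    self_mem_nhdsWithin).exists
  obtain ⟨m, hm', hc⟩ := apt_mem_map_chimneyGerm_of_segment hJ h.apt_mem hA' h.isom_mem hF
    (hF.smul_mem hu ht0) (hgerm hx) (hgerm ht)
  exact ⟨x + m, u + n, F, mkQ_add_of_mem_VJ x hm', mkQ_add_of_mem_VJ u hn, hF, hu, hc⟩

lemma exists_apply_mkQ_eq (hJ : 𝔸.IsSpherical J) (h₀ : ℐ.IsSectorFaceGerm ε J F₀)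
    (h : ℐ.Induces ε J F₀ A f g) (hA' : A' ∈ ℐ.apts) {F : Set V} (hF : 𝔸.IsVectorialFacet F)
    {n u z : V} (hu : u ∈ F) (hc : A' ∈ map f (𝔸.chimneyGerm n F (𝔸.facetOf ε 1 J)))
    (hz : g ((𝔸.VJ J).mkQ z) ∈ ℐ.facadeApt F₀ A') :
    ∃ f' g', ℐ.Induces ε J F₀ A' f' g' ∧
      g' ((𝔸.VJ J).mkQ z) = g ((𝔸.VJ J).mkQ z) ∧ g' ((𝔸.VJ J).mkQ n) = g ((𝔸.VJ J).mkQ n) ∧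
      ∀ᶠ t : ℝ in 𝓝[>] 0,
        g' ((𝔸.VJ J).mkQ (n + t • u)) = g ((𝔸.VJ J).mkQ (n + t • u)) := by
  have hdir := isVectorialFacet_facetOf_one (R := 𝔸.toRootBasis) ε J
  have hz' : A' ∈ map f (sectorFaceGerm z (𝔸.facetOf ε 1 J)) := h.val_apply_mkQ z ▸ hz
  obtain ⟨m, hm, hcz⟩ := apt_mem_map_chimneyGerm hJ h.apt_mem hA' h.isom_mem hz'
  obtain ⟨f', hf', S, -, hSn, hSz, hEq⟩ :=
    exists_isom_eqOn_of_mem_chimneyGerm hJ h.apt_mem hA' h.isom_mem hF hdir hc hcz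
  replace hSz := sectorFaceGerm_le_chimneyGerm hJ _ hdir hSz
  rw [sectorFaceGerm_add z hm] at hSz
  obtain ⟨g', h'⟩ := h.exists_of_eqOn hJ h₀ hA' hf' hEq hSz
  refine ⟨f', g', h', h.apply_mkQ_eq_of_eqOn h' hEq hSz,
    h.apply_mkQ_eq_of_eqOn h' hEq (sectorFaceGerm_le_chimneyGerm hJ n hF hSn), ?_⟩
  filter_upwards [eventually_mem_sectorFaceGerm_of_mem_chimneyGerm hJ hF (zero_mem _)
    ((add_zero u).symm ▸ hu) hSn] with t ht
  exact h.apply_mkQ_eq_of_eqOn h' hEq ht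

lemma eq_of_apply_eq (hJ : 𝔸.IsSpherical J) (h₀ : ℐ.IsSectorFaceGerm ε J F₀)
    (h : ℐ.Induces ε J F₀ A f g) (h' : ℐ.Induces ε J F₀ A f' g') {n u : V}
    (hu : u ∈ 𝔸.fundFacet ∅) (hn : g' ((𝔸.VJ J).mkQ n) = g ((𝔸.VJ J).mkQ n))
    (hnu : g' ((𝔸.VJ J).mkQ (n + u)) = g ((𝔸.VJ J).mkQ (n + u))) : g' = g := by
  obtain ⟨w, -, hl, -, hw⟩ := h.exists_eq_comp hJ h₀ h'
  rw [hw] at hn hnu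
  funext v
  obtain ⟨z, rfl⟩ := (𝔸.VJ J).mkQ_surjective v
  rw [hw, mkQ_apply_eq_of_fixes_two hJ hl hu (h.injective hn) (h.injective hnu)]

lemma exists_of_facadeApt_subset (hJ : 𝔸.IsSpherical J) (h₀ : ℐ.IsSectorFaceGerm ε J F₀)
    (h : ℐ.Induces ε J F₀ A f g) (hA' : A' ∈ ℐ.apts)
    (hsub : ℐ.facadeApt F₀ A ⊆ ℐ.facadeApt F₀ A') : ∃ f', ℐ.Induces ε J F₀ A' f' g := by
  have hall (v : V ⧸ 𝔸.VJ J) : g v ∈ ℐ.facadeApt F₀ A' := hsub (h.apt_mem_val v)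
  have hgerm (z : V) : A' ∈ map f (sectorFaceGerm z (𝔸.facetOf ε 1 J)) :=
    h.val_apply_mkQ z ▸ hall _
  obtain ⟨u, hu⟩ := fundFacet_nonempty (R := 𝔸.toRootBasis) ∅
  have hchamber := isVectorialFacet_facetOf_one (R := 𝔸.toRootBasis) 1 ∅
  have hu₁ : u ∈ 𝔸.facetOf 1 1 ∅ := mem_facetOf_one.2 ((one_smul ℤˣ u).symm ▸ hu)
  obtain ⟨n, -, hc⟩ := apt_mem_map_chimneyGerm_of_segment hJ h.apt_mem hA' h.isom_mem hchamber
    hu₁ (hgerm 0) (hgerm (0 + u))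
  obtain ⟨f₁, g₁, h₁, -, hn₁, hu₁'⟩ :=
    h.exists_apply_mkQ_eq (z := 0) hJ h₀ hA' hchamber hu₁ hc (hall _)
  refine ⟨f₁, ?_⟩
  suffices g₁ = g from this ▸ h₁
  funext v
  obtain ⟨z, rfl⟩ := (𝔸.VJ J).mkQ_surjective v
  obtain ⟨f₂, g₂, h₂, hz, hn₂, hu₂⟩ :=
    h.exists_apply_mkQ_eq hJ h₀ hA' hchamber hu₁ hc (hall ((𝔸.VJ J).mkQ z))
  obtain ⟨t, ⟨ht₁, ht₂⟩, ht⟩ := ((hu₁'.and hu₂).and self_mem_nhdsWithin).exists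
  have htu : t • u ∈ 𝔸.fundFacet ∅ := by
    simpa [mem_facetOf_one] using smul_mem_facetOf hu₁ ht
  rw [h₂.eq_of_apply_eq hJ h₀ h₁ htu (hn₁.trans hn₂.symm) (ht₁.trans ht₂.symm), hz]

lemma exists_mem_WJ_eq_comp (hJ : 𝔸.IsSpherical J) (h₀ : ℐ.IsSectorFaceGerm ε J F₀)
    (h : ℐ.Induces ε J F₀ A f g) (h' : ℐ.Induces ε J F₀ A' f' g')
    (hAA' : ℐ.facadeApt F₀ A = ℐ.facadeApt F₀ A') : ∃ k ∈ 𝔸.WJ J, g' = g ∘ k := by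
  obtain ⟨f₁, h₁⟩ := h.exists_of_facadeApt_subset hJ h₀ h'.apt_mem hAA'.le
  obtain ⟨w, hw, hl, -, hg'⟩ := h₁.exists_eq_comp hJ h₀ h'
  obtain ⟨k, hk, hkw⟩ := exists_mem_WJ_apply_mkQ hw hl
  refine ⟨k, hk, funext fun v => ?_⟩
  obtain ⟨x, rfl⟩ := (𝔸.VJ J).mkQ_surjective v
  rw [hg', Function.comp_apply, hkw]

end Induces

lemma mem_facadeFacets_iff (hJ : 𝔸.IsSpherical J) (h₀ : ℐ.IsSectorFaceGerm ε J F₀)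
    {𝓕 : Filter (ℐ.Facade F₀)} : 𝓕 ∈ ℐ.facadeFacets F₀ ↔
      ∃ A f g x F, ℐ.Induces (g := g) ε J F₀ A f ∧ 𝔸.IsVectorialFacet F ∧
        𝓕 = ℐ.facadeFilter F₀ (map f (𝔸.chimneyGerm x F (𝔸.facetOf ε 1 J))) := by
  constructor
  · rintro ⟨R, ⟨A, hA, f, hf, x, F, Fv, hF, hFv, rfl, hpar⟩, rfl⟩
    have hpar := (parallel_iff_parallelOfType hJ h₀ _).1 hpar
    obtain ⟨A₁, hA₁, f₁, hf₁, a, b, -, hb⟩ := id hpar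
    obtain ⟨w, hw, rfl⟩ := exists_facet_eq_linear_image hJ hA₁ hA hf₁ hf
      hFv.isVectorialFacet hb.symm
    rw [← map_comp_sectorFaceGerm_inv] at hpar
    obtain ⟨g, hg⟩ := exists_induces hJ h₀ hA (comp_mem_isom hA hf hw) hpar
    have hF' := hF.image (linear_mem_weyl (inv_mem hw))
    refine ⟨A, f ∘ w, g, w⁻¹ x, _, hg, hF', ?_⟩
    have hFw : w.linear '' ((w⁻¹ : V ≃ᵃ[ℝ] V).linear '' F) = F := by
      simpa using inv_linear_image_linear_image w⁻¹ F
    rw [← map_map, map_chimneyGerm hw, hFw, AffineEquiv.inv_def, AffineEquiv.apply_symm_apply]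
  · rintro ⟨A, f, g, x, F, h, hF, rfl⟩
    exact ⟨_, ⟨A, h.apt_mem, f, h.isom_mem, x, F, _, hF, isSphericalFacet_facetOf_one hJ ε, rfl,
      (parallel_iff_parallelOfType hJ h₀ _).2 (h.parallelOfType hJ h₀ x)⟩, rfl⟩

namespace Induces

lemma exists_map_closedFacet_eq (hJ : 𝔸.IsSpherical J) (h₀ : ℐ.IsSectorFaceGerm ε J F₀)
    (h : ℐ.Induces ε J F₀ A f g) {𝓕 : Filter (ℐ.Facade F₀)} (h𝓕 : 𝓕 ∈ ℐ.facadeFacets F₀)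
    (hm : ℐ.facadeApt F₀ A ∈ 𝓕) :
    ∃ v v', 𝓕 = map g (closedFacet (𝔸.wallsJ J) v v') := by
  obtain ⟨A₁, f₁, g₁, x, F, h₁, hF, rfl⟩ := (mem_facadeFacets_iff hJ h₀).1 h𝓕
  obtain ⟨u, hu⟩ := hF.nonempty
  rw [h₁.facadeFilter_map_chimneyGerm hJ h₀ x hF hu] at hm
  obtain ⟨x', u', F', hx, hu', hF', huF', hc⟩ := h₁.exists_mem_map_chimneyGerm hJ h.apt_mem hm
  rw [h₁.facadeFilter_map_chimneyGerm hJ h₀ x hF hu, ← hx, ← hu',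
    ← h₁.facadeFilter_map_chimneyGerm hJ h₀ x' hF' huF']
  obtain ⟨f₂, hf₂, S, -, hS, -, hEq⟩ :=
    exists_isom_eqOn_of_mem_chimneyGerm hJ h₁.apt_mem h.apt_mem h₁.isom_mem hF' hF' hc hc
  obtain ⟨g₂, h₂⟩ := h₁.exists_of_eqOn hJ h₀ h.apt_mem hf₂ hEq
    (sectorFaceGerm_le_chimneyGerm hJ x' hF' hS)
  obtain ⟨w, hw, hl, rfl, -⟩ := h.exists_eq_comp hJ h₀ h₂
  rw [map_congr (mem_of_superset hS hEq), ← map_map, map_chimneyGerm hw,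
    image_facetOf_one_of_mem_parabolic hl]
  exact ⟨_, _, h.facadeFilter_map_chimneyGerm hJ h₀ (w x') (hF'.image (linear_mem_weyl hw))
    (Set.mem_image_of_mem _ huF')⟩

lemma map_closedFacet_mem_facadeFacets (hJ : 𝔸.IsSpherical J) (h₀ : ℐ.IsSectorFaceGerm ε J F₀)
    (h : ℐ.Induces ε J F₀ A f g) (v v' : V ⧸ 𝔸.VJ J) :
    map g (closedFacet (𝔸.wallsJ J) v v') ∈ ℐ.facadeFacets F₀ := by
  obtain ⟨x, rfl⟩ := (𝔸.VJ J).mkQ_surjective v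
  obtain ⟨u, rfl⟩ := (𝔸.VJ J).mkQ_surjective v'
  obtain ⟨n, hn, F, hF, hu⟩ := exists_add_mem_vectorialFacet hJ u
  refine (mem_facadeFacets_iff hJ h₀).2 ⟨A, f, g, x, F, h, hF, ?_⟩
  rw [h.facadeFilter_map_chimneyGerm hJ h₀ x hF hu, mkQ_add_of_mem_VJ u hn]

lemma exists_facadeFilter_eq (hJ : 𝔸.IsSpherical J) (h₀ : ℐ.IsSectorFaceGerm ε J F₀)
    (h : ℐ.Induces ε J F₀ A f g) (hA' : A' ∈ ℐ.apts) {𝓕 : Filter (ℐ.Facade F₀)}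
    (h𝓕 : 𝓕 ∈ ℐ.facadeFacets F₀) (hm : ℐ.facadeApt F₀ A ∩ ℐ.facadeApt F₀ A' ∈ 𝓕) :
    ∃ x F, 𝔸.IsVectorialFacet F ∧
      𝓕 = ℐ.facadeFilter F₀ (map f (𝔸.chimneyGerm x F (𝔸.facetOf ε 1 J))) ∧
      A' ∈ map f (𝔸.chimneyGerm x F (𝔸.facetOf ε 1 J)) := by
  obtain ⟨v, v', rfl⟩ := h.exists_map_closedFacet_eq hJ h₀ h𝓕
    (mem_of_superset hm Set.inter_subset_left)
  obtain ⟨x, u, F, rfl, rfl, hF, hu, hc⟩ :=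
    h.exists_mem_map_chimneyGerm hJ hA' (mem_of_superset hm Set.inter_subset_right)
  exact ⟨x, F, hF, (h.facadeFilter_map_chimneyGerm hJ h₀ x hF hu).symm, hc⟩

end Induces

lemma mem_facadeIsom_iff_exists_eq_comp (hJ : 𝔸.IsSpherical J) (h₀ : ℐ.IsSectorFaceGerm ε J F₀)
    {B : Set (ℐ.Facade F₀)} (hg : g ∈ ℐ.facadeIsom ε J F₀ B) :
    g' ∈ ℐ.facadeIsom ε J F₀ B ↔ ∃ k ∈ 𝔸.WJ J, g' = g ∘ k := by
  obtain ⟨A, f, h, rfl⟩ := mem_facadeIsom_iff.1 hg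
  constructor
  · intro hg'
    obtain ⟨A', f', h', hAA'⟩ := mem_facadeIsom_iff.1 hg'
    exact h.exists_mem_WJ_eq_comp hJ h₀ h' hAA'
  · rintro ⟨k, hk, rfl⟩
    obtain ⟨f', h'⟩ := h.exists_comp hk
    exact h'.mem_facadeIsom

lemma facadeIsom_nonempty_and_forall (hJ : 𝔸.IsSpherical J) (h₀ : ℐ.IsSectorFaceGerm ε J F₀)
    {B : Set (ℐ.Facade F₀)} (hB : B ∈ ℐ.facadeApts F₀) :
    (ℐ.facadeIsom ε J F₀ B).Nonempty ∧ ∀ g ∈ ℐ.facadeIsom ε J F₀ B, Function.Injective g ∧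
      Set.range g = B ∧ ∀ g', g' ∈ ℐ.facadeIsom ε J F₀ B ↔ ∃ k ∈ 𝔸.WJ J, g' = g ∘ k := by
  obtain ⟨A, f, g, h, rfl⟩ := exists_induces_of_mem_facadeApts hJ h₀ hB
  refine ⟨⟨g, h.mem_facadeIsom⟩, fun g' hg' => ?_⟩
  obtain ⟨A', f', h', hAA'⟩ := mem_facadeIsom_iff.1 hg'
  exact ⟨h'.injective, hAA' ▸ h'.range_eq hJ h₀,
    fun _ => mem_facadeIsom_iff_exists_eq_comp hJ h₀ hg'⟩

lemma mem_facadeFacets_and_mem_iff (hJ : 𝔸.IsSpherical J) (h₀ : ℐ.IsSectorFaceGerm ε J F₀)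
    {B : Set (ℐ.Facade F₀)} (hg : g ∈ ℐ.facadeIsom ε J F₀ B) (𝓕 : Filter (ℐ.Facade F₀)) :
    𝓕 ∈ ℐ.facadeFacets F₀ ∧ B ∈ 𝓕 ↔ ∃ v v', 𝓕 = map g (closedFacet (𝔸.wallsJ J) v v') := by
  obtain ⟨A, f, h, rfl⟩ := mem_facadeIsom_iff.1 hg
  constructor
  · rintro ⟨h𝓕, hm⟩
    exact h.exists_map_closedFacet_eq hJ h₀ h𝓕 hm
  · rintro ⟨v, v', rfl⟩
    exact ⟨h.map_closedFacet_mem_facadeFacets hJ h₀ v v', mem_map.2 (univ_mem' h.apt_mem_val)⟩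

lemma exists_facadeApts_mem_mem (hJ : 𝔸.IsSpherical J) (h₀ : ℐ.IsSectorFaceGerm ε J F₀)
    {𝓕 𝓕' : Filter (ℐ.Facade F₀)} (h𝓕 : 𝓕 ∈ ℐ.facadeFacets F₀) (h𝓕' : 𝓕' ∈ ℐ.facadeFacets F₀) :
    ∃ B ∈ ℐ.facadeApts F₀, B ∈ 𝓕 ∧ B ∈ 𝓕' := by
  obtain ⟨A₁, f₁, g₁, x, F, h₁, hF, rfl⟩ := (mem_facadeFacets_iff hJ h₀).1 h𝓕
  obtain ⟨A₂, f₂, g₂, y, F', h₂, hF', rfl⟩ := (mem_facadeFacets_iff hJ h₀).1 h𝓕'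
  obtain ⟨A, hA, hm, hm'⟩ := ℐ.MA3 A₁ h₁.apt_mem A₂ h₂.apt_mem f₁ h₁.isom_mem f₂ h₂.isom_mem _ _
    (isSplayedChimneyGerm_chimneyGerm hJ x hF) (isFacetOrSolidChimneyGerm_chimneyGerm hJ y hF')
  have hmem : g₁ ((𝔸.VJ J).mkQ x) ∈ ℐ.facadeApt F₀ A := by
    change A ∈ (g₁ _).1
    rw [h₁.val_apply_mkQ]
    exact sectorFaceGerm_le_chimneyGerm hJ x hF hm
  exact ⟨_, ⟨A, hA, ⟨_, hmem⟩, rfl⟩, facadeApt_mem_facadeFilter hm, facadeApt_mem_facadeFilter hm'⟩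

lemma exists_facadeFacets_of_mem_inter (hJ : 𝔸.IsSpherical J) (h₀ : ℐ.IsSectorFaceGerm ε J F₀)
    {B B' : Set (ℐ.Facade F₀)} (hB : B ∈ ℐ.facadeApts F₀) (hB' : B' ∈ ℐ.facadeApts F₀)
    {G : ℐ.Facade F₀} (hG : G ∈ B ∩ B') :
    ∃ 𝓕 ∈ ℐ.facadeFacets F₀, pure G ≤ 𝓕 ∧ B ∩ B' ∈ 𝓕 := by
  obtain ⟨A, f, g, h, rfl⟩ := exists_induces_of_mem_facadeApts hJ h₀ hB
  obtain ⟨A', hA', -, rfl⟩ := hB'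
  obtain ⟨v, rfl⟩ := (h.range_eq hJ h₀).ge hG.1
  obtain ⟨z, rfl⟩ := (𝔸.VJ J).mkQ_surjective v
  have hz : A' ∈ map f (sectorFaceGerm z (𝔸.facetOf ε 1 J)) := h.val_apply_mkQ z ▸ hG.2
  obtain ⟨n, hn, hc⟩ := apt_mem_map_chimneyGerm hJ h.apt_mem hA' h.isom_mem hz
  have hF := isVectorialFacet_facetOf_one (R := 𝔸.toRootBasis) ε J
  refine ⟨_, (mem_facadeFacets_iff hJ h₀).2 ⟨A, f, g, z + n, _, h, hF, rfl⟩, fun T hT => ?_,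
    inter_mem (facadeApt_mem_facadeFilter (apt_mem_map h.apt_mem h.isom_mem _))
      (facadeApt_mem_facadeFilter hc)⟩
  obtain ⟨S, hS, hsub⟩ := mem_facadeFilter.1 hT
  refine hsub _ ?_
  rw [← mkQ_add_of_mem_VJ z hn, h.val_apply_mkQ]
  exact map_mono (sectorFaceGerm_le_chimneyGerm hJ _ hF) hS

lemma exists_facadeIsom_eqOn (hJ : 𝔸.IsSpherical J) (h₀ : ℐ.IsSectorFaceGerm ε J F₀)
    {B B' : Set (ℐ.Facade F₀)} (hB : B ∈ ℐ.facadeApts F₀) (hB' : B' ∈ ℐ.facadeApts F₀)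
    {𝓕 𝓕' : Filter (ℐ.Facade F₀)} (h𝓕 : 𝓕 ∈ ℐ.facadeFacets F₀) (h𝓕' : 𝓕' ∈ ℐ.facadeFacets F₀)
    (hm : B ∩ B' ∈ 𝓕) (hm' : B ∩ B' ∈ 𝓕') :
    ∃ g ∈ ℐ.facadeIsom ε J F₀ B, ∃ g' ∈ ℐ.facadeIsom ε J F₀ B',
      (∃ S ∈ 𝓕, ∀ v, g v ∈ S → g' v = g v) ∧ ∃ S ∈ 𝓕', ∀ v, g v ∈ S → g' v = g v := by
  obtain ⟨A, f, g, h, rfl⟩ := exists_induces_of_mem_facadeApts hJ h₀ hB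
  obtain ⟨A', hA', -, rfl⟩ := hB'
  obtain ⟨x, F, hF, rfl, hc⟩ := h.exists_facadeFilter_eq hJ h₀ hA' h𝓕 hm
  obtain ⟨y, F', hF', rfl, hc'⟩ := h.exists_facadeFilter_eq hJ h₀ hA' h𝓕' hm'
  obtain ⟨f', hf', S, -, hS, hS', hEq⟩ :=
    exists_isom_eqOn_of_mem_chimneyGerm hJ h.apt_mem hA' h.isom_mem hF hF' hc hc'
  obtain ⟨g', h'⟩ := h.exists_of_eqOn hJ h₀ hA' hf' hEq (sectorFaceGerm_le_chimneyGerm hJ x hF hS)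
  have hfix (v : V ⧸ 𝔸.VJ J) (hv : g v ∈ ℐ.facadeApt F₀ (f '' S)) : g' v = g v := by
    obtain ⟨z, rfl⟩ := (𝔸.VJ J).mkQ_surjective v
    exact h.apply_mkQ_eq_of_eqOn h' hEq (h.image_mem_val_iff.1 hv)
  exact ⟨g, h.mem_facadeIsom, g', h'.mem_facadeIsom,
    ⟨_, facadeApt_mem_facadeFilter (image_mem_map hS), hfix⟩,
    ⟨_, facadeApt_mem_facadeFilter (image_mem_map hS'), hfix⟩⟩

end Masure

theorem proposition4p3 {V : Type*} [NormedAddCommGroup V] [NormedSpace ℝ V]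
    [FiniteDimensional ℝ V] {I : Type*} [Fintype I] (𝔸 : ModelApartment V I)
    {X : Type*} (ℐ : Masure 𝔸 X) (ε : ℤˣ) (J : Set I) (hJ : 𝔸.IsSpherical J)
    (F₀ : Filter X) (hF₀ : ℐ.IsSectorFaceGerm ε J F₀) :
    ∃ B : LinearMap.BilinForm ℝ (V ⧸ 𝔸.VJ J),
      EuclideanBuilding.IsEuclideanBuilding B (𝔸.wallsJ J) (𝔸.WJ J)
        (ℐ.facadeApts F₀) (ℐ.facadeIsom ε J F₀) (ℐ.facadeFacets F₀) :=
  ⟨ModelApartment.formBar hJ, {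
    apartment := ModelApartment.isEuclideanApartment hJ
    weyl_le := ModelApartment.weylGroup_le_WJ hJ
    linear_mem _ hg := ModelApartment.linear_mem_vectorialWeylGroup hJ hg
    isometry _ hg x y := ModelApartment.formBar_sub_sub hJ hg x y
    walls_stable _ hg _ hM := ModelApartment.image_mem_wallsJ hg hM
    cover := Masure.sUnion_facadeApts F₀
    I0 _ hB := Masure.facadeIsom_nonempty_and_forall hJ hF₀ hB
    I0_facets _ _ _ hg := Masure.mem_facadeFacets_and_mem_iff hJ hF₀ hg
    I1 _ h𝓕 _ h𝓕' := Masure.exists_facadeApts_mem_mem hJ hF₀ h𝓕 h𝓕'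
    I2_union _ hB _ hB' _ hG := Masure.exists_facadeFacets_of_mem_inter hJ hF₀ hB hB' hG
    I2_isom _ hB _ hB' _ h𝓕 _ h𝓕' hm hm' :=
      Masure.exists_facadeIsom_eqOn hJ hF₀ hB hB' h𝓕 h𝓕' hm hm' }⟩
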